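/- **Setting.** Let $X$ be a Riemannian manifold with Levi-Civita connection, let $W$ be a real Euclidean vector bundle of rank $2l$ over $X$ with a Euclidean connection, and let $\xi$ be an oriented real Euclidean plane bundle over $X$ with a Euclidean connection and Euler form $c=e(\xi)$. Let $R^{TX},R^W$ be the curvatures of $TX$ and $W$, let $p_1$ be the first Pontryagin form, and let $\widehat A(TX)=\det^{1/2}\left(\frac{\frac{\sqrt{-1}}{4\pi}R^{TX}}{\sinh(\frac{\sqrt{-1}}{4\pi}R^{TX})}\right)$. For a complex bundle $F$ let $\Lambda_t(F)=\sum_k t^k\Lambda^k F$ and $S_t(F)=\sum_k t^kS^kF$, extended to virtual bundles by $\Lambda_t(F-G)=\Lambda_t(F)/\Lambda_t(G)$ and $S_t(F-G)=S_t(F)/S_t(G)$, with the induced connections; let $\widetilde F=F-\dim F$, and write $T_{\mathbf C}X,W_{\mathbf C},\xi_{\mathbf C}$ for complexifications. Put $q=e^{2\pi\sqrt{-1}\tau}$ for $\tau$ in the upper half plane, $E_2(\tau)=1-24\sum_{n\ge1}\big(\sum_{d\mid n}d\big)q^n$, and $$\Theta_1=\bigotimes_{u\ge1}S_{q^u}(\widetilde{T_{\mathbf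 C}X})\otimes\bigotimes_{v\ge1}\Lambda_{q^v}(\widetilde{W_{\mathbf C}}-2\widetilde{\xi_{\mathbf C}})\otimes\bigotimes_{r\ge1}\Lambda_{q^{r-1/2}}(\widetilde{\xi_{\mathbf C}})\otimes\bigotimes_{s\ge1}\Lambda_{-q^{s-1/2}}(\widetilde{\xi_{\mathbf C}}),$$ $$\Theta_2=\bigotimes_{u\ge1}S_{q^u}(\widetilde{T_{\mathbf C}X})\otimes\bigotimes_{v\ge1}\Lambda_{-q^{v-1/2}}(\widetilde{W_{\mathbf C}}-2\widetilde{\xi_{\mathbf C}})\otimes\bigotimes_{r\ge1}\Lambda_{q^{r-1/2}}(\widetilde{\xi_{\mathbf C}})\otimes\bigotimes_{s\ge1}\Lambda_{q^{s}}(\widetilde{\xi_{\mathbf C}}).$$ Let $p=p_1(TX)-p_1(W)$, let $\{\omega\}^{(j)}$ be the degree $j$ component of a form $\omega$ (zero for $j<0$), and for an integer $j$ set $$F_1^{(j)}(\tau)=\left\{e^{\frac1{24}E_2(\tau)p}\,\frac{\widehat A(TX)\,\det^{1/2}\!\big(2\cosh(\tfrac{\sqrt{-1}}{4\pi}R^W)\big)}{\cosh^2(c/2)}\,\mathrm{ch}(\Theta_1)\right\}^{(j)},$$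 $$F_2^{(j)}(\tau)=\left\{\widehat A(TX)\cosh(\tfrac c2)\,\mathrm{ch}(\Theta_2)\right\}^{(j)},\qquad F_3^{(j)}(\tau)=\left\{\frac{e^{\frac1{24}E_2(\tau)p}-1}{p}\,\widehat A(TX)\cosh(\tfrac c2)\,\mathrm{ch}(\Theta_2)\right\}^{(j)},$$ where $\frac{e^{sp}-1}{p}$ means $\sum_{k\ge0}\frac{s^{k+1}p^k}{(k+1)!}$. A function of $\tau$ with values in differential forms is called a modular form if, at each point $x\in X$, its composition with every linear functional on the complex exterior forms at $x$ is a modular form (holomorphic on the upper half plane and at the cusps, transforming with trivial character). **Proposition.** The $q$-series $\mathrm{ch}(\Theta_1)$ and $\mathrm{ch}(\Theta_2)$ converge at every $\tau$ in the upper half plane. Let $m\ge0$ be an integer. (1) Let $\dim X=8m+4$, and put $P_1=F_1^{(8m+4)}$, $P_2=F_2^{(8m+4)}$, $\Xi_2=F_3^{(8m)}$. Then $P_1$ is a modular form of weight $4m+2$ over $\Gamma_0(2)$, $P_2+(p_1(TX)-p_1(W))\,\Xi_2$ is a modular form of weight $4m+2$ over $\Gamma^0(2)$, and $$P_1\left(-\tfrac1\tau\right)=2^l\tau^{4m+2}\left(P_2(\tau)+(p_1(TX)-p_1(W))\,\Xi_2(\tau)\right).$$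 (2) Let $\dim X=8m$, and put $Q_1=F_1^{(8m)}$, $Q_2=F_2^{(8m)}$, $\Pi_2=F_3^{(8m-4)}$. Then $Q_1$ is a modular form of weight $4m$ over $\Gamma_0(2)$, $Q_2+(p_1(TX)-p_1(W))\,\Pi_2$ is a modular form of weight $4m$ over $\Gamma^0(2)$, and $$Q_1\left(-\tfrac1\tau\right)=2^l\tau^{4m}\left(Q_2(\tau)+(p_1(TX)-p_1(W))\,\Pi_2(\tau)\right).$$ -/

import Mathlib

open Bundle Manifold
open scoped ContDiff Topology MatrixGroups PowerSeries UpperHalfPlane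

noncomputable section

namespace CharForms

/-! ### Differential forms at a point -/

section Forms

variable (T : Type*) [AddCommGroup T] [Module ℝ T]

/-- Complex valued exterior forms on a real vector space `T` (a tangent space): the exterior
algebra, over `ℂ`, of the space of complex valued covectors, i.e. `Λ(T*) ⊗ ℂ`. -/
abbrev CForm : Type _ := ExteriorAlgebra ℂ (T →ₗ[ℝ] ℂ)

/-- Complex valued exterior forms of even degree (the even part of the exterior algebra). -/
abbrev EvenForm : Type _ := ↥(CliffordAlgebra.even (0 : QuadraticForm ℂ (T →ₗ[ℝ] ℂ)))

variable {T}

theorem ι_mul_ι_mul_ι (a b c : T →ₗ[ℝ] ℂ) :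
    (ExteriorAlgebra.ι ℂ a * ExteriorAlgebra.ι ℂ b) * ExteriorAlgebra.ι ℂ c
      = ExteriorAlgebra.ι ℂ c * (ExteriorAlgebra.ι ℂ a * ExteriorAlgebra.ι ℂ b) := by
  have h : ∀ x y : T →ₗ[ℝ] ℂ, ExteriorAlgebra.ι ℂ x * ExteriorAlgebra.ι ℂ y
      = -(ExteriorAlgebra.ι ℂ y * ExteriorAlgebra.ι ℂ x) := fun x y =>
    eq_neg_of_add_eq_zero_left (ExteriorAlgebra.ι_add_mul_swap x y)
  rw [mul_assoc, h b c, mul_neg, ← mul_assoc, h a c, neg_mul, neg_neg, mul_assoc]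

/-- Forms of even degree commute with all forms. -/
theorem evenForm_comm (x : EvenForm T) (y : CForm T) : (x : CForm T) * y = y * (x : CForm T) := by
  obtain ⟨x, hx⟩ := x
  have key : ∀ a b : T →ₗ[ℝ] ℂ, ∀ y : CForm T,
      (ExteriorAlgebra.ι ℂ a * ExteriorAlgebra.ι ℂ b) * y
        = y * (ExteriorAlgebra.ι ℂ a * ExteriorAlgebra.ι ℂ b) := by
    intro a b y
    induction y using ExteriorAlgebra.induction with
    | algebraMap r => exact (Algebra.commutes r _).symm
    | ι c => exact ι_mul_ι_mul_ι a b c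
    | mul u v hu hv => rw [← mul_assoc, hu, mul_assoc, hv, mul_assoc]
    | add u v hu hv => rw [mul_add, add_mul, hu, hv]
  change x * y = y * x
  induction x, hx using CliffordAlgebra.even_induction with
  | algebraMap r => exact Algebra.commutes r _
  | add u v _ _ hu hv => rw [mul_add, add_mul, hu, hv]
  | ι_mul_ι_mul a b u _ hu =>
    have h := key a b
    change (ExteriorAlgebra.ι ℂ a * ExteriorAlgebra.ι ℂ b * u) * y
      = y * (ExteriorAlgebra.ι ℂ a * ExteriorAlgebra.ι ℂ b * u)
    rw [mul_assoc, hu, ← mul_assoc, h, mul_assoc]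

instance : CommRing (EvenForm T) :=
  { (inferInstance : Ring (EvenForm T)) with
    mul_comm := fun x y => Subtype.ext (evenForm_comm x (y : CForm T)) }

/-- The `2`-form `∑_{a<b} r(e_a, e_b) e^a ∧ e^b = ½ ∑_{a,b} r(e_a, e_b) e^a ∧ e^b` of an alternating
bilinear function `r` on `T`; here `(e_a)` is a basis of `T` and `(e^a)` its dual basis. -/
def twoForm [FiniteDimensional ℝ T] (r : T → T → ℝ) : EvenForm T :=
  let e := Module.finBasis ℝ T
  let dual := fun a => (Complex.ofRealAm.toLinearMap ∘ₗ e.coord a : T →ₗ[ℝ] ℂ)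
  (1 / 2 : ℂ) • ∑ a, ∑ b, (r (e a) (e b) : ℂ) •
    (CliffordAlgebra.even.ι (0 : QuadraticForm ℂ (T →ₗ[ℝ] ℂ))).bilin (dual a) (dual b)

/-- The component `η^{(j)}` of degree `j` of a form `η` (zero if `j` is negative). -/
def formPart (j : ℤ) (η : CForm T) : CForm T :=
  if 0 ≤ j then
    GradedRing.proj (fun i : ℕ => ⋀[ℂ]^i (T →ₗ[ℝ] ℂ)) j.toNat η
  else 0

end Forms

/-! ### Chern-Weil theory for a matrix of forms

`A` is a commutative algebra (the even forms at a point) and `R` is the curvature matrix of a vector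
bundle with connection in a frame. -/

section Algebra

/-- The value `f(b) = ∑ f_k b^k` of a formal power series at a nilpotent element. -/
def nilEval {B : Type*} [Ring B] [Algebra ℂ B] (f : ℂ⟦X⟧) (b : B) : B :=
  ∑ k ∈ Finset.range (nilpotencyClass b), PowerSeries.coeff k f • b ^ k

/-- `exp x` -/
def expSeries : ℂ⟦X⟧ := PowerSeries.exp ℂ

/-- `log (1 + x)` -/
def logSeries : ℂ⟦X⟧ := PowerSeries.mk fun k => if k = 0 then 0 else (-1) ^ (k + 1) / k

/-- `cosh x` -/
def coshSeries : ℂ⟦X⟧ := PowerSeries.mk fun k => if Even k then 1 / (k.factorial : ℂ) else 0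

/-- `(sinh x) / x` -/
def sinhcSeries : ℂ⟦X⟧ := PowerSeries.mk fun k => if Even k then 1 / ((k + 1).factorial : ℂ) else 0

/-- `(exp (s x) - 1) / x` -/
def expQuotSeries (s : ℂ) : ℂ⟦X⟧ :=
  PowerSeries.mk fun k => s ^ (k + 1) / ((k + 1).factorial : ℂ)

variable {A : Type*} [CommRing A] [Algebra ℂ A] {n : ℕ}

/-- `det^{1/2}(M) = exp(½ tr log M)` for a matrix `M` which is the identity plus a nilpotent. -/
def sqrtDet (M : Matrix (Fin n) (Fin n) A) : A :=
  nilEval expSeries ((1 / 2 : ℂ) • (nilEval logSeries (M - 1)).trace)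

/-- The first Pontryagin form `-(1/8π²) tr(R²)`. -/
def pontryaginOne (R : Matrix (Fin n) (Fin n) A) : A :=
  (-(1 / (8 * (Real.pi : ℂ) ^ 2))) • (R * R).trace

/-- The form `Â = det^{1/2}(x / sinh x)`, `x = (√-1/4π) R`. -/
def aHat (R : Matrix (Fin n) (Fin n) A) : A :=
  sqrtDet (nilEval sinhcSeries⁻¹ ((Complex.I / (4 * Real.pi)) • R))

/-- The form `det^{1/2}(2 cosh((√-1/4π) R))` for a bundle of rank `2l`; the factor `2` contributes
`(2^{2l})^{1/2} = 2^l`. -/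
def sqrtDetTwoCosh (l : ℕ) (R : Matrix (Fin n) (Fin n) A) : A :=
  (2 ^ l : ℂ) • sqrtDet (nilEval coshSeries ((Complex.I / (4 * Real.pi)) • R))

/-- The derivation extension of an endomorphism `f` of `M` to `Λ^k M`:
`v₁ ∧ ⋯ ∧ v_k ↦ ∑_i v₁ ∧ ⋯ ∧ f v_i ∧ ⋯ ∧ v_k`. If `f` is the curvature of a vector bundle with
connection, this is the curvature of the induced connection on its `k`-th exterior power. -/
def extDer {M : Type*} [AddCommGroup M] [Module A M] (f : M →ₗ[A] M) (k : ℕ) :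
    Module.End A (⋀[A]^k M) :=
  exteriorPower.alternatingMapLinearEquiv
    { toMultilinearMap := ∑ i : Fin k,
        (exteriorPower.ιMulti A k (M := M)).toMultilinearMap.compLinearMap
          (Function.update (fun _ => LinearMap.id) i f)
      map_eq_zero_of_eq' := by
        intro v a b hab hne
        have hval : ∀ i : Fin k, (fun c => (Function.update (fun _ => LinearMap.id) i f :
            Fin k → M →ₗ[A] M) c (v c)) = Function.update v i (f (v i)) := by
          intro i
          funext c
          by_cases hc : c = i
          · subst hc; simp
          · simp [hc]
        simp only [MultilinearMap.toFun_eq_coe, _root_.sum_apply,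
          MultilinearMap.compLinearMap_apply, hval, AlternatingMap.coe_multilinearMap]
        rw [← Finset.sum_subset (Finset.subset_univ {a, b}), Finset.sum_pair hne]
        · have h1 : Function.update v b (f (v b))
              = Function.update v a (f (v a)) ∘ Equiv.swap a b := by
            funext c
            by_cases hca : c = a
            · subst hca; simp [hne, hne.symm, hab]
            · by_cases hcb : c = b
              · subst hcb; simp [hab]
              · simp [hca, hcb, Equiv.swap_apply_of_ne_of_ne hca hcb]
          rw [h1, AlternatingMap.map_swap _ _ hne, add_neg_cancel]
        · intro c _ hc
          simp only [Finset.mem_insert, Finset.mem_singleton, not_or] at hc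
          refine AlternatingMap.map_eq_zero_of_eq _ _ (i := a) (j := b) ?_ hne
          rw [Function.update_of_ne (Ne.symm hc.1), Function.update_of_ne (Ne.symm hc.2), hab] }

/-- The matrix, in the basis of monomials of degree `k`, of the derivation extension
`e_j ↦ ∑_i R_{ij} e_i` of `R` to the `k`-th symmetric power, realised as the homogeneous polynomials
of degree `k` in the `e_j`. If `R` is the curvature of a vector bundle with connection, this is the
curvature of the induced connection on its `k`-th symmetric power. -/
def symDer (R : Matrix (Fin n) (Fin n) A) (k : ℕ) :
    Matrix ↥(Finset.finsuppAntidiag (Finset.univ : Finset (Fin n)) k)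
      ↥(Finset.finsuppAntidiag (Finset.univ : Finset (Fin n)) k) A :=
  Matrix.of fun s t => MvPolynomial.coeff s.1
    (MvPolynomial.mkDerivation A
      (fun j => ∑ i, MvPolynomial.C (R i j) * (MvPolynomial.X i : MvPolynomial (Fin n) A))
      (MvPolynomial.monomial t.1 1))

/-- `ch(Λ_t(E)) = ∑_k t^k ch(Λ^k E)`, with `ch(Λ^k E) = tr exp((√-1/2π) R^{Λ^k E})`, as a power
series in `t`, for a complex vector bundle `E` with curvature matrix `R`. -/
def chLambda (R : Matrix (Fin n) (Fin n) A) : A⟦X⟧ :=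
  PowerSeries.mk fun k => LinearMap.trace A (⋀[A]^k (Fin n → A))
    (nilEval expSeries ((Complex.I / (2 * Real.pi)) • extDer (Matrix.toLin' R) k))

/-- `ch(S_t(E)) = ∑_k t^k ch(S^k E)`, with `ch(S^k E) = tr exp((√-1/2π) R^{S^k E})`, as a power
series in `t`, for a complex vector bundle `E` with curvature matrix `R`. -/
def chSym (R : Matrix (Fin n) (Fin n) A) : A⟦X⟧ :=
  PowerSeries.mk fun k =>
    (nilEval expSeries ((Complex.I / (2 * Real.pi)) • symDer R k)).trace

/-- `ch(Λ_t(E - n)) = ch(Λ_t(E)) / ch(Λ_t(ℂⁿ))`, where `n = dim E` and `ℂⁿ` is the flat trivial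
bundle. -/
def chLambdaTilde (R : Matrix (Fin n) (Fin n) A) : A⟦X⟧ :=
  chLambda R * (chLambda (0 : Matrix (Fin n) (Fin n) A)).invOfUnit 1

/-- `ch(S_t(E - n)) = ch(S_t(E)) / ch(S_t(ℂⁿ))`, where `n = dim E`. -/
def chSymTilde (R : Matrix (Fin n) (Fin n) A) : A⟦X⟧ :=
  chSym R * (chSym (0 : Matrix (Fin n) (Fin n) A)).invOfUnit 1

/-- The substitution `t = ε s^k` (`k ≥ 1`) in a power series in `t`. -/
def atPow (ε : A) (k : ℕ) (F : A⟦X⟧) : A⟦X⟧ :=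
  PowerSeries.subst (PowerSeries.C ε * (PowerSeries.X : A⟦X⟧) ^ k) F

/-- The infinite product `∏_{i ≥ 0} F_i` of power series in `s`, where `F_i ≡ 1` modulo `s^{i+1}`:
its coefficient of `s^N` is that of `∏_{i ≤ N} F_i`. -/
def seriesProd (F : ℕ → A⟦X⟧) : A⟦X⟧ :=
  PowerSeries.mk fun N => PowerSeries.coeff N (∏ i ∈ Finset.range (N + 1), F i)

variable {dT dW dξ : ℕ}

/-- `ch(Θ₁)` as a power series in `s = q^{1/2}`, for curvature matrices `RT`, `RW`, `Rξ` of the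
tangent bundle, of `W` and of `ξ`. -/
def chTheta₁ (RT : Matrix (Fin dT) (Fin dT) A) (RW : Matrix (Fin dW) (Fin dW) A)
    (Rξ : Matrix (Fin dξ) (Fin dξ) A) : A⟦X⟧ :=
  seriesProd (fun i => atPow 1 (2 * (i + 1)) (chSymTilde RT)) *
  seriesProd (fun i => atPow 1 (2 * (i + 1))
    (chLambdaTilde RW * ((chLambdaTilde Rξ) ^ 2).invOfUnit 1)) *
  seriesProd (fun i => atPow 1 (2 * i + 1) (chLambdaTilde Rξ)) *
  seriesProd (fun i => atPow (-1) (2 * i + 1) (chLambdaTilde Rξ))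

/-- `ch(Θ₂)` as a power series in `s = q^{1/2}`. -/
def chTheta₂ (RT : Matrix (Fin dT) (Fin dT) A) (RW : Matrix (Fin dW) (Fin dW) A)
    (Rξ : Matrix (Fin dξ) (Fin dξ) A) : A⟦X⟧ :=
  seriesProd (fun i => atPow 1 (2 * (i + 1)) (chSymTilde RT)) *
  seriesProd (fun i => atPow (-1) (2 * i + 1)
    (chLambdaTilde RW * ((chLambdaTilde Rξ) ^ 2).invOfUnit 1)) *
  seriesProd (fun i => atPow 1 (2 * i + 1) (chLambdaTilde Rξ)) *
  seriesProd (fun i => atPow 1 (2 * (i + 1)) (chLambdaTilde Rξ))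

/-- The terms `a_j q^{j/2}`, `q = e^{2π√-1τ}`, of the `q`-series `∑_j a_j q^{j/2}`. -/
def qTerm (F : A⟦X⟧) (τ : ℍ) (j : ℕ) : A :=
  Complex.exp (Real.pi * Complex.I * τ * j) • PowerSeries.coeff j F

/-- The `q`-series converges (unconditionally) at every point of the upper half plane, for the
canonical (module) topology of `A`. -/
def QConverges (F : A⟦X⟧) : Prop :=
  letI : TopologicalSpace A := moduleTopology ℂ A
  ∀ τ : ℍ, Summable (qTerm F τ)

/-- The sum of a `q`-series at `τ`. -/
def qEval (F : A⟦X⟧) (τ : ℍ) : A :=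
  letI : TopologicalSpace A := moduleTopology ℂ A
  ∑' j : ℕ, qTerm F τ j

end Algebra

/-! ### The forms `P₁`, `P₂`, `Ξ₂` (and `Q₁`, `Q₂`, `Π₂`) at a point -/

/-- The curvature matrices, in some frames at a point with tangent space `T`, of the tangent bundle,
of `W` and of `ξ`; for `ξ` the frame is orthonormal and positively oriented. -/
structure CurvatureData (T : Type*) [AddCommGroup T] [Module ℝ T] where
  dimT : ℕ
  dimW : ℕ
  RT : Matrix (Fin dimT) (Fin dimT) (EvenForm T)
  RW : Matrix (Fin dimW) (Fin dimW) (EvenForm T)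
  Rξ : Matrix (Fin 2) (Fin 2) (EvenForm T)

namespace CurvatureData

variable {T : Type*} [AddCommGroup T] [Module ℝ T] (D : CurvatureData T)

/-- The Euler form `c = e(ξ) = Pf(R/2π) = R₁₂/2π`. -/
def euler : EvenForm T := (1 / (2 * (Real.pi : ℂ))) • D.Rξ 0 1

/-- `p₁(TX) - p₁(W)` -/
def pDiff : EvenForm T := pontryaginOne D.RT - pontryaginOne D.RW

/-- `ch(Θ₁)` -/
def chΘ₁ : (EvenForm T)⟦X⟧ := chTheta₁ D.RT D.RW D.Rξ

/-- `ch(Θ₂)` -/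
def chΘ₂ : (EvenForm T)⟦X⟧ := chTheta₂ D.RT D.RW D.Rξ

/-- `{ e^{E₂(τ)(p₁(TX)-p₁(W))/24} · Â(TX) det^{1/2}(2cosh(√-1 R^W/4π)) / cosh²(c/2) · ch(Θ₁) }^{(j)}`,
for `W` of rank `2l`. This is `P₁` for `j = 8m+4` and `Q₁` for `j = 8m`. -/
def form₁ (l : ℕ) (j : ℤ) (τ : ℍ) : CForm T :=
  formPart j
    ((nilEval expSeries ((EisensteinSeries.E2 τ / 24) • D.pDiff) *
      (aHat D.RT * sqrtDetTwoCosh l D.RW *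
        nilEval (coshSeries ^ 2)⁻¹ ((1 / 2 : ℂ) • D.euler)) *
      qEval D.chΘ₁ τ : EvenForm T) : CForm T)

/-- `{ Â(TX) cosh(c/2) ch(Θ₂) }^{(j)}`. This is `P₂` for `j = 8m+4` and `Q₂` for `j = 8m`. -/
def form₂ (j : ℤ) (τ : ℍ) : CForm T :=
  formPart j
    ((aHat D.RT * nilEval coshSeries ((1 / 2 : ℂ) • D.euler) * qEval D.chΘ₂ τ : EvenForm T) :
      CForm T)

/-- `{ (e^{E₂(τ)(p₁(TX)-p₁(W))/24} - 1)/(p₁(TX)-p₁(W)) · Â(TX) cosh(c/2) ch(Θ₂) }^{(j)}`. This is `Ξ₂`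
for `j = 8m` and `Π₂` for `j = 8m-4`. -/
def form₃ (j : ℤ) (τ : ℍ) : CForm T :=
  formPart j
    ((nilEval (expQuotSeries (EisensteinSeries.E2 τ / 24)) D.pDiff *
      (aHat D.RT * nilEval coshSeries ((1 / 2 : ℂ) • D.euler)) * qEval D.chΘ₂ τ : EvenForm T) :
      CForm T)

end CurvatureData

/-! ### Curvature of a connection -/

section Geometry

variable {E : Type*} [NormedAddCommGroup E] [NormedSpace ℝ E]
  {H : Type*} [TopologicalSpace H] {I : ModelWithCorners ℝ E H}
  {X : Type*} [TopologicalSpace X] [ChartedSpace H X] [IsManifold I 1 X]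
  {F : Type*} [NormedAddCommGroup F] [NormedSpace ℝ F]
  {V : X → Type*} [TopologicalSpace (TotalSpace F V)]

/-- The curvature `R(u, v) w = ∇_U ∇_V σ - ∇_V ∇_U σ - ∇_{[U,V]} σ` at `x`, where `U`, `V`, `σ` are
local extensions of `u`, `v`, `w`, constant in a local trivialization. (In Mathlib `cov σ x u` is
`(∇_u σ)(x)`.) -/
def curvature [∀ x, AddCommGroup (V x)] [∀ x, Module ℝ (V x)] [∀ x, TopologicalSpace (V x)]
    [∀ x, IsTopologicalAddGroup (V x)] [∀ x, ContinuousSMul ℝ (V x)] [FiberBundle F V]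
    (cov : CovariantDerivative I F V) (x : X) (u v : TangentSpace I x) (w : V x) : V x :=
  let U : Π y : X, TangentSpace I y := FiberBundle.extend E u
  let U' : Π y : X, TangentSpace I y := FiberBundle.extend E v
  let σ : Π y : X, V y := FiberBundle.extend F w
  cov (fun y => cov σ y (U' y)) x u - cov (fun y => cov σ y (U y)) x v
    - cov σ x (VectorField.mlieBracket I U U' x)

variable [∀ x, NormedAddCommGroup (V x)] [∀ x, InnerProductSpace ℝ (V x)] [FiberBundle F V]

/-- The matrix of `2`-forms `R_{ij} = ⟨R e_j, e_i⟩` of the curvature at `x` in an orthonormal basis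
`e` of the fibre. -/
def curvatureMatrix [FiniteDimensional ℝ E] (cov : CovariantDerivative I F V) (x : X) {n : ℕ}
    (e : OrthonormalBasis (Fin n) ℝ (V x)) :
    Matrix (Fin n) (Fin n) (EvenForm (TangentSpace I x)) :=
  haveI : FiniteDimensional ℝ (TangentSpace I x) := inferInstanceAs (FiniteDimensional ℝ E)
  Matrix.of fun i j => twoForm fun u v => inner ℝ (curvature cov x u v (e j)) (e i)

/-- An orientation of a vector bundle of rank `n`: orientations of the fibres, locally constant in
local trivializations. -/
structure BundleOrientation (F : Type*) [NormedAddCommGroup F] [NormedSpace ℝ F]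
    (V : X → Type*) [TopologicalSpace (TotalSpace F V)] [∀ x, NormedAddCommGroup (V x)]
    [∀ x, InnerProductSpace ℝ (V x)] [FiberBundle F V] [VectorBundle ℝ F V] (n : ℕ) where
  orientation : ∀ x, Orientation ℝ (V x) (Fin n)
  locallyConstant : ∀ x, ∀ᶠ y in 𝓝 x, ∃ hy : y ∈ (trivializationAt F V x).baseSet,
    Orientation.map (Fin n)
        ((trivializationAt F V x).continuousLinearEquivAt ℝ y hy).toLinearEquiv (orientation y) =
      Orientation.map (Fin n)
        ((trivializationAt F V x).continuousLinearEquivAt ℝ x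
          (FiberBundle.mem_baseSet_trivializationAt' x)).toLinearEquiv (orientation x)

end Geometry

section Global

variable {d : ℕ} {X : Type*} [TopologicalSpace X] [ChartedSpace (EuclideanSpace ℝ (Fin d)) X]
  [IsManifold (𝓡 d) ∞ X]
  [RiemannianBundle (fun x : X => TangentSpace (𝓡 d) x)]
  [IsContMDiffRiemannianBundle (𝓡 d) ∞ (EuclideanSpace ℝ (Fin d))
    (fun x : X => TangentSpace (𝓡 d) x)]

/-- The Levi-Civita connection: compatible with the metric and torsion free. -/
def IsLeviCivita (cov : CovariantDerivative (𝓡 d) (EuclideanSpace ℝ (Fin d))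
    (fun x : X => TangentSpace (𝓡 d) x)) : Prop :=
  haveI : IsContMDiffRiemannianBundle (𝓡 d) 1 (EuclideanSpace ℝ (Fin d))
      (fun x : X => TangentSpace (𝓡 d) x) := .of_le (n := ∞) (by decide)
  cov.IsMetricCompatible ∧ cov.torsion = 0

variable {l : ℕ}
  {W : X → Type*} [TopologicalSpace (TotalSpace (EuclideanSpace ℝ (Fin (2 * l))) W)]
  [∀ x, NormedAddCommGroup (W x)] [∀ x, InnerProductSpace ℝ (W x)]
  [FiberBundle (EuclideanSpace ℝ (Fin (2 * l))) W]
  [VectorBundle ℝ (EuclideanSpace ℝ (Fin (2 * l))) W]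
  {ξ : X → Type*} [TopologicalSpace (TotalSpace (EuclideanSpace ℝ (Fin 2)) ξ)]
  [∀ x, NormedAddCommGroup (ξ x)] [∀ x, InnerProductSpace ℝ (ξ x)]
  [FiberBundle (EuclideanSpace ℝ (Fin 2)) ξ] [VectorBundle ℝ (EuclideanSpace ℝ (Fin 2)) ξ]

/-- The curvature matrices at `x` of connections on `TX`, `W` and the oriented plane bundle `ξ`. -/
def curvatureData
    (covT : CovariantDerivative (𝓡 d) (EuclideanSpace ℝ (Fin d))
      (fun x : X => TangentSpace (𝓡 d) x))
    (covW : CovariantDerivative (𝓡 d) (EuclideanSpace ℝ (Fin (2 * l))) W)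
    (covξ : CovariantDerivative (𝓡 d) (EuclideanSpace ℝ (Fin 2)) ξ)
    (o : BundleOrientation (EuclideanSpace ℝ (Fin 2)) ξ 2) (x : X) :
    CurvatureData (TangentSpace (𝓡 d) x) :=
  haveI : FiniteDimensional ℝ (TangentSpace (𝓡 d) x) :=
    inferInstanceAs (FiniteDimensional ℝ (EuclideanSpace ℝ (Fin d)))
  haveI : FiniteDimensional ℝ (W x) :=
    VectorBundle.finiteDimensional ℝ (EuclideanSpace ℝ (Fin (2 * l))) W x
  { dimT := Module.finrank ℝ (TangentSpace (𝓡 d) x)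
    dimW := Module.finrank ℝ (W x)
    RT := curvatureMatrix covT x (stdOrthonormalBasis ℝ (TangentSpace (𝓡 d) x))
    RW := curvatureMatrix covW x (stdOrthonormalBasis ℝ (W x))
    Rξ := curvatureMatrix covξ x ((o.orientation x).finOrthonormalBasis two_pos
      ((VectorBundle.finrank_eq ℝ (EuclideanSpace ℝ (Fin 2)) ξ x).trans
        finrank_euclideanSpace_fin)) }

end Global

/-! ### Modular forms with values in a vector space -/

/-- The subgroup `Γ⁰(2)` of `SL₂(ℤ)` of the matrices whose upper right entry is even. -/
def GammaUpper0 : Subgroup SL(2, ℤ) where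
  carrier := {g | ((g 0 1 : ℤ) : ZMod 2) = 0}
  one_mem' := by simp
  mul_mem' := by
    intro a b ha hb
    simp only [Set.mem_ofPred_eq] at ha hb ⊢
    simp [Matrix.mul_apply, Fin.sum_univ_two, ha, hb]
  inv_mem' := by
    intro a ha
    simp only [Set.mem_ofPred_eq] at ha ⊢
    simp [Matrix.SpecialLinearGroup.SL2_inv_expl, ha]

/-- `F` is a modular form of weight `k` over `Γ` with values in the complex vector space `V`: for
every linear functional `φ` on `V`, `φ ∘ F` is a modular form of weight `k` over `Γ` (holomorphic on
the upper half plane, holomorphic at the cusps, invariant with trivial character). -/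
def IsModularFormValued (Γ : Subgroup SL(2, ℤ)) (k : ℤ) {V : Type*} [AddCommGroup V] [Module ℂ V]
    (F : ℍ → V) : Prop :=
  ∀ φ : V →ₗ[ℂ] ℂ, ∃ f : ModularForm (Γ.map (Matrix.SpecialLinearGroup.mapGL ℝ)) k,
    ∀ τ : ℍ, f τ = φ (F τ)

end CharForms

end

open CharForms

/-!
The curvature forms have degree two, so they are nilpotent, and every multiplicative characteristic
form is the exponential of a combination `∑ f_k tr(X^k) / k!` of power sums of the Chern matrices
`X = (√-1/2π) R` of the three bundles. For `Â`, `det^{1/2}(2 cosh)` and the powers of `cosh(c/2)`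
the coefficients `f_k` are Bernoulli numbers (`aHat_eq`, `sqrtDetTwoCosh_eq`,
`nilEval_cosh_euler`). For `ch(S_t(E))` and `ch(Λ_t(E))` the statement is Newton's identity for the
traces of the exponential on symmetric and exterior powers (`chSymTilde_eq`, `chLambdaTilde_eq`),
and the products over the powers of `q` turn the coefficients into the divisor sums
`∑_n (∑_{d ∣ n} d^{k-1}) q^n` (`chTheta_eq`, `qEval_chTheta`). Together the two contributions make
up Eisenstein series of weight `k`, at `τ`, `2τ` and `τ/2`. For `k = 2` these are not modular, but
the factor `e^{E₂ p / 24}` changes their coefficients into combinations that are, such as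
`E₂(τ) - 2 E₂(2τ)`. The result is that the coefficients in the first total exponent are modular
forms of weight `k` over `Γ₀(2)`, and that `τ ↦ -1/τ` takes them to the coefficients in the second
one (`exp_mul_expand_eq_total₁`, `exp_mul_expand_eq_total₂`, `isModularPair_coef`). Here only even
`k` matter: the power sums with `k` odd vanish, because the curvature of a metric connection is
skew-symmetric (`inner_curvature`).

Since `tr(X^k)` has degree `2k`, the exponents lie in the algebra spanned by the pairs
`(f v, (f|S) v)` with `f` modular over `Γ₀(2)` and `v` a form of degree twice the weight of `f`
(`gradedPairs`). So do their exponentials, and hence the component of degree `2k` is modular of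
weight `k`, for every `k` (`isModularPair_formPart`).
-/

noncomputable section

namespace CharForms

/-! ### Power series evaluated at nilpotent elements -/

section NilEval

open PowerSeries

variable {B : Type*} [Ring B] [Algebra ℂ B]

theorem nilEval_eq_sum (f : ℂ⟦X⟧) {b : B} {N : ℕ} (h : b ^ N = 0) :
    nilEval f b = ∑ k ∈ Finset.range N, coeff k f • b ^ k := by
  rw [nilEval]
  refine Finset.sum_subset (Finset.range_mono (csInf_le' h)) fun k _ hk => ?_
  rw [pow_eq_zero_of_le (not_lt.1 (by simpa using hk)) (pow_nilpotencyClass ⟨N, h⟩), smul_zero]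

theorem nilEval_add (b : B) (f g : ℂ⟦X⟧) :
    nilEval (f + g) b = nilEval f b + nilEval g b := by
  simp only [nilEval, map_add, add_smul, Finset.sum_add_distrib]

theorem nilEval_smul (c : ℂ) (f : ℂ⟦X⟧) (b : B) : nilEval (c • f) b = c • nilEval f b := by
  simp only [nilEval, coeff_smul, smul_eq_mul, mul_smul, Finset.smul_sum]

theorem nilEval_coe {b : B} (hb : IsNilpotent b) (p : Polynomial ℂ) :
    nilEval (p : ℂ⟦X⟧) b = Polynomial.aeval b p := by
  obtain ⟨N, hN⟩ := hb
  have h : b ^ (N + (p.natDegree + 1)) = 0 := pow_eq_zero_of_le (Nat.le_add_right _ _) hN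
  rw [nilEval_eq_sum _ h, Polynomial.aeval_eq_sum_range' (show p.natDegree < N + (p.natDegree + 1)
    by omega)]
  simp

theorem nilEval_X_pow_mul {b : B} {N : ℕ} (hb : b ^ N = 0) (f : ℂ⟦X⟧) :
    nilEval (X ^ N * f) b = 0 := by
  rw [nilEval_eq_sum _ hb]
  refine Finset.sum_eq_zero fun k hk => ?_
  rw [coeff_X_pow_mul', if_neg (by simpa using hk), zero_smul]

theorem nilEval_eq_aeval {b : B} {N : ℕ} (hb : b ^ N = 0) {f : ℂ⟦X⟧} {p : Polynomial ℂ}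
    (h : X ^ N ∣ f - (p : ℂ⟦X⟧)) : nilEval f b = Polynomial.aeval b p := by
  obtain ⟨g, hg⟩ := h
  rw [sub_eq_iff_eq_add.1 hg, nilEval_add, nilEval_X_pow_mul hb, zero_add,
    nilEval_coe ⟨N, hb⟩]

theorem X_pow_dvd_sub_trunc (N : ℕ) (f : ℂ⟦X⟧) : X ^ N ∣ f - (trunc N f : ℂ⟦X⟧) := by
  rw [X_pow_dvd_iff]
  intro m hm
  simp [coeff_trunc, hm]

theorem nilEval_mul {b : B} (hb : IsNilpotent b) (f g : ℂ⟦X⟧) :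
    nilEval (f * g) b = nilEval f b * nilEval g b := by
  obtain ⟨N, hN⟩ := hb
  rw [nilEval_eq_aeval hN (X_pow_dvd_sub_trunc N f), nilEval_eq_aeval hN (X_pow_dvd_sub_trunc N g),
    ← map_mul]
  refine nilEval_eq_aeval hN ?_
  rw [Polynomial.coe_mul]
  have e : f * g - (trunc N f : ℂ⟦X⟧) * (trunc N g : ℂ⟦X⟧)
      = (f - trunc N f) * g + trunc N f * (g - trunc N g) := by ring
  rw [e]
  exact dvd_add (Dvd.dvd.mul_right (X_pow_dvd_sub_trunc N f) _)
    (Dvd.dvd.mul_left (X_pow_dvd_sub_trunc N g) _)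

@[simp]
theorem nilEval_one {b : B} (hb : IsNilpotent b) : nilEval (1 : ℂ⟦X⟧) b = 1 := by
  simpa using nilEval_coe hb 1

@[simp]
theorem nilEval_X {b : B} (hb : IsNilpotent b) : nilEval (X : ℂ⟦X⟧) b = b := by
  simpa using nilEval_coe hb Polynomial.X

/-- Evaluation of power series at a nilpotent element, as an algebra homomorphism. -/
def nilHom {b : B} (hb : IsNilpotent b) : ℂ⟦X⟧ →ₐ[ℂ] B where
  toFun f := nilEval f b
  map_one' := nilEval_one hb
  map_mul' := nilEval_mul hb
  map_zero' := by simp [nilEval]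
  map_add' := nilEval_add b
  commutes' c := by
    rw [Algebra.algebraMap_eq_smul_one, nilEval_smul, nilEval_one hb,
      Algebra.algebraMap_eq_smul_one]

theorem nilHom_apply {b : B} (hb : IsNilpotent b) (f : ℂ⟦X⟧) : nilHom hb f = nilEval f b := rfl

theorem map_nilEval {B' F : Type*} [Ring B'] [Algebra ℂ B'] [FunLike F B B'] [AlgHomClass F ℂ B B']
    (ψ : F) {b : B} (hb : IsNilpotent b) (f : ℂ⟦X⟧) : ψ (nilEval f b) = nilEval f (ψ b) := by
  obtain ⟨N, hN⟩ := hb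
  have hN' : ψ b ^ N = 0 := by rw [← map_pow, hN, map_zero]
  rw [nilEval_eq_sum f hN, nilEval_eq_sum f hN', map_sum]
  simp

theorem isNilpotent_nilEval {b : B} (hb : IsNilpotent b) {f : ℂ⟦X⟧} (hf : constantCoeff f = 0) :
    IsNilpotent (nilEval f b) := by
  obtain ⟨g, rfl⟩ := X_dvd_iff.2 hf
  rw [nilEval_mul hb, nilEval_X hb]
  refine Commute.isNilpotent_mul_right ?_ hb
  have h := (Commute.all X g).map (nilHom hb)
  rwa [nilHom_apply, nilHom_apply, nilEval_X hb] at h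

theorem nilEval_subst {b : B} (hb : IsNilpotent b) {g : ℂ⟦X⟧} (hg : constantCoeff g = 0)
    (f : ℂ⟦X⟧) : nilEval (f.subst g) b = nilEval f (nilEval g b) := by
  obtain ⟨N, hN⟩ := hb
  have hb : IsNilpotent b := ⟨N, hN⟩
  have hs : HasSubst g := HasSubst.of_constantCoeff_zero' hg
  obtain ⟨h, hh⟩ := X_pow_dvd_sub_trunc N f
  have hgN : nilEval g b ^ N = 0 := by
    obtain ⟨g, rfl⟩ := X_dvd_iff.2 hg
    rw [← nilHom_apply hb, ← map_pow, mul_pow, nilHom_apply, nilEval_X_pow_mul hN]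
  have e := congrArg (fun u => nilHom hb (substAlgHom hs u)) (sub_eq_iff_eq_add.1 hh)
  simp only [map_add, map_mul, map_pow, coe_substAlgHom, subst_X hs, nilHom_apply, hgN, zero_mul,
    zero_add] at e
  rw [e, nilEval_eq_aeval hgN (X_pow_dvd_sub_trunc N f)]
  rw [← nilHom_apply hb g, Polynomial.aeval_algHom_apply, ← nilHom_apply hb]
  congr 1
  exact subst_coe hs (p := trunc N f)

theorem nilEval_const_smul {b : B} (c : ℂ) (hb : IsNilpotent b) (f : ℂ⟦X⟧) :
    nilEval f (c • b) = nilEval (rescale c f) b := by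
  obtain ⟨N, hN⟩ := hb
  have h : (c • b) ^ N = 0 := by rw [smul_pow, hN, smul_zero]
  rw [nilEval_eq_sum _ hN, nilEval_eq_sum _ h]
  refine Finset.sum_congr rfl fun k _ => ?_
  rw [smul_pow, smul_smul, coeff_rescale, mul_comm]

/-- Evaluation of power series at a nilpotent endomorphism commutes with intertwining maps. -/
theorem nilEval_intertwine {R M N : Type*} [CommRing R] [Algebra ℂ R] [AddCommGroup M] [Module R M]
    [AddCommGroup N] [Module R N] [Module ℂ M] [IsScalarTower ℂ R M] [SMulCommClass R ℂ M]
    [Module ℂ N] [IsScalarTower ℂ R N] [SMulCommClass R ℂ N] {fM : Module.End R M}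
    {fN : Module.End R N} (hM : IsNilpotent fM) (hN : IsNilpotent fN) {g : M →ₗ[R] N}
    (h : fN ∘ₗ g = g ∘ₗ fM) (f : ℂ⟦X⟧) : nilEval f fN ∘ₗ g = g ∘ₗ nilEval f fM := by
  obtain ⟨a, ha⟩ := hM
  obtain ⟨b, hb⟩ := hN
  have ha' : fM ^ (a + b) = 0 := pow_eq_zero_of_le (by omega) ha
  have hb' : fN ^ (a + b) = 0 := pow_eq_zero_of_le (by omega) hb
  rw [nilEval_eq_sum f ha', nilEval_eq_sum f hb']
  ext m
  have key (i : ℕ) : (fN ^ i) (g m) = g ((fM ^ i) m) := by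
    simpa using LinearMap.congr_fun (Module.End.commute_pow_left_of_commute h i) m
  simp [key, ← algebraMap_smul R]

theorem nilEval_exp_eq [Module ℚ B] (b : B) : nilEval expSeries b = IsNilpotent.exp b := by
  rw [nilEval, IsNilpotent.exp]
  refine Finset.sum_congr rfl fun k _ => ?_
  rw [expSeries, coeff_exp, one_div]
  have := Rat.cast_smul_eq_qsmul ℂ ((k.factorial : ℚ)⁻¹) (b ^ k)
  rw [← this]
  rfl

theorem nilEval_exp_add {a b : B} (h : Commute a b) (ha : IsNilpotent a) (hb : IsNilpotent b) :
    nilEval expSeries (a + b) = nilEval expSeries a * nilEval expSeries b := by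
  let : Module ℚ B := Module.compHom B (algebraMap ℚ ℂ)
  simp only [nilEval_exp_eq]
  exact IsNilpotent.exp_add_of_commute h ha hb

@[simp]
theorem nilEval_exp_zero : nilEval expSeries (0 : B) = 1 := by
  rw [nilEval_eq_sum _ (pow_one (0 : B))]
  simp [expSeries]

theorem nilEval_exp_sum {B : Type*} [CommRing B] [Algebra ℂ B] {ι : Type*} (s : Finset ι)
    (a : ι → B) (h : ∀ i ∈ s, IsNilpotent (a i)) :
    nilEval expSeries (∑ i ∈ s, a i) = ∏ i ∈ s, nilEval expSeries (a i) := by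
  classical
  induction s using Finset.induction_on with
  | empty => simp
  | insert i s hi ih =>
    rw [Finset.sum_insert hi, Finset.prod_insert hi, nilEval_exp_add (Commute.all _ _)
      (h i (by simp)), ih fun j hj => h j (by simp [hj])]
    exact isNilpotent_sum fun j hj => h j (by simp [hj])

end NilEval

/-! ### Matrices with nilpotent entries -/

section NilMatrix

variable {A : Type*} [CommRing A]

/-- Finitely many nilpotent elements lie in a nilpotent ideal. -/
theorem exists_nilpotent_ideal {ι : Type*} [Finite ι] (a : ι → A) (h : ∀ i, IsNilpotent (a i)) :
    ∃ J : Ideal A, IsNilpotent J ∧ ∀ i, a i ∈ J := by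
  refine ⟨Ideal.span (Set.range a), ?_, fun i => Ideal.subset_span ⟨i, rfl⟩⟩
  refine (Ideal.FG.isNilpotent_iff_le_nilradical ⟨(Set.finite_range a).toFinset, by simp⟩).2 ?_
  rw [Ideal.span_le]
  rintro _ ⟨i, rfl⟩
  exact h i

/-- An endomorphism which maps a module `M` into `J M` for a nilpotent ideal `J` is nilpotent. -/
theorem isNilpotent_end_of_le {M : Type*} [AddCommGroup M] [Module A M] {J : Ideal A}
    (hJ : IsNilpotent J) {f : Module.End A M} (hf : ∀ m, f m ∈ J • (⊤ : Submodule A M)) :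
    IsNilpotent f := by
  obtain ⟨N, hN⟩ := hJ
  have key : ∀ k m, (f ^ k) m ∈ J ^ k • (⊤ : Submodule A M) := by
    intro k
    induction k with
    | zero => intro m; simp
    | succ k ih =>
      intro m
      rw [pow_succ' f, Module.End.mul_apply, pow_succ J]
      have : f ((f ^ k) m) ∈ Submodule.map f (J ^ k • ⊤) := Submodule.mem_map_of_mem (ih m)
      rw [Submodule.map_smul''] at this
      rw [mul_smul]
      refine Submodule.smul_mono le_rfl ?_ this
      rintro _ ⟨x, _, rfl⟩
      exact hf x
  refine ⟨N, LinearMap.ext fun m => ?_⟩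
  simpa [hN] using key N m

theorem toLin'_mem_smul {n : Type*} [Fintype n] [DecidableEq n] {J : Ideal A}
    {X : Matrix n n A} (h : ∀ i j, X i j ∈ J) (v : n → A) :
    Matrix.toLin' X v ∈ J • (⊤ : Submodule A (n → A)) := by
  rw [pi_eq_sum_univ (Matrix.toLin' X v)]
  refine Submodule.sum_mem _ fun i _ => Submodule.smul_mem_smul ?_ trivial
  rw [Matrix.toLin'_apply, Matrix.mulVec, dotProduct]
  exact Ideal.sum_mem _ fun j _ => Ideal.mul_mem_right _ _ (h i j)

theorem isNilpotent_matrix {n : Type*} [Fintype n] [DecidableEq n] {J : Ideal A}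
    (hJ : IsNilpotent J) {X : Matrix n n A} (h : ∀ i j, X i j ∈ J) : IsNilpotent X := by
  rw [← Matrix.isNilpotent_toLin'_iff]
  exact isNilpotent_end_of_le hJ (toLin'_mem_smul h)

theorem isNilpotent_matrix_of_entries {n : Type*} [Fintype n] [DecidableEq n]
    {X : Matrix n n A} (h : ∀ i j, IsNilpotent (X i j)) : IsNilpotent X := by
  obtain ⟨J, hJ, hX⟩ := exists_nilpotent_ideal (fun p : n × n => X p.1 p.2) fun p => h _ _
  exact isNilpotent_matrix hJ fun i j => hX (i, j)

theorem isNilpotent_trace {n : Type*} [Fintype n] {X : Matrix n n A}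
    (h : ∀ i j, IsNilpotent (X i j)) : IsNilpotent X.trace :=
  isNilpotent_sum fun i _ => h i i

theorem isNilpotent_trace_pow {n : Type*} [Fintype n] [DecidableEq n] {X : Matrix n n A}
    (h : ∀ i j, IsNilpotent (X i j)) {k : ℕ} (hk : k ≠ 0) : IsNilpotent (X ^ k).trace := by
  obtain ⟨k, rfl⟩ := Nat.exists_eq_succ_of_ne_zero hk
  refine isNilpotent_trace fun i j => ?_
  rw [pow_succ, Matrix.mul_apply]
  exact isNilpotent_sum fun l _ => Commute.isNilpotent_mul_left (Commute.all _ _) (h l j)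

end NilMatrix

/-! ### Newton's identities for traces on exterior and symmetric powers -/

section Newton

variable {A : Type*} [CommRing A]

/-- If `D' (m · p) = (f m) · p + m · (D p)` for a bilinear product `M × P → Q`, then
`exp(D') (m · p) = (exp(f) m) · (exp(D) p)`. -/
theorem exp_intertwine [Algebra ℂ A] {M P Q : Type*} [AddCommGroup M] [AddCommGroup P] [AddCommGroup Q]
    [Module A M] [Module A P] [Module A Q]
    [Module ℂ M] [IsScalarTower ℂ A M] [Module ℂ P] [IsScalarTower ℂ A P]
    [Module ℂ Q] [IsScalarTower ℂ A Q]
    (w : M →ₗ[A] P →ₗ[A] Q) {f : Module.End A M} {D : Module.End A P} {D' : Module.End A Q}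
    (hf : IsNilpotent f) (hD : IsNilpotent D) (hD' : IsNilpotent D')
    (h : ∀ m p, D' (w m p) = w (f m) p + w m (D p)) (m : M) (p : P) :
    nilEval expSeries D' (w m p) = w (nilEval expSeries f m) (nilEval expSeries D p) := by
  let L : Module.End A (TensorProduct A M P) := f.rTensor P
  let R : Module.End A (TensorProduct A M P) := D.lTensor M
  have hL : IsNilpotent L := hf.map (Module.End.rTensorAlgHom A M P)
  have hR : IsNilpotent R := hD.map (Module.End.lTensorAlgHom A P M)
  have hc : Commute L R := by ext; simp [L, R]
  have hLR := hc.isNilpotent_add hL hR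
  have h1 : nilEval expSeries D' ∘ₗ TensorProduct.lift w
      = TensorProduct.lift w ∘ₗ nilEval expSeries (L + R) := by
    refine nilEval_intertwine hLR hD' ?_ _
    ext m p
    simp [L, R, h]
  have h2 : nilEval expSeries L = (nilEval expSeries f).rTensor P :=
    (map_nilEval ((Module.End.rTensorAlgHom A M P).restrictScalars ℂ) hf expSeries).symm
  have h3 : nilEval expSeries R = (nilEval expSeries D).lTensor M :=
    (map_nilEval ((Module.End.lTensorAlgHom A P M).restrictScalars ℂ) hD expSeries).symm
  have h4 := LinearMap.congr_fun h1 (m ⊗ₜ[A] p)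
  rw [nilEval_exp_add hc hL hR, h2, h3] at h4
  simpa using h4

theorem exp_toLin'_basis [Algebra ℂ A] {n : ℕ} {R : Matrix (Fin n) (Fin n) A} (hR : IsNilpotent R)
    (c : ℂ) (j : Fin n) :
    nilEval expSeries (c • Matrix.toLin' R) (Pi.basisFun A (Fin n) j)
      = ∑ i, nilEval expSeries (c • R) i j • Pi.basisFun A (Fin n) i := by
  have e := map_nilEval ((Matrix.toLinAlgEquiv' (R := A) (n := Fin n)).toAlgHom.restrictScalars ℂ)
    (hR.smul c) expSeries
  have e' : (Matrix.toLinAlgEquiv' (R := A) (n := Fin n)).toAlgHom.restrictScalars ℂ (c • R)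
    = c • Matrix.toLin' R := map_smul _ _ _
  rw [e'] at e
  rw [← e]
  ext i
  simp [Pi.single_apply, Finset.sum_apply]

/-- **Newton's identities** for the traces of operators `G_k` on a graded module with creation
operators `w i` and annihilation operators `c i` which commute (`ε = 1`) or anticommute (`ε = -1`)
up to constants, when `G` intertwines creation operators through the matrix `g`. -/
theorem newton_of_creation_annihilation {n : ℕ} (ε : A) (P : ℕ → Type*) [∀ k, AddCommGroup (P k)]
    [∀ k, Module A (P k)] [∀ k, Module.Free A (P k)] [∀ k, Module.Finite A (P k)]
    (w : ∀ k, Fin n → P k →ₗ[A] P (k + 1)) (c : ∀ k, Fin n → P (k + 1) →ₗ[A] P k)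
    (G : ∀ k, Module.End A (P k)) (g : Matrix (Fin n) (Fin n) A)
    (hcw₀ : ∀ i j, c 0 i ∘ₗ w 0 j = if i = j then LinearMap.id else 0)
    (hcw : ∀ k i j, c (k + 1) i ∘ₗ w (k + 1) j
      = (if i = j then LinearMap.id else 0) + ε • (w k j ∘ₗ c k i))
    (hwc : ∀ k, ∑ i, w k i ∘ₗ c k i = ((k + 1 : ℕ) : A) • LinearMap.id)
    (hG : ∀ k j, G (k + 1) ∘ₗ w k j = ∑ i, g i j • (w k i ∘ₗ G k)) (k : ℕ) :
    ((k + 1 : ℕ) : A) * LinearMap.trace A _ (G (k + 1))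
      = ∑ a ∈ Finset.range (k + 1),
        ε ^ a * (g ^ (a + 1)).trace * LinearMap.trace A _ (G (k - a)) := by
  let t : ∀ k, Module.End A (P k) →ₗ[A] A := fun k => LinearMap.trace A (P k)
  let T : ℕ → Matrix (Fin n) (Fin n) A := fun k => Matrix.of fun l i =>
    t (k + 1) (w k l ∘ₗ c k i ∘ₗ G (k + 1))
  have hT : ∀ k l i, T k l i = ∑ j, g j l * t k (c k i ∘ₗ w k j ∘ₗ G k) := by
    intro k l i
    have e : T k l i = t k (c k i ∘ₗ G (k + 1) ∘ₗ w k l) :=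
      LinearMap.trace_comp_comm' (c k i ∘ₗ G (k + 1)) (w k l)
    have e' : c k i ∘ₗ ∑ j, g j l • (w k j ∘ₗ G k) = ∑ j, g j l • (c k i ∘ₗ w k j ∘ₗ G k) := by
      ext p
      simp
    rw [e, hG, e']
    simp only [map_sum, map_smul, smul_eq_mul]
  have hite : ∀ k (i j : Fin n), t k ((if i = j then LinearMap.id else 0) ∘ₗ G k)
      = (1 : Matrix (Fin n) (Fin n) A) j i * t k (G k) := by
    intro k i j
    by_cases hij : i = j
    · subst hij; simp
    · simp [hij, Matrix.one_apply_ne (Ne.symm hij)]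
  have hT0 : T 0 = t 0 (G 0) • g.transpose := by
    ext l i
    rw [hT]
    simp only [← LinearMap.comp_assoc, hcw₀, hite, Matrix.one_apply, ite_mul, one_mul, zero_mul,
      mul_ite, mul_zero, Finset.sum_ite_eq', Finset.mem_univ, if_true, Matrix.smul_apply,
      Matrix.transpose_apply, smul_eq_mul]
    ring
  have hTs : ∀ k, T (k + 1) = t (k + 1) (G (k + 1)) • g.transpose + ε • (g.transpose * T k) := by
    intro k
    ext l i
    rw [hT]
    have e : ∀ j, t (k + 1) (c (k + 1) i ∘ₗ w (k + 1) j ∘ₗ G (k + 1))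
        = (1 : Matrix (Fin n) (Fin n) A) j i * t (k + 1) (G (k + 1)) + ε * T k j i := by
      intro j
      rw [← LinearMap.comp_assoc, hcw, LinearMap.add_comp, map_add, hite, LinearMap.smul_comp,
        map_smul, smul_eq_mul]
      rfl
    simp only [e, mul_add, Finset.sum_add_distrib, Matrix.one_apply, ite_mul, one_mul, zero_mul,
      mul_ite, mul_zero, Finset.sum_ite_eq', Finset.mem_univ, if_true, Matrix.add_apply,
      Matrix.smul_apply, Matrix.transpose_apply, Matrix.mul_apply, smul_eq_mul, Finset.mul_sum]
    congr 1
    · ring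
    · exact Finset.sum_congr rfl fun j _ => by ring
  have hTk : ∀ k, T k = ∑ a ∈ Finset.range (k + 1),
      (ε ^ a * t (k - a) (G (k - a))) • g.transpose ^ (a + 1) := by
    intro k
    induction k with
    | zero => simp [hT0]
    | succ k ih =>
      rw [hTs, ih, Finset.sum_range_succ' _ (k + 1), add_comm]
      simp only [Finset.mul_sum, Finset.smul_sum, pow_zero, one_mul, Nat.sub_zero, zero_add,
        pow_one, mul_smul_comm, smul_smul]
      congr 1
      refine Finset.sum_congr rfl fun a _ => ?_
      rw [pow_succ' g.transpose (a + 1), ← mul_assoc, ← pow_succ']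
      rw [Nat.add_sub_add_right]
  have htr : (T k).trace = ((k + 1 : ℕ) : A) * t (k + 1) (G (k + 1)) := by
    have e : (T k).trace = t (k + 1) ((∑ i, w k i ∘ₗ c k i) ∘ₗ G (k + 1)) := by
      have e' : (∑ i, w k i ∘ₗ c k i) ∘ₗ G (k + 1) = ∑ i, w k i ∘ₗ c k i ∘ₗ G (k + 1) := by
        ext p
        simp
      rw [e', map_sum]
      rfl
    rw [e, hwc, LinearMap.smul_comp, LinearMap.id_comp, map_smul, smul_eq_mul]
  change _ * t (k + 1) (G (k + 1)) = _
  rw [← htr, hTk, Matrix.trace_sum]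
  refine Finset.sum_congr rfl fun a _ => ?_
  rw [Matrix.trace_smul, ← Matrix.transpose_pow, Matrix.trace_transpose, smul_eq_mul]
  ring

end Newton

section Exterior

variable {A : Type*} [CommRing A] {M : Type*} [AddCommGroup M] [Module A M]

/-- Exterior multiplication `m ∧ · : Λ^k M → Λ^{k+1} M` by a vector. -/
def wedge (k : ℕ) : M →ₗ[A] ⋀[A]^k M →ₗ[A] ⋀[A]^(k + 1) M :=
  LinearMap.mk₂ A (fun m x => ⟨ExteriorAlgebra.ι A m * x.1, by
      rw [ExteriorAlgebra.exteriorPower, pow_succ']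
      exact Submodule.mul_mem_mul ⟨m, rfl⟩ x.2⟩)
    (fun m m' x => Subtype.ext (by simp [add_mul]))
    (fun a m x => Subtype.ext (by simp))
    (fun m x x' => Subtype.ext (by simp [mul_add]))
    (fun a m x => Subtype.ext (by simp))

@[simp]
theorem coe_wedge (k : ℕ) (m : M) (x : ⋀[A]^k M) :
    (wedge k m x : ExteriorAlgebra A M) = ExteriorAlgebra.ι A m * x := rfl

theorem wedge_ιMulti (k : ℕ) (m : M) (v : Fin k → M) :
    wedge k m (exteriorPower.ιMulti A k v) = exteriorPower.ιMulti A (k + 1) (Fin.cons m v) := by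
  ext
  rw [coe_wedge, exteriorPower.ιMulti_apply_coe, exteriorPower.ιMulti_apply_coe,
    ExteriorAlgebra.ιMulti_succ_apply]
  rfl

theorem extDer_ιMulti (f : M →ₗ[A] M) (k : ℕ) (v : Fin k → M) :
    extDer f k (exteriorPower.ιMulti A k v)
      = ∑ i, exteriorPower.ιMulti A k (Function.update v i (f (v i))) := by
  rw [extDer, exteriorPower.alternatingMapLinearEquiv_apply_ιMulti]
  change (∑ i : Fin k, (exteriorPower.ιMulti A k (M := M)).toMultilinearMap.compLinearMap
          (Function.update (fun _ => LinearMap.id) i f)) v = _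
  rw [_root_.sum_apply]
  refine Finset.sum_congr rfl fun i _ => ?_
  rw [MultilinearMap.compLinearMap_apply]
  change exteriorPower.ιMulti A k _ = _
  congr 1
  funext c
  by_cases hc : c = i
  · subst hc; simp
  · simp [hc]

theorem extDer_wedge (f : M →ₗ[A] M) (k : ℕ) (m : M) (x : ⋀[A]^k M) :
    extDer f (k + 1) (wedge k m x) = wedge k (f m) x + wedge k m (extDer f k x) := by
  have h : extDer f (k + 1) ∘ₗ wedge k m = wedge k (f m) + wedge k m ∘ₗ extDer f k := by
    refine exteriorPower.linearMap_ext ?_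
    ext1 v
    simp only [LinearMap.compAlternatingMap_apply, LinearMap.comp_apply, LinearMap.add_apply,
      wedge_ιMulti, extDer_ιMulti, map_sum]
    rw [Fin.sum_univ_succ]
    simp only [Fin.cons_zero, Fin.cons_succ, Fin.update_cons_zero, Fin.cons_update]
  exact LinearMap.congr_fun h x

theorem extDer_mem_smul {J : Ideal A} {f : M →ₗ[A] M}
    (hf : ∀ m, f m ∈ J • (⊤ : Submodule A M)) (k : ℕ) (x : ⋀[A]^k M) :
    extDer f k x ∈ J • (⊤ : Submodule A (⋀[A]^k M)) := by
  have hx : x ∈ Submodule.span A (Set.range (exteriorPower.ιMulti A k (M := M))) := by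
    rw [exteriorPower.ιMulti_span]; trivial
  induction hx using Submodule.span_induction with
  | mem x hx =>
    obtain ⟨v, rfl⟩ := hx
    rw [extDer_ιMulti]
    refine Submodule.sum_mem _ fun i _ => ?_
    let L : M →ₗ[A] ⋀[A]^k M :=
      (exteriorPower.ιMulti A k (M := M)).toMultilinearMap.toLinearMap v i
    have : L (f (v i)) ∈ Submodule.map L (J • ⊤) := Submodule.mem_map_of_mem (hf _)
    rw [Submodule.map_smul''] at this
    exact Submodule.smul_mono le_rfl le_top this
  | zero => simp
  | add x y _ _ hx hy => rw [map_add]; exact Submodule.add_mem _ hx hy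
  | smul a x _ hx => rw [map_smul]; exact Submodule.smul_mem _ _ hx

theorem contractLeft_mem (d : Module.Dual A M) (k : ℕ) :
    ∀ x ∈ ⋀[A]^(k + 1) M,
      CliffordAlgebra.contractLeft (Q := (0 : QuadraticForm A M)) d x ∈ ⋀[A]^k M := by
  induction k with
  | zero =>
    intro x hx
    rw [ExteriorAlgebra.exteriorPower, zero_add, pow_one] at hx
    obtain ⟨m, rfl⟩ := hx
    rw [ExteriorAlgebra.exteriorPower, pow_zero]
    exact (CliffordAlgebra.contractLeft_ι (0 : QuadraticForm A M) d m).symm ▸ Submodule.algebraMap_mem _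
  | succ k ih =>
    intro x hx
    rw [ExteriorAlgebra.exteriorPower, pow_succ'] at hx
    induction hx using Submodule.mul_induction_on' with
    | mem_mul_mem a ha y hy =>
      obtain ⟨m, rfl⟩ := ha
      have e := CliffordAlgebra.contractLeft_ι_mul (Q := (0 : QuadraticForm A M)) d m y
      have e' : CliffordAlgebra.contractLeft (Q := (0 : QuadraticForm A M)) d
        (ExteriorAlgebra.ι A m * y) = d m • y - ExteriorAlgebra.ι A m *
          CliffordAlgebra.contractLeft (Q := (0 : QuadraticForm A M)) d y := e
      rw [e']
      refine Submodule.sub_mem _ (Submodule.smul_mem _ _ hy) ?_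
      rw [ExteriorAlgebra.exteriorPower, pow_succ']
      exact Submodule.mul_mem_mul ⟨m, rfl⟩ (ih y hy)
    | add x _ y _ hx hy => rw [map_add]; exact Submodule.add_mem _ hx hy

/-- Contraction `Λ^{k+1} M → Λ^k M` with a covector. -/
def contract (k : ℕ) (d : Module.Dual A M) : ⋀[A]^(k + 1) M →ₗ[A] ⋀[A]^k M :=
  (CliffordAlgebra.contractLeft (Q := (0 : QuadraticForm A M)) d).restrict (contractLeft_mem d k)

theorem contract_wedge_zero (d : Module.Dual A M) (m : M) (x : ⋀[A]^0 M) :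
    contract 0 d (wedge 0 m x) = d m • x := by
  obtain ⟨x, hx⟩ := x
  obtain ⟨r, rfl⟩ := Submodule.mem_one.1 (show x ∈ (1 : Submodule A (ExteriorAlgebra A M)) by rwa [ExteriorAlgebra.exteriorPower, pow_zero] at hx)
  ext
  refine (CliffordAlgebra.contractLeft_ι_mul (Q := (0 : QuadraticForm A M)) d m _).trans ?_
  have e := CliffordAlgebra.contractLeft_algebraMap (Q := (0 : QuadraticForm A M)) d r
  rw [e, mul_zero, sub_zero]
  rfl

theorem contract_wedge (k : ℕ) (d : Module.Dual A M) (m : M) (x : ⋀[A]^(k + 1) M) :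
    contract (k + 1) d (wedge (k + 1) m x) = d m • x - wedge k m (contract k d x) := by
  ext
  exact CliffordAlgebra.contractLeft_ι_mul (Q := (0 : QuadraticForm A M)) d m _

theorem sum_wedge_contract {n : ℕ} (b : Module.Basis (Fin n) A M) (k : ℕ) :
    ∀ x ∈ ⋀[A]^k M, ∑ i, ExteriorAlgebra.ι A (b i) *
        CliffordAlgebra.contractLeft (Q := (0 : QuadraticForm A M)) (b.coord i) x = (k : A) • x := by
  induction k with
  | zero =>
    intro x hx
    obtain ⟨r, rfl⟩ := Submodule.mem_one.1 (show x ∈ (1 : Submodule A (ExteriorAlgebra A M)) by rwa [ExteriorAlgebra.exteriorPower, pow_zero] at hx)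
    rw [Nat.cast_zero, zero_smul]
    refine Finset.sum_eq_zero fun i _ => ?_
    have e := CliffordAlgebra.contractLeft_algebraMap (Q := (0 : QuadraticForm A M)) (b.coord i) r
    rw [e, mul_zero]
  | succ k ih =>
    intro x hx
    rw [ExteriorAlgebra.exteriorPower, pow_succ'] at hx
    induction hx using Submodule.mul_induction_on' with
    | mem_mul_mem a ha y hy =>
      obtain ⟨m, rfl⟩ := ha
      have e : ∀ i, ExteriorAlgebra.ι A (b i) *
          CliffordAlgebra.contractLeft (Q := (0 : QuadraticForm A M)) (b.coord i)
            (ExteriorAlgebra.ι A m * y)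
          = ExteriorAlgebra.ι A (b.coord i m • b i) * y + ExteriorAlgebra.ι A m *
            (ExteriorAlgebra.ι A (b i) *
              CliffordAlgebra.contractLeft (Q := (0 : QuadraticForm A M)) (b.coord i) y) := by
        intro i
        have e1 : CliffordAlgebra.contractLeft (Q := (0 : QuadraticForm A M)) (b.coord i)
          (ExteriorAlgebra.ι A m * y) = b.coord i m • y - ExteriorAlgebra.ι A m *
            CliffordAlgebra.contractLeft (Q := (0 : QuadraticForm A M)) (b.coord i) y :=
          CliffordAlgebra.contractLeft_ι_mul _ m y
        rw [e1, mul_sub, ← mul_assoc, ← mul_assoc,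
          eq_neg_of_add_eq_zero_left (ExteriorAlgebra.ι_add_mul_swap (b i) m)]
        simp
      rw [Finset.sum_congr rfl fun i _ => e i, Finset.sum_add_distrib, ← Finset.mul_sum,
        ih y hy, ← Finset.sum_mul, ← map_sum]
      have hm : ∑ i, b.coord i m • b i = m := b.sum_repr m
      rw [hm]
      simp [add_smul, add_comm]
    | add x _ y _ hx hy =>
      simp only [map_add, mul_add, Finset.sum_add_distrib, smul_add, hx, hy]

end Exterior

section ChLambda

variable {A : Type*} [CommRing A] [Algebra ℂ A] {n : ℕ}

/-- The Chern characters `ch(Λ^k E) = tr exp(c R^{Λ^k E})` satisfy Newton's identities with respect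
to the power sums `tr(e^{jcR})`. -/
theorem trace_exp_extDer_newton {R : Matrix (Fin n) (Fin n) A} (hR : ∀ i j, IsNilpotent (R i j))
    (c : ℂ) (k : ℕ) :
    ((k + 1 : ℕ) : A) * LinearMap.trace A (⋀[A]^(k + 1) (Fin n → A))
        (nilEval expSeries (c • extDer (Matrix.toLin' R) (k + 1)))
      = ∑ a ∈ Finset.range (k + 1), (-1) ^ a * (nilEval expSeries (c • R) ^ (a + 1)).trace *
        LinearMap.trace A (⋀[A]^(k - a) (Fin n → A))
          (nilEval expSeries (c • extDer (Matrix.toLin' R) (k - a))) := by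
  obtain ⟨J, hJ, hJR⟩ := exists_nilpotent_ideal (fun p : Fin n × Fin n => R p.1 p.2) fun p => hR _ _
  have hmem := toLin'_mem_smul (J := J) (X := R) fun i j => hJR (i, j)
  have hf : IsNilpotent (c • Matrix.toLin' R) := (isNilpotent_end_of_le hJ hmem).smul c
  have hD : ∀ k, IsNilpotent (c • extDer (Matrix.toLin' R) k) := fun k =>
    (isNilpotent_end_of_le hJ (extDer_mem_smul hmem k)).smul c
  have hg := exp_toLin'_basis (isNilpotent_matrix (X := R) hJ fun i j => hJR (i, j)) c
  refine newton_of_creation_annihilation (-1) (fun k => ⋀[A]^k (Fin n → A))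
    (fun k i => wedge k (Pi.basisFun A (Fin n) i))
    (fun k i => contract k ((Pi.basisFun A (Fin n)).coord i))
    (fun k => nilEval expSeries (c • extDer (Matrix.toLin' R) k)) (nilEval expSeries (c • R))
    ?_ ?_ ?_ ?_ k
  · intro i j
    refine LinearMap.ext fun x => ?_
    rw [LinearMap.comp_apply, contract_wedge_zero]
    by_cases h : i = j
    · subst h; simp
    · simp [h]
  · intro k i j
    refine LinearMap.ext fun x => ?_
    rw [LinearMap.comp_apply, contract_wedge]
    by_cases h : i = j
    · subst h; simp [sub_eq_add_neg]
    · simp [h]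
  · intro k
    refine LinearMap.ext fun x => Subtype.ext ?_
    have := sum_wedge_contract (Pi.basisFun A (Fin n)) (k + 1) x.1 x.2
    rw [LinearMap.sum_apply, AddSubmonoidClass.coe_finsetSum]
    exact this
  · intro k j
    refine LinearMap.ext fun x => ?_
    rw [LinearMap.comp_apply, exp_intertwine (wedge k) hf (hD k) (hD (k + 1)), hg]
    · simp
    · intro m p
      simp [extDer_wedge]

end ChLambda

section Symmetric

open MvPolynomial

variable {A : Type*} [CommRing A] {n : ℕ}

/-- Multiplication `S^k E → S^{k+1} E` by a vector, for the symmetric powers of `E = A^n` realised as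
homogeneous polynomials. -/
def symMul (k : ℕ) : (Fin n → A) →ₗ[A] homogeneousSubmodule (Fin n) A k →ₗ[A]
    homogeneousSubmodule (Fin n) A (k + 1) :=
  LinearMap.mk₂ A (fun m p => ⟨(∑ i, C (m i) * X i) * p.1, by
      rw [mem_homogeneousSubmodule, add_comm k 1]
      refine IsHomogeneous.mul (IsHomogeneous.sum _ _ _ fun i _ => ?_) p.2
      simpa using (isHomogeneous_C (Fin n) (m i)).mul (isHomogeneous_X A i)⟩)
    (fun m m' x => Subtype.ext (by simp [add_mul, Finset.sum_add_distrib]))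
    (fun a m x => Subtype.ext (by simp [Finset.mul_sum, smul_eq_C_mul, Finset.sum_mul, mul_assoc]))
    (fun m x x' => Subtype.ext (by simp [mul_add]))
    (fun a m x => Subtype.ext (by simp))

theorem coe_symMul (k : ℕ) (m : Fin n → A) (p : homogeneousSubmodule (Fin n) A k) :
    (symMul k m p : MvPolynomial (Fin n) A) = (∑ i, C (m i) * X i) * p.1 := rfl

theorem coe_symMul_single (k : ℕ) (i : Fin n) (p : homogeneousSubmodule (Fin n) A k) :
    (symMul k (Pi.single i 1) p : MvPolynomial (Fin n) A) = X i * p.1 := by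
  rw [coe_symMul]
  congr 1
  rw [Finset.sum_eq_single i] <;> simp +contextual

/-- Partial differentiation `S^{k+1} E → S^k E`. -/
def symDiff (k : ℕ) (i : Fin n) : homogeneousSubmodule (Fin n) A (k + 1) →ₗ[A]
    homogeneousSubmodule (Fin n) A k :=
  (pderiv i).toLinearMap.restrict fun p hp => by
    simpa using IsHomogeneous.pderiv (i := i) (show p.IsHomogeneous (k + 1) from hp)

theorem coe_symDiff (k : ℕ) (i : Fin n) (p : homogeneousSubmodule (Fin n) A (k + 1)) :
    (symDiff k i p : MvPolynomial (Fin n) A) = pderiv i p.1 := rfl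

/-- The derivation extension of an endomorphism `R` of `E = A^n` to `S^k E`, as the operator
`∑ R_{ij} x_i ∂_j`. -/
def symOp (R : Matrix (Fin n) (Fin n) A) : ∀ k, Module.End A (homogeneousSubmodule (Fin n) A k)
  | 0 => 0
  | k + 1 => ∑ i, ∑ j, R i j • (symMul k (Pi.basisFun A (Fin n) i) ∘ₗ symDiff k j)

/-- The derivation `∑ R_{ij} x_i ∂_j` of the polynomial ring. -/
abbrev polyDer (R : Matrix (Fin n) (Fin n) A) :
    Derivation A (MvPolynomial (Fin n) A) (MvPolynomial (Fin n) A) :=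
  mkDerivation A (fun j => ∑ i, C (R i j) * (X i : MvPolynomial (Fin n) A))

theorem derivation_sum_apply (D : Fin n → Derivation A (MvPolynomial (Fin n) A)
    (MvPolynomial (Fin n) A)) (p : MvPolynomial (Fin n) A) : (∑ j, D j) p = ∑ j, D j p := by
  have h := congrFun (map_sum Derivation.coeFnAddMonoidHom D Finset.univ) p
  rwa [Finset.sum_apply] at h

theorem polyDer_eq (R : Matrix (Fin n) (Fin n) A) (p : MvPolynomial (Fin n) A) :
    polyDer R p = ∑ i, ∑ j, R i j • (X i * pderiv j p) := by
  have h : polyDer R = ∑ j, (∑ i, C (R i j) * (X i : MvPolynomial (Fin n) A)) • pderiv j := by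
    refine derivation_ext fun l => ?_
    rw [mkDerivation_X, derivation_sum_apply]
    refine Eq.trans ?_ (Finset.sum_eq_single l ?_ ?_).symm
    · simp
    · intro j _ hj
      rw [Derivation.smul_apply, pderiv_X_of_ne hj.symm, smul_zero]
    · simp
  rw [h, derivation_sum_apply, Finset.sum_comm]
  refine Finset.sum_congr rfl fun j _ => ?_
  simp [Finset.sum_mul, smul_eq_C_mul, mul_assoc]

theorem isHomogeneous_zero_eq_C {p : MvPolynomial (Fin n) A} (hp : p.IsHomogeneous 0) :
    p = C (coeff 0 p) :=
  (totalDegree_eq_zero_iff_eq_C).1 (Nat.le_zero.1 hp.totalDegree_le)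

theorem coe_symOp (R : Matrix (Fin n) (Fin n) A) (k : ℕ) (p : homogeneousSubmodule (Fin n) A k) :
    (symOp R k p : MvPolynomial (Fin n) A) = polyDer R p.1 := by
  cases k with
  | zero =>
    rw [isHomogeneous_zero_eq_C p.2, ← algebraMap_eq, Derivation.map_algebraMap]
    rfl
  | succ k =>
    rw [polyDer_eq]
    simp [symOp, LinearMap.sum_apply, coe_symMul_single, coe_symDiff]

theorem symOp_symMul (R : Matrix (Fin n) (Fin n) A) (k : ℕ) (m : Fin n → A)
    (p : homogeneousSubmodule (Fin n) A k) :
    symOp R (k + 1) (symMul k m p)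
      = symMul k (Matrix.toLin' R m) p + symMul k m (symOp R k p) := by
  ext1
  rw [Submodule.coe_add, coe_symOp, coe_symMul, coe_symMul, coe_symMul, coe_symOp,
    Derivation.leibniz, smul_eq_mul, smul_eq_mul, add_comm, mul_comm p.1]
  congr 2
  rw [map_sum]
  simp only [← smul_eq_C_mul, Derivation.map_smul, mkDerivation_X, Matrix.toLin'_apply,
    Matrix.mulVec, dotProduct, Finset.smul_sum, Finset.sum_smul]
  rw [Finset.sum_comm]
  refine Finset.sum_congr rfl fun i _ => Finset.sum_congr rfl fun j _ => ?_
  rw [smul_smul, mul_comm]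

theorem symOp_mem_smul {J : Ideal A} {R : Matrix (Fin n) (Fin n) A} (hR : ∀ i j, R i j ∈ J)
    (k : ℕ) (p : homogeneousSubmodule (Fin n) A k) :
    symOp R k p ∈ J • (⊤ : Submodule A (homogeneousSubmodule (Fin n) A k)) := by
  cases k with
  | zero => exact Submodule.zero_mem _
  | succ k =>
    rw [symOp]
    simp only [LinearMap.sum_apply, LinearMap.smul_apply]
    exact Submodule.sum_mem _ fun i _ => Submodule.sum_mem _ fun j _ =>
      Submodule.smul_mem_smul (hR i j) trivial

/-- The monomials of degree `k`. -/
def homMonomial (A : Type*) [CommRing A] {n k : ℕ}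
    (s : ↥(Finset.finsuppAntidiag (Finset.univ : Finset (Fin n)) k)) :
    homogeneousSubmodule (Fin n) A k :=
  ⟨monomial s.1 1, by
    have hs := (Finset.mem_finsuppAntidiag.1 s.2).1
    refine isHomogeneous_monomial _ ?_
    rw [Finsupp.degree_eq_sum]
    exact hs⟩

theorem coe_homMonomial {k : ℕ}
    (s : ↥(Finset.finsuppAntidiag (Finset.univ : Finset (Fin n)) k)) :
    (homMonomial A s : MvPolynomial (Fin n) A) = monomial s.1 1 := rfl

/-- The basis of monomials of the homogeneous polynomials of degree `k`. -/
def monomialBasis (A : Type*) [CommRing A] (n k : ℕ) :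
    Module.Basis ↥(Finset.finsuppAntidiag (Finset.univ : Finset (Fin n)) k) A
      (homogeneousSubmodule (Fin n) A k) :=
  Module.Basis.ofEquivFun
    { toFun := fun p s => coeff s.1 p.1
      map_add' := fun p q => funext fun s => by simp
      map_smul' := fun a p => funext fun s => by simp
      invFun := fun f => ∑ s, f s • homMonomial A s
      left_inv := by
        intro p
        ext t
        change coeff t (Subtype.val (∑ s, coeff s.1 p.1 • homMonomial A s)) = _
        rw [AddSubmonoidClass.coe_finsetSum, coeff_sum]
        simp only [SetLike.val_smul, coe_homMonomial, coeff_smul, coeff_monomial, smul_eq_mul, mul_ite, mul_one,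
          mul_zero]
        by_cases ht : t ∈ Finset.finsuppAntidiag (Finset.univ : Finset (Fin n)) k
        · rw [Finset.sum_eq_single ⟨t, ht⟩]
          · simp
          · intro s _ hs
            rw [if_neg fun h => hs (Subtype.ext h)]
          · simp
        · rw [Finset.sum_eq_zero, (show p.1.IsHomogeneous k from p.2).coeff_eq_zero]
          · intro h
            rw [Finsupp.degree_eq_sum] at h
            exact ht (Finset.mem_finsuppAntidiag.2 ⟨h, Finset.subset_univ _⟩)
          · intro s _
            rw [if_neg fun h => ht (by rw [← h]; exact s.2)]
      right_inv := by
        intro f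
        funext t
        change coeff t.1 (Subtype.val (∑ s, f s • homMonomial A s)) = _
        rw [AddSubmonoidClass.coe_finsetSum, coeff_sum, Finset.sum_eq_single t]
        · simp [coe_homMonomial]
        · intro s _ hs
          simp [coe_homMonomial, coeff_monomial, hs]
        · simp }

theorem monomialBasis_repr (k : ℕ) (p : homogeneousSubmodule (Fin n) A k)
    (s : ↥(Finset.finsuppAntidiag (Finset.univ : Finset (Fin n)) k)) :
    (monomialBasis A n k).repr p s = coeff s.1 p.1 := rfl

theorem coe_monomialBasis (k : ℕ)
    (s : ↥(Finset.finsuppAntidiag (Finset.univ : Finset (Fin n)) k)) :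
    (monomialBasis A n k s : MvPolynomial (Fin n) A) = monomial s.1 1 := by
  have h : (monomialBasis A n k s : MvPolynomial (Fin n) A) = Subtype.val (∑ t,
      (Pi.single s 1 : ↥(Finset.finsuppAntidiag (Finset.univ : Finset (Fin n)) k) → A) t • homMonomial A t) := by
    rw [monomialBasis, Module.Basis.coe_ofEquivFun]
    rfl
  rw [h, Finset.sum_eq_single s]
  · simp [coe_homMonomial]
  · intro t _ ht
    simp [ht]
  · simp

theorem toMatrix_symOp (R : Matrix (Fin n) (Fin n) A) (k : ℕ) :
    LinearMap.toMatrix (monomialBasis A n k) (monomialBasis A n k) (symOp R k) = symDer R k := by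
  ext s t
  rw [LinearMap.toMatrix_apply, monomialBasis_repr, coe_symOp, coe_monomialBasis]
  rfl

end Symmetric

section ChSym

open MvPolynomial

variable {A : Type*} [CommRing A] [Algebra ℂ A] {n : ℕ}

theorem trace_exp_symDer {R : Matrix (Fin n) (Fin n) A} {k : ℕ} {c : ℂ}
    (h : IsNilpotent (c • symOp R k)) :
    (nilEval expSeries (c • symDer R k)).trace
      = LinearMap.trace A _ (nilEval expSeries (c • symOp R k)) := by
  have e := map_nilEval
    ((LinearMap.toMatrixAlgEquiv (monomialBasis A n k)).toAlgHom.restrictScalars ℂ) h expSeries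
  have e' : (LinearMap.toMatrixAlgEquiv (monomialBasis A n k)).toAlgHom.restrictScalars ℂ
      (c • symOp R k) = c • symDer R k := by
    rw [← toMatrix_symOp]
    exact map_smul ((LinearMap.toMatrixAlgEquiv (monomialBasis A n k)).toAlgHom.restrictScalars ℂ)
      _ _
  rw [e'] at e
  rw [← e, LinearMap.trace_eq_matrix_trace A (monomialBasis A n k)]
  rfl

/-- The Chern characters `ch(S^k E) = tr exp(c R^{S^k E})` satisfy Newton's identities with respect
to the power sums `tr(e^{jcR})`. -/
theorem trace_exp_symDer_newton {R : Matrix (Fin n) (Fin n) A} (hR : ∀ i j, IsNilpotent (R i j))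
    (c : ℂ) (k : ℕ) :
    ((k + 1 : ℕ) : A) * (nilEval expSeries (c • symDer R (k + 1))).trace
      = ∑ a ∈ Finset.range (k + 1), (nilEval expSeries (c • R) ^ (a + 1)).trace *
        (nilEval expSeries (c • symDer R (k - a))).trace := by
  obtain ⟨J, hJ, hJR⟩ := exists_nilpotent_ideal (fun p : Fin n × Fin n => R p.1 p.2) fun p => hR _ _
  have hmem := toLin'_mem_smul (J := J) (X := R) fun i j => hJR (i, j)
  have hf : IsNilpotent (c • Matrix.toLin' R) := (isNilpotent_end_of_le hJ hmem).smul c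
  have hD : ∀ k, IsNilpotent (c • symOp R k) := fun k =>
    (isNilpotent_end_of_le hJ (symOp_mem_smul (fun i j => hJR (i, j)) k)).smul c
  have hg := exp_toLin'_basis (isNilpotent_matrix (X := R) hJ fun i j => hJR (i, j)) c
  have : ∀ k, Module.Free A (homogeneousSubmodule (Fin n) A k) := fun k =>
    Module.Free.of_basis (monomialBasis A n k)
  have : ∀ k, Module.Finite A (homogeneousSubmodule (Fin n) A k) := fun k =>
    Module.Finite.of_basis (monomialBasis A n k)
  simp only [trace_exp_symDer (hD _)]
  have := newton_of_creation_annihilation 1 (fun k => homogeneousSubmodule (Fin n) A k)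
    (fun k i => symMul k (Pi.basisFun A (Fin n) i)) (fun k i => symDiff k i)
    (fun k => nilEval expSeries (c • symOp R k)) (nilEval expSeries (c • R))
    ?_ ?_ ?_ ?_ k
  · simpa only [one_pow, one_mul] using this
  · intro i j
    refine LinearMap.ext fun p => Subtype.ext ?_
    rw [LinearMap.comp_apply, coe_symDiff, Pi.basisFun_apply, coe_symMul_single, isHomogeneous_zero_eq_C p.2]
    by_cases h : i = j
    · subst h
      have h0 := congrArg (pderiv i) (isHomogeneous_zero_eq_C p.2)
      rw [pderiv_C] at h0
      simp [← isHomogeneous_zero_eq_C p.2, h0]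
    · simp [h, pderiv_X_of_ne (Ne.symm h)]
  · intro k i j
    refine LinearMap.ext fun p => Subtype.ext ?_
    rw [LinearMap.comp_apply, coe_symDiff, Pi.basisFun_apply, coe_symMul_single]
    by_cases h : i = j
    · subst h; simp [coe_symMul_single, coe_symDiff, add_comm]
    · simp [h, pderiv_X_of_ne (Ne.symm h), coe_symMul_single, coe_symDiff]
  · intro k
    refine LinearMap.ext fun p => Subtype.ext ?_
    have := IsHomogeneous.sum_X_mul_pderiv (show p.1.IsHomogeneous (k + 1) from p.2)
    rw [LinearMap.sum_apply, AddSubmonoidClass.coe_finsetSum]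
    simp only [LinearMap.comp_apply, Pi.basisFun_apply, coe_symMul_single, coe_symDiff]
    rw [this]
    simp [smul_eq_C_mul]
  · intro k j
    refine LinearMap.ext fun x => ?_
    rw [LinearMap.comp_apply, exp_intertwine (symMul k) hf (hD k) (hD (k + 1)), hg]
    · simp
    · intro m p
      simp [symOp_symMul]

end ChSym

/-! ### The Chern characters of the power operations as exponentials -/

section Exponentials

open PowerSeries

variable {A : Type*} [CommRing A] [Algebra ℂ A] {n : ℕ}

theorem isUnit_natCast_succ (k : ℕ) : IsUnit ((k + 1 : ℕ) : A) := by
  have h : IsUnit ((k + 1 : ℕ) : ℂ) := (Nat.cast_ne_zero.2 (Nat.succ_ne_zero k)).isUnit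
  simpa using h.map (algebraMap ℂ A)

/-- A power series is determined by its logarithmic derivative and its constant term. -/
theorem eq_of_derivative_eq_mul {F G Q : A⟦X⟧} (hF : d⁄dX A F = F * Q) (hG : d⁄dX A G = G * Q)
    (h0 : coeff 0 F = coeff 0 G) : F = G := by
  ext k
  induction k using Nat.strong_induction_on with
  | _ k ih =>
    cases k with
    | zero => exact h0
    | succ k =>
      have hF' := congrArg (coeff k) hF
      have hG' := congrArg (coeff k) hG
      rw [coeff_derivative, coeff_mul] at hF' hG'
      have e : ∑ p ∈ Finset.HasAntidiagonal.antidiagonal k, coeff p.1 F * coeff p.2 Q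
          = ∑ p ∈ Finset.HasAntidiagonal.antidiagonal k, coeff p.1 G * coeff p.2 Q :=
        Finset.sum_congr rfl fun p hp => by
          rw [ih p.1 (by have := Finset.HasAntidiagonal.mem_antidiagonal.1 hp; omega)]
      rw [← e, ← hF'] at hG'
      have hu := isUnit_natCast_succ (A := A) k
      rw [Nat.cast_succ] at hu
      exact (hu.mul_left_injective hG').symm

theorem derivative_nilEval (f : ℂ⟦X⟧) {Z : A⟦X⟧} (hZ : IsNilpotent Z) :
    d⁄dX A (nilEval f Z) = nilEval (d⁄dX ℂ f) Z * d⁄dX A Z := by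
  obtain ⟨N, hN⟩ := hZ
  have hN' : Z ^ (N + 1) = 0 := pow_eq_zero_of_le (Nat.le_succ N) hN
  rw [nilEval_eq_sum f hN', nilEval_eq_sum _ hN, map_sum, Finset.sum_range_succ', Finset.sum_mul]
  have hs : ∀ (c : ℂ) (F : A⟦X⟧), d⁄dX A (c • F) = c • d⁄dX A F := by
    intro c F
    rw [← algebraMap_smul A c F, Derivation.map_smul, algebraMap_smul]
  have e0 : d⁄dX A (coeff 0 f • Z ^ 0) = 0 := by
    rw [hs, pow_zero, Derivation.map_one_eq_zero, smul_zero]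
  rw [e0, add_zero]
  refine Finset.sum_congr rfl fun k _ => ?_
  rw [hs, Derivation.leibniz_pow, coeff_derivative, Nat.add_sub_cancel, smul_eq_mul,
    smul_mul_assoc, mul_smul]
  congr 1
  rw [← Nat.cast_succ, Nat.cast_smul_eq_nsmul]

theorem constantCoeff_nilEval (f : ℂ⟦X⟧) {Z : A⟦X⟧} (hZ : IsNilpotent Z) :
    constantCoeff (nilEval f Z) = nilEval f (constantCoeff Z) :=
  map_nilEval (({ constantCoeff (R := A) with commutes' := fun a => by simp } : A⟦X⟧ →ₐ[A] A
    ).restrictScalars ℂ) hZ f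

theorem derivative_expSeries : d⁄dX ℂ expSeries = expSeries := derivative_exp ℂ

/-- The series `∑_{j ≥ 1} ε^{j-1} j^{i-1} t^j`. -/
def powSeries (ε : ℂ) (i : ℕ) : ℂ⟦X⟧ :=
  PowerSeries.mk fun j => if j = 0 then 0 else ε ^ (j - 1) * (j : ℂ) ^ (i - 1)

theorem coeff_derivative_powSeries (ε : ℂ) {i : ℕ} (hi : i ≠ 0) (a : ℕ) :
    coeff a (d⁄dX ℂ (powSeries ε i)) = ε ^ a * ((a + 1 : ℕ) : ℂ) ^ i := by
  obtain ⟨i, rfl⟩ := Nat.exists_eq_succ_of_ne_zero hi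
  rw [coeff_derivative, powSeries, coeff_mk, if_neg (Nat.succ_ne_zero a)]
  simp only [Nat.succ_eq_add_one, Nat.add_sub_cancel, pow_succ]
  push_cast
  ring

theorem derivative_map (f : ℂ⟦X⟧) :
    d⁄dX A (map (algebraMap ℂ A) f) = map (algebraMap ℂ A) (d⁄dX ℂ f) := by
  ext k
  simp [coeff_derivative, coeff_map]

/-- The exponent `∑_{1 ≤ i < N} (tr Y^i / i!) φ_i` attached to a matrix `Y` and power series `φ_i`. -/
def traceSum {n : ℕ} (Y : Matrix (Fin n) (Fin n) A) (N : ℕ) (φ : ℕ → ℂ⟦X⟧) : A⟦X⟧ :=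
  ∑ i ∈ Finset.Ico 1 N, C ((1 / (i.factorial : ℂ)) • (Y ^ i).trace) * map (algebraMap ℂ A) (φ i)

theorem isNilpotent_traceSum_term {Y : Matrix (Fin n) (Fin n) A}
    (hY : ∀ i j, IsNilpotent (Y i j)) {i : ℕ} (hi : i ≠ 0) (φ : ℂ⟦X⟧) :
    IsNilpotent (C ((1 / (i.factorial : ℂ)) • (Y ^ i).trace) * map (algebraMap ℂ A) φ) :=
  Commute.isNilpotent_mul_right (Commute.all _ _)
    (((isNilpotent_trace_pow hY hi).smul (1 / (i.factorial : ℂ))).map (C (R := A)))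

theorem isNilpotent_traceSum {Y : Matrix (Fin n) (Fin n) A} (hY : ∀ i j, IsNilpotent (Y i j))
    (N : ℕ) (φ : ℕ → ℂ⟦X⟧) : IsNilpotent (traceSum Y N φ) :=
  isNilpotent_sum fun _ hi => isNilpotent_traceSum_term hY
    (Nat.one_le_iff_ne_zero.1 (Finset.mem_Ico.1 hi).1) _

theorem trace_exp_pow {Y : Matrix (Fin n) (Fin n) A} {N : ℕ} (hY : Y ^ N = 0) (j : ℕ) :
    (nilEval expSeries Y ^ j).trace
      = ∑ i ∈ Finset.range N, ((j : ℂ) ^ i / (i.factorial : ℂ)) • (Y ^ i).trace := by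
  have h : nilEval expSeries Y ^ j = nilEval (rescale (j : ℂ) expSeries) Y := by
    rw [expSeries, ← exp_pow_eq_rescale_exp, ← nilHom_apply ⟨N, hY⟩, ← nilHom_apply ⟨N, hY⟩,
      map_pow]
  rw [h, nilEval_eq_sum _ hY, Matrix.trace_sum]
  refine Finset.sum_congr rfl fun i _ => ?_
  rw [Matrix.trace_smul, coeff_rescale, expSeries, coeff_exp]
  congr 1
  simp [div_eq_mul_inv]

/-- Two series satisfying Newton's identities for the power sums of `e^Y` and of the identity
differ by an exponential. -/
theorem mul_invOfUnit_eq_exp_traceSum {Y : Matrix (Fin n) (Fin n) A}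
    (hY : ∀ i j, IsNilpotent (Y i j)) {N : ℕ} (hYN : Y ^ N = 0) (ε : ℂ) {H H₀ : A⟦X⟧}
    (h0 : coeff 0 H = 1) (h00 : coeff 0 H₀ = 1)
    (hH : ∀ k, ((k + 1 : ℕ) : A) * coeff (k + 1) H = ∑ a ∈ Finset.range (k + 1),
      algebraMap ℂ A ε ^ a * (nilEval expSeries Y ^ (a + 1)).trace * coeff (k - a) H)
    (hH₀ : ∀ k, ((k + 1 : ℕ) : A) * coeff (k + 1) H₀ = ∑ a ∈ Finset.range (k + 1),
      algebraMap ℂ A ε ^ a * (nilEval expSeries (0 : Matrix (Fin n) (Fin n) A) ^ (a + 1)).trace *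
        coeff (k - a) H₀) :
    H * H₀.invOfUnit 1 = nilEval expSeries (traceSum Y N (powSeries ε)) := by
  set Z := traceSum Y N (powSeries ε) with hZ
  have hZn : IsNilpotent Z := isNilpotent_traceSum hY N _
  have key : ∀ {F : A⟦X⟧} {p : ℕ → A}, (∀ k, ((k + 1 : ℕ) : A) * coeff (k + 1) F
      = ∑ a ∈ Finset.range (k + 1), algebraMap ℂ A ε ^ a * p (a + 1) * coeff (k - a) F) →
      d⁄dX A F = F * PowerSeries.mk fun a => algebraMap ℂ A ε ^ a * p (a + 1) := by
    intro F p hF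
    ext k
    rw [coeff_derivative, ← Nat.cast_succ, mul_comm, hF, mul_comm F, coeff_mul,
      Finset.Nat.sum_antidiagonal_eq_sum_range_succ_mk]
    simp
  have hd := key (p := fun a => (nilEval expSeries Y ^ a).trace) hH
  have hd₀ := key (p := fun a =>
    (nilEval expSeries (0 : Matrix (Fin n) (Fin n) A) ^ a).trace) hH₀
  have hdZ : (PowerSeries.mk fun a => algebraMap ℂ A ε ^ a * (nilEval expSeries Y ^ (a + 1)).trace)
      = (PowerSeries.mk fun a => algebraMap ℂ A ε ^ a *
          (nilEval expSeries (0 : Matrix (Fin n) (Fin n) A) ^ (a + 1)).trace) + d⁄dX A Z := by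
    ext a
    rw [map_add, coeff_mk, coeff_mk, hZ, traceSum, map_sum, map_sum, nilEval_exp_zero, one_pow,
      trace_exp_pow hYN]
    have e : ∀ i ∈ Finset.Ico 1 N, coeff a (d⁄dX A (C ((1 / (i.factorial : ℂ)) • (Y ^ i).trace) *
        map (algebraMap ℂ A) (powSeries ε i)))
        = algebraMap ℂ A ε ^ a *
          ((((a + 1 : ℕ) : ℂ) ^ i / (i.factorial : ℂ)) • (Y ^ i).trace) := by
      intro i hi
      rw [← smul_eq_C_mul, Derivation.map_smul, derivative_map, coeff_smul, coeff_map,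
        coeff_derivative_powSeries _ (Nat.one_le_iff_ne_zero.1 (Finset.mem_Ico.1 hi).1),
        smul_eq_mul, Algebra.smul_def, Algebra.smul_def, ← map_pow]
      simp only [map_mul, div_eq_mul_inv, one_mul]
      ring
    rw [Finset.sum_congr rfl e, ← Finset.mul_sum, ← mul_add]
    congr 1
    cases N with
    | zero =>
      have : Subsingleton (Matrix (Fin n) (Fin n) A) := subsingleton_of_zero_eq_one
        (by simpa using hYN.symm)
      simp [Subsingleton.elim (1 : Matrix (Fin n) (Fin n) A) 0]
    | succ N =>
      rw [Finset.range_eq_Ico, Finset.sum_eq_sum_Ico_succ_bot (Nat.succ_pos N)]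
      simp
  have hdE : d⁄dX A (nilEval expSeries Z) = nilEval expSeries Z * d⁄dX A Z := by
    rw [derivative_nilEval _ hZn, derivative_expSeries]
  have hcE : coeff 0 (nilEval expSeries Z) = 1 := by
    have hcZ : constantCoeff Z = 0 := by
      rw [hZ, traceSum, map_sum]
      refine Finset.sum_eq_zero fun i _ => ?_
      rw [map_mul, ← coeff_zero_eq_constantCoeff_apply (map _ _), coeff_map]
      simp [powSeries]
    rw [coeff_zero_eq_constantCoeff_apply, constantCoeff_nilEval _ hZn, hcZ, nilEval_exp_zero]
  have hmain : H = H₀ * nilEval expSeries Z := by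
    refine eq_of_derivative_eq_mul hd ?_ ?_
    · rw [Derivation.leibniz, hdE, hd₀, hdZ, smul_eq_mul, smul_eq_mul]
      ring
    · rw [coeff_zero_eq_constantCoeff_apply] at h0 h00 hcE ⊢
      rw [coeff_zero_eq_constantCoeff_apply, map_mul, h0, h00, hcE, mul_one]
  rw [hmain, mul_right_comm, mul_invOfUnit _ _ (by simpa using h00), one_mul]

/-- The endomorphism-valued form `(√-1/2π) R`. -/
def chernMatrix (R : Matrix (Fin n) (Fin n) A) : Matrix (Fin n) (Fin n) A :=
  (Complex.I / (2 * Real.pi)) • R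

theorem coeff_zero_chSym (R : Matrix (Fin n) (Fin n) A) : coeff 0 (chSym R) = 1 := by
  have e : symDer R 0 = 0 := by
    rw [← toMatrix_symOp]
    exact map_zero _
  rw [chSym, coeff_mk, e, smul_zero, nilEval_exp_zero, Matrix.trace_one, Fintype.card_coe,
    Finset.finsuppAntidiag_zero]
  simp

theorem coeff_zero_chLambda (R : Matrix (Fin n) (Fin n) A) : coeff 0 (chLambda R) = 1 := by
  nontriviality A
  have e : extDer (Matrix.toLin' R) 0 = 0 := by
    refine exteriorPower.linearMap_ext ?_
    ext1 v
    simp [extDer_ιMulti]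
  rw [chLambda, coeff_mk, e, smul_zero, nilEval_exp_zero, LinearMap.trace_one,
    exteriorPower.finrank_eq]
  simp

theorem chSym_newton {R : Matrix (Fin n) (Fin n) A} (hR : ∀ i j, IsNilpotent (R i j)) (k : ℕ) :
    ((k + 1 : ℕ) : A) * coeff (k + 1) (chSym R) = ∑ a ∈ Finset.range (k + 1),
      algebraMap ℂ A 1 ^ a * (nilEval expSeries (chernMatrix R) ^ (a + 1)).trace *
        coeff (k - a) (chSym R) := by
  simp only [chSym, coeff_mk, map_one, one_pow, one_mul]
  exact trace_exp_symDer_newton hR _ k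

theorem chLambda_newton {R : Matrix (Fin n) (Fin n) A} (hR : ∀ i j, IsNilpotent (R i j)) (k : ℕ) :
    ((k + 1 : ℕ) : A) * coeff (k + 1) (chLambda R) = ∑ a ∈ Finset.range (k + 1),
      algebraMap ℂ A (-1) ^ a * (nilEval expSeries (chernMatrix R) ^ (a + 1)).trace *
        coeff (k - a) (chLambda R) := by
  simp only [chLambda, coeff_mk, map_neg, map_one]
  exact trace_exp_extDer_newton hR _ k

theorem isNilpotent_chernMatrix {R : Matrix (Fin n) (Fin n) A} (hR : ∀ i j, IsNilpotent (R i j))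
    (i j : Fin n) : IsNilpotent (chernMatrix R i j) :=
  (hR i j).smul (Complex.I / (2 * Real.pi))

theorem chernMatrix_zero : chernMatrix (0 : Matrix (Fin n) (Fin n) A) = 0 := smul_zero _

/-- `ch(S_t(Ẽ)) = exp (∑_i (tr Y^i / i!) ∑_j j^{i-1} t^j)` with `Y = (√-1/2π) R`. The term `i = 0`, where
`tr 1` is the rank, is absent because of the division by `S_t` of the trivial bundle. -/
theorem chSymTilde_eq {R : Matrix (Fin n) (Fin n) A} (hR : ∀ i j, IsNilpotent (R i j)) {N : ℕ}
    (hN : chernMatrix R ^ N = 0) :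
    chSymTilde R = nilEval expSeries (traceSum (chernMatrix R) N (powSeries 1)) := by
  have h0 := chSym_newton (R := (0 : Matrix (Fin n) (Fin n) A)) fun _ _ => IsNilpotent.zero
  rw [chernMatrix_zero] at h0
  exact mul_invOfUnit_eq_exp_traceSum (isNilpotent_chernMatrix hR) hN 1 (coeff_zero_chSym _)
    (coeff_zero_chSym _) (chSym_newton hR) h0

theorem chLambdaTilde_eq {R : Matrix (Fin n) (Fin n) A} (hR : ∀ i j, IsNilpotent (R i j)) {N : ℕ}
    (hN : chernMatrix R ^ N = 0) :
    chLambdaTilde R = nilEval expSeries (traceSum (chernMatrix R) N (powSeries (-1))) := by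
  have h0 := chLambda_newton (R := (0 : Matrix (Fin n) (Fin n) A)) fun _ _ => IsNilpotent.zero
  rw [chernMatrix_zero] at h0
  exact mul_invOfUnit_eq_exp_traceSum (isNilpotent_chernMatrix hR) hN (-1) (coeff_zero_chLambda _)
    (coeff_zero_chLambda _) (chLambda_newton hR) h0

end Exponentials

/-! ### Infinite products of exponentials -/

section Products

open PowerSeries

variable {A : Type*} [CommRing A] {n : ℕ}

theorem hasSubst_monomial (ε : A) {k : ℕ} (hk : k ≠ 0) : HasSubst (C ε * (X : A⟦X⟧) ^ k) :=
  HasSubst.of_constantCoeff_zero' (by simp [hk])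

theorem coeff_atPow (ε : A) {k : ℕ} (hk : k ≠ 0) (F : A⟦X⟧) (m : ℕ) :
    coeff m (atPow ε k F) = if k ∣ m then ε ^ (m / k) * coeff (m / k) F else 0 := by
  rw [atPow, coeff_subst' (hasSubst_monomial ε hk)]
  have e : ∀ d, coeff d F • coeff m ((C ε * (X : A⟦X⟧) ^ k) ^ d)
      = if m = k * d then ε ^ d * coeff d F else 0 := by
    intro d
    rw [mul_pow, ← pow_mul, ← map_pow, coeff_C_mul, coeff_X_pow]
    split_ifs <;> simp [mul_comm]
  simp only [e]
  split_ifs with h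
  · obtain ⟨d, rfl⟩ := h
    rw [Nat.mul_div_cancel_left _ (Nat.pos_of_ne_zero hk), finsum_eq_single _ d]
    · simp
    · intro d' hd'
      rw [if_neg]
      intro h
      exact hd' (Nat.eq_of_mul_eq_mul_left (Nat.pos_of_ne_zero hk) h).symm
  · rw [finsum_eq_zero_of_forall_eq_zero]
    intro d
    rw [if_neg]
    rintro rfl
    exact h ⟨d, rfl⟩

/-- The substitution `t = ε s^k`, as an algebra homomorphism. -/
def atPowHom (ε : A) {k : ℕ} (hk : k ≠ 0) : A⟦X⟧ →ₐ[A] A⟦X⟧ := substAlgHom (hasSubst_monomial ε hk)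

theorem atPowHom_apply (ε : A) {k : ℕ} (hk : k ≠ 0) (F : A⟦X⟧) :
    atPowHom ε hk F = atPow ε k F := by
  rw [atPowHom, coe_substAlgHom, atPow]

theorem atPowHom_C (ε : A) {k : ℕ} (hk : k ≠ 0) (a : A) : atPowHom ε hk (C a) = C a :=
  (atPowHom ε hk).commutes a

theorem atPow_sub (ε : A) {k : ℕ} (hk : k ≠ 0) (F G : A⟦X⟧) :
    atPow ε k (F - G) = atPow ε k F - atPow ε k G := by
  simp only [← atPowHom_apply ε hk, map_sub]

theorem atPow_nilEval [Algebra ℂ A] (ε : A) {k : ℕ} (hk : k ≠ 0) (f : ℂ⟦X⟧) {Z : A⟦X⟧} (hZ : IsNilpotent Z) :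
    atPow ε k (nilEval f Z) = nilEval f (atPow ε k Z) := by
  simp only [← atPowHom_apply ε hk]
  exact map_nilEval ((atPowHom ε hk).restrictScalars ℂ) hZ f

theorem isNilpotent_atPow (ε : A) {k : ℕ} (hk : k ≠ 0) {Z : A⟦X⟧} (hZ : IsNilpotent Z) :
    IsNilpotent (atPow ε k Z) := by
  rw [← atPowHom_apply ε hk]
  exact hZ.map _

theorem atPow_map [Algebra ℂ A] (ε : ℂ) {k : ℕ} (hk : k ≠ 0) (φ : ℂ⟦X⟧) :
    atPow (algebraMap ℂ A ε) k (map (algebraMap ℂ A) φ) = map (algebraMap ℂ A) (atPow ε k φ) := by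
  ext m
  rw [coeff_map, coeff_atPow _ hk, coeff_atPow _ hk]
  split_ifs <;> simp

theorem atPow_traceSum [Algebra ℂ A] (ε : ℂ) {k : ℕ} (hk : k ≠ 0) (Y : Matrix (Fin n) (Fin n) A) (N : ℕ)
    (φ : ℕ → ℂ⟦X⟧) : atPow (algebraMap ℂ A ε) k (traceSum Y N φ)
      = traceSum Y N fun i => atPow ε k (φ i) := by
  simp only [traceSum, ← atPowHom_apply _ hk, map_sum, map_mul]
  refine Finset.sum_congr rfl fun i _ => ?_
  refine congrArg₂ _ ((atPowHom (algebraMap ℂ A ε) hk).commutes _) ?_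
  rw [atPowHom_apply, atPowHom_apply, atPow_map ε hk]

theorem atPow_one_atPow_one {k l : ℕ} (hk : k ≠ 0) (hl : l ≠ 0) (F : A⟦X⟧) :
    atPow 1 k (atPow 1 l F) = atPow 1 (k * l) F := by
  ext m
  rw [coeff_atPow _ hk, coeff_atPow _ (mul_ne_zero hk hl)]
  by_cases h : k ∣ m
  · obtain ⟨d, rfl⟩ := h
    rw [Nat.mul_div_cancel_left _ (Nat.pos_of_ne_zero hk), coeff_atPow _ hl,
      Nat.mul_div_mul_left _ _ (Nat.pos_of_ne_zero hk), if_pos (Dvd.intro _ rfl)]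
    by_cases h : l ∣ d
    · rw [if_pos h, if_pos (Nat.mul_dvd_mul_left k h)]
      simp
    · rw [if_neg h, if_neg fun h' => h ((Nat.mul_dvd_mul_iff_left (Nat.pos_of_ne_zero hk)).1 h'),
        mul_zero]
  · rw [if_neg h, if_neg fun h' => h (dvd_of_mul_right_dvd h')]

theorem X_pow_dvd_atPow (ε : A) {k : ℕ} (hk : k ≠ 0) {N : ℕ} {F : A⟦X⟧} (h : X ^ N ∣ F) :
    X ^ N ∣ atPow ε k F := by
  rw [X_pow_dvd_iff] at h ⊢
  intro m hm
  rw [coeff_atPow _ hk, h _ (lt_of_le_of_lt (Nat.div_le_self _ _) hm), mul_zero, ite_self]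

/-- `Φ = ∑_i φ_i` in the `X`-adic sense: `Φ` and `∑_{i ≤ N} φ_i` agree modulo `X^{N+1}`. -/
def IsSeriesSum {R : Type*} [CommRing R] (φ : ℕ → R⟦X⟧) (Φ : R⟦X⟧) : Prop :=
  ∀ N, X ^ (N + 1) ∣ Φ - ∑ i ∈ Finset.range (N + 1), φ i

theorem IsSeriesSum.add {R : Type*} [CommRing R] {φ ψ : ℕ → R⟦X⟧} {Φ Ψ : R⟦X⟧}
    (h : IsSeriesSum φ Φ) (h' : IsSeriesSum ψ Ψ) : IsSeriesSum (fun i => φ i + ψ i) (Φ + Ψ) := by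
  intro N
  rw [Finset.sum_add_distrib, add_sub_add_comm]
  exact dvd_add (h N) (h' N)

theorem IsSeriesSum.mul_left {R : Type*} [CommRing R] {φ : ℕ → R⟦X⟧} {Φ : R⟦X⟧}
    (h : IsSeriesSum φ Φ) (F : R⟦X⟧) : IsSeriesSum (fun i => F * φ i) (F * Φ) := by
  intro N
  rw [← Finset.mul_sum, ← mul_sub]
  exact (h N).mul_left F

theorem IsSeriesSum.sub {R : Type*} [CommRing R] {φ ψ : ℕ → R⟦X⟧} {Φ Ψ : R⟦X⟧}
    (h : IsSeriesSum φ Φ) (h' : IsSeriesSum ψ Ψ) : IsSeriesSum (fun i => φ i - ψ i) (Φ - Ψ) := by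
  simpa [sub_eq_add_neg] using h.add (h'.mul_left (-1))

theorem IsSeriesSum.atPow {φ : ℕ → A⟦X⟧} {Φ : A⟦X⟧} (h : IsSeriesSum φ Φ) (ε : A) {k : ℕ}
    (hk : k ≠ 0) : IsSeriesSum (fun i => atPow ε k (φ i)) (atPow ε k Φ) := by
  intro N
  have := X_pow_dvd_atPow ε hk (h N)
  simpa only [← atPowHom_apply ε hk, map_sub, map_sum] using this

variable [Algebra ℂ A]

theorem IsSeriesSum.map {φ : ℕ → ℂ⟦X⟧} {Φ : ℂ⟦X⟧} (h : IsSeriesSum φ Φ) :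
    IsSeriesSum (fun i => map (algebraMap ℂ A) (φ i)) (map (algebraMap ℂ A) Φ) := by
  intro N
  simpa using map_dvd (PowerSeries.map (algebraMap ℂ A)) (h N)

theorem IsSeriesSum.traceSum {φ : ℕ → ℕ → ℂ⟦X⟧} {Φ : ℕ → ℂ⟦X⟧} {N : ℕ}
    (h : ∀ k ∈ Finset.Ico 1 N, IsSeriesSum (fun i => φ i k) (Φ k)) (Y : Matrix (Fin n) (Fin n) A) :
    IsSeriesSum (fun i => traceSum Y N (φ i)) (traceSum Y N Φ) := by
  intro M
  simp only [CharForms.traceSum]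
  rw [Finset.sum_comm, ← Finset.sum_sub_distrib]
  exact Finset.dvd_sum fun k hk => ((h k hk).map (A := A)).mul_left _ M

/-- An infinite product of exponentials is the exponential of the sum of the exponents. -/
theorem seriesProd_exp {Z : ℕ → A⟦X⟧} {Z' : A⟦X⟧} (hZ : ∀ i, IsNilpotent (Z i))
    (hZ' : IsNilpotent Z') (h : IsSeriesSum Z Z') :
    seriesProd (fun i => nilEval expSeries (Z i)) = nilEval expSeries Z' := by
  ext N
  rw [seriesProd, coeff_mk, ← nilEval_exp_sum _ _ fun i _ => hZ i]
  set W := ∑ i ∈ Finset.range (N + 1), Z i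
  have hW : IsNilpotent W := isNilpotent_sum fun i _ => hZ i
  have hD : IsNilpotent (Z' - W) := (Commute.all _ _).isNilpotent_sub hZ' hW
  have e : nilEval expSeries Z' = nilEval expSeries W * nilEval expSeries (Z' - W) := by
    rw [← nilEval_exp_add (Commute.all _ _) hW hD, add_sub_cancel]
  have hdvd : X ^ (N + 1) ∣ nilEval expSeries (Z' - W) - 1 := by
    have hX : X ∣ expSeries - 1 := by
      rw [X_dvd_iff]
      simp [expSeries]
    obtain ⟨g, hg⟩ := hX
    rw [← nilEval_one hD, ← nilHom_apply hD, ← nilHom_apply hD, ← map_sub, hg, map_mul,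
      nilHom_apply, nilEval_X hD]
    exact (h N).mul_right _
  have := (X_pow_dvd_iff.1 (hdvd.mul_left (nilEval expSeries W))) N (Nat.lt_succ_self N)
  rw [mul_sub, mul_one, ← e, map_sub] at this
  exact (sub_eq_zero.1 this).symm

theorem invOfUnit_exp {Z : A⟦X⟧} (hZ : IsNilpotent Z) (h0 : constantCoeff (nilEval expSeries Z) = 1) :
    (nilEval expSeries Z).invOfUnit 1 = nilEval expSeries (-Z) := by
  have h1 := mul_invOfUnit (nilEval expSeries Z) 1 (by simpa using h0)
  have h2 : nilEval expSeries Z * nilEval expSeries (-Z) = 1 := by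
    rw [← nilEval_exp_add (Commute.all _ _) hZ hZ.neg, add_neg_cancel, nilEval_exp_zero]
  calc (nilEval expSeries Z).invOfUnit 1
      = (nilEval expSeries Z * nilEval expSeries (-Z)) * (nilEval expSeries Z).invOfUnit 1 := by
        rw [h2, one_mul]
    _ = nilEval expSeries (-Z) := by
        rw [mul_right_comm, h1, one_mul]

end Products

/-! ### Divisor sums -/

section DivisorSums

open PowerSeries

/-- The series `∑_{n ≥ 1} σ_{k-1}(n) s^n`. -/
def sigmaSeries (k : ℕ) : ℂ⟦X⟧ :=
  PowerSeries.mk fun m => (ArithmeticFunction.sigma (k - 1) m : ℂ)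

theorem isSeriesSum_sigma (k : ℕ) :
    IsSeriesSum (fun i => atPow 1 (i + 1) (powSeries 1 k)) (sigmaSeries k) := by
  intro N
  rw [X_pow_dvd_iff]
  intro m hm
  rw [map_sub, map_sum, sub_eq_zero, sigmaSeries, coeff_mk]
  simp only [coeff_atPow _ (Nat.succ_ne_zero _), one_pow, one_mul]
  cases m with
  | zero => simp [powSeries]
  | succ m =>
    rw [ArithmeticFunction.sigma_apply]
    push_cast
    rw [← Nat.sum_div_divisors (m + 1) (fun e => (e : ℂ) ^ (k - 1)), ← Finset.sum_filter]
    refine Finset.sum_bij' (fun e _ => e - 1) (fun i _ => i + 1) ?_ ?_ ?_ ?_ ?_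
    · intro e he
      have := Nat.divisor_le he
      have := Nat.pos_of_mem_divisors he
      rw [Finset.mem_filter, Finset.mem_range, Nat.succ_eq_add_one, Nat.sub_add_cancel this]
      exact ⟨by omega, Nat.dvd_of_mem_divisors he⟩
    · intro i hi
      exact Nat.mem_divisors.2 ⟨(Finset.mem_filter.1 hi).2, by omega⟩
    · intro e he
      exact Nat.sub_add_cancel (Nat.pos_of_mem_divisors he)
    · intro i _
      exact Nat.add_sub_cancel i 1
    · intro e he
      have h1 := Nat.pos_of_mem_divisors he
      have h2 : (m + 1) / e ≠ 0 :=
        (Nat.div_pos (Nat.divisor_le he) h1).ne'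
      simp [powSeries, Nat.sub_add_cancel h1, h2]

theorem isSeriesSum_even (k : ℕ) :
    IsSeriesSum (fun i => atPow 1 (2 * (i + 1)) (powSeries 1 k)) (atPow 1 2 (sigmaSeries k)) := by
  have := (isSeriesSum_sigma k).atPow 1 two_ne_zero
  simpa only [atPow_one_atPow_one two_ne_zero (Nat.succ_ne_zero _)] using this

theorem isSeriesSum_odd (k : ℕ) :
    IsSeriesSum (fun i => atPow 1 (2 * i + 1) (powSeries 1 k))
      (sigmaSeries k - atPow 1 2 (sigmaSeries k)) := by
  intro N
  have h1 := (pow_dvd_pow (X : ℂ⟦X⟧) (show N + 1 ≤ 2 * N + 1 + 1 by omega)).trans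
    (isSeriesSum_sigma k (2 * N + 1))
  have h2 := isSeriesSum_even k N
  have e : ∀ M, ∑ i ∈ Finset.range (2 * M), atPow 1 (i + 1) (powSeries 1 k)
      = ∑ i ∈ Finset.range M, atPow 1 (2 * i + 1) (powSeries 1 k)
        + ∑ i ∈ Finset.range M, atPow 1 (2 * (i + 1)) (powSeries 1 k) := by
    intro M
    induction M with
    | zero => simp
    | succ M ih =>
      rw [show 2 * (M + 1) = 2 * M + 1 + 1 by ring, Finset.sum_range_succ, Finset.sum_range_succ, ih,
        Finset.sum_range_succ _ M, Finset.sum_range_succ _ M]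
      ring_nf
  rw [show 2 * N + 1 + 1 = 2 * (N + 1) by ring, e] at h1
  convert dvd_sub h1 h2 using 1
  ring

theorem powSeries_neg_one {k : ℕ} (hk : k ≠ 0) :
    powSeries (-1) k = powSeries 1 k - C (2 ^ k : ℂ) * atPow 1 2 (powSeries 1 k) := by
  ext m
  rw [map_sub, coeff_C_mul, coeff_atPow _ two_ne_zero]
  simp only [powSeries, coeff_mk, one_pow, one_mul]
  rcases Nat.eq_zero_or_pos m with rfl | hm
  · simp
  rcases Nat.even_or_odd m with ⟨a, rfl⟩ | ⟨a, rfl⟩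
  · obtain ⟨k, rfl⟩ := Nat.exists_eq_succ_of_ne_zero hk
    have ha : a ≠ 0 := by omega
    rw [if_neg hm.ne', if_neg hm.ne', if_pos ⟨a, by ring⟩, show (a + a) / 2 = a by omega, if_neg ha,
      Odd.neg_one_pow ⟨a - 1, by omega⟩]
    simp only [Nat.succ_eq_add_one, Nat.add_sub_cancel]
    push_cast
    rw [← two_mul, mul_pow]
    ring
  · rw [if_neg hm.ne', if_neg hm.ne', if_neg (by omega), Nat.add_sub_cancel,
      Even.neg_one_pow ⟨a, by ring⟩]
    ring

theorem atPow_neg_one_powSeries (k : ℕ) {e : ℕ} (he : e ≠ 0) :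
    atPow (-1) e (powSeries (-1) k) = -atPow 1 e (powSeries 1 k) := by
  ext m
  rw [map_neg, coeff_atPow _ he, coeff_atPow _ he]
  simp only [powSeries, coeff_mk, one_pow, one_mul]
  split_ifs with h h'
  · simp
  · obtain ⟨j, hj⟩ := Nat.exists_eq_succ_of_ne_zero h'
    rw [hj, ← mul_assoc, ← pow_add, Odd.neg_one_pow ⟨j, by simp; ring⟩]
    ring
  · simp

/-- The exponent series of `⊗ S_{q^u}`. -/
def symExp (k : ℕ) : ℂ⟦X⟧ := atPow 1 2 (sigmaSeries k)

/-- The exponent series of `⊗ Λ_{q^v}`. -/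
def lamExp₁ (k : ℕ) : ℂ⟦X⟧ :=
  atPow 1 2 (sigmaSeries k) - C (2 ^ k : ℂ) * atPow 1 4 (sigmaSeries k)

/-- The exponent series of `⊗ Λ_{-q^{v-1/2}}`. -/
def lamExp₂ (k : ℕ) : ℂ⟦X⟧ := atPow 1 2 (sigmaSeries k) - sigmaSeries k

/-- The exponent series of `⊗ Λ_{q^{v-1/2}}`. -/
def lamExp₃ (k : ℕ) : ℂ⟦X⟧ :=
  sigmaSeries k - atPow 1 2 (sigmaSeries k)
    - C (2 ^ k : ℂ) * (atPow 1 2 (sigmaSeries k) - atPow 1 4 (sigmaSeries k))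

theorem isSeriesSum_lamExp₁ {k : ℕ} (hk : k ≠ 0) :
    IsSeriesSum (fun i => atPow 1 (2 * (i + 1)) (powSeries (-1) k)) (lamExp₁ k) := by
  have h := (isSeriesSum_even k).sub (((isSeriesSum_even k).atPow 1 two_ne_zero).mul_left
    (C (2 ^ k : ℂ)))
  rw [atPow_one_atPow_one two_ne_zero two_ne_zero] at h
  convert h using 2 with i
  · rw [powSeries_neg_one hk, atPow_one_atPow_one two_ne_zero (by omega),
      ← atPowHom_apply 1 (show 2 * (i + 1) ≠ 0 by omega), map_sub, map_mul, atPowHom_C,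
      atPowHom_apply, atPowHom_apply, atPow_one_atPow_one (by omega) two_ne_zero, mul_comm _ 2]
  · rfl

theorem isSeriesSum_lamExp₂ (k : ℕ) :
    IsSeriesSum (fun i => atPow (-1) (2 * i + 1) (powSeries (-1) k)) (lamExp₂ k) := by
  have h := (isSeriesSum_odd k).mul_left (-1)
  simpa [atPow_neg_one_powSeries k (Nat.succ_ne_zero _), lamExp₂] using h

theorem isSeriesSum_lamExp₃ {k : ℕ} (hk : k ≠ 0) :
    IsSeriesSum (fun i => atPow 1 (2 * i + 1) (powSeries (-1) k)) (lamExp₃ k) := by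
  have h := (isSeriesSum_odd k).sub (((isSeriesSum_odd k).atPow 1 two_ne_zero).mul_left
    (C (2 ^ k : ℂ)))
  rw [atPow_sub _ two_ne_zero, atPow_one_atPow_one two_ne_zero two_ne_zero] at h
  convert h using 2 with i
  · rw [powSeries_neg_one hk, atPow_one_atPow_one two_ne_zero (by omega),
      ← atPowHom_apply 1 (show 2 * i + 1 ≠ 0 by omega), map_sub, map_mul, atPowHom_C,
      atPowHom_apply, atPowHom_apply, atPow_one_atPow_one (by omega) two_ne_zero, mul_comm _ 2]
  · rfl

end DivisorSums

section Theta

open PowerSeries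

variable {A : Type*} [CommRing A] [Algebra ℂ A] {dT dW dξ : ℕ}

theorem seriesProd_atPow_exp {n : ℕ} {Y : Matrix (Fin n) (Fin n) A}
    (hY : ∀ i j, IsNilpotent (Y i j)) {N : ℕ} {φ : ℕ → ℂ⟦X⟧} {Φ : ℕ → ℂ⟦X⟧} (ε : ℂ) {e : ℕ → ℕ}
    (he : ∀ i, e i ≠ 0) (h : ∀ k ≠ 0, IsSeriesSum (fun i => atPow ε (e i) (φ k)) (Φ k)) :
    seriesProd (fun i => atPow (algebraMap ℂ A ε) (e i) (nilEval expSeries (traceSum Y N φ)))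
      = nilEval expSeries (traceSum Y N Φ) := by
  have hn := isNilpotent_traceSum hY N φ
  simp only [fun i => atPow_nilEval (algebraMap ℂ A ε) (he i) expSeries hn]
  refine seriesProd_exp (fun i => isNilpotent_atPow _ (he i) hn) (isNilpotent_traceSum hY N Φ) ?_
  simp only [fun i => atPow_traceSum ε (he i) Y N φ]
  exact IsSeriesSum.traceSum (fun k hk => h k (Nat.one_le_iff_ne_zero.1 (Finset.mem_Ico.1 hk).1)) Y

variable (RT : Matrix (Fin dT) (Fin dT) A) (RW : Matrix (Fin dW) (Fin dW) A)
  (Rξ : Matrix (Fin dξ) (Fin dξ) A) {N : ℕ}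

/-- The Chern character of `Λ_t(W̃ - 2ξ̃)` is the exponential of a combination of power sums. -/
theorem chLambdaTilde_mul_invOfUnit (hW : ∀ i j, IsNilpotent (RW i j))
    (hξ : ∀ i j, IsNilpotent (Rξ i j)) (hNW : chernMatrix RW ^ N = 0)
    (hNξ : chernMatrix Rξ ^ N = 0) :
    chLambdaTilde RW * ((chLambdaTilde Rξ) ^ 2).invOfUnit 1
      = nilEval expSeries (traceSum (chernMatrix RW) N (powSeries (-1))
          - 2 • traceSum (chernMatrix Rξ) N (powSeries (-1))) := by
  have nW := isNilpotent_traceSum (isNilpotent_chernMatrix hW) N (powSeries (-1))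
  have nξ := isNilpotent_traceSum (isNilpotent_chernMatrix hξ) N (powSeries (-1))
  have hc : constantCoeff (nilEval expSeries
      (2 • traceSum (chernMatrix Rξ) N (powSeries (-1)))) = 1 := by
    have : constantCoeff (traceSum (chernMatrix Rξ) N (powSeries (-1))) = 0 := by
      rw [traceSum, map_sum]
      refine Finset.sum_eq_zero fun i _ => ?_
      rw [map_mul, ← coeff_zero_eq_constantCoeff_apply (map _ _), coeff_map]
      simp [powSeries]
    rw [constantCoeff_nilEval _ (nξ.smul 2), map_nsmul, this, smul_zero, nilEval_exp_zero]
  rw [chLambdaTilde_eq hW hNW, chLambdaTilde_eq hξ hNξ, pow_two,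
    ← nilEval_exp_add (Commute.all _ _) nξ nξ, ← two_nsmul, invOfUnit_exp (nξ.smul 2) hc,
    ← nilEval_exp_add (Commute.all _ _) nW (nξ.smul 2).neg, sub_eq_add_neg]

theorem seriesProd_atPow_exp_two {n n' : ℕ} {Y : Matrix (Fin n) (Fin n) A}
    {Y' : Matrix (Fin n') (Fin n') A} (hY : ∀ i j, IsNilpotent (Y i j))
    (hY' : ∀ i j, IsNilpotent (Y' i j)) {N : ℕ} {φ : ℕ → ℂ⟦X⟧} {Φ : ℕ → ℂ⟦X⟧} (ε : ℂ) {e : ℕ → ℕ}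
    (he : ∀ i, e i ≠ 0) (h : ∀ k ≠ 0, IsSeriesSum (fun i => atPow ε (e i) (φ k)) (Φ k)) :
    seriesProd (fun i => atPow (algebraMap ℂ A ε) (e i)
        (nilEval expSeries (traceSum Y N φ - 2 • traceSum Y' N φ)))
      = nilEval expSeries (traceSum Y N Φ - 2 • traceSum Y' N Φ) := by
  have sub {Z Z' : A⟦X⟧} (h : IsNilpotent Z) (h' : IsNilpotent Z') : IsNilpotent (Z - 2 • Z') :=
    (Commute.all _ _).isNilpotent_sub h (h'.smul 2)
  have hn := sub (isNilpotent_traceSum hY N φ) (isNilpotent_traceSum hY' N φ)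
  simp only [fun i => atPow_nilEval (algebraMap ℂ A ε) (he i) expSeries hn]
  refine seriesProd_exp (fun i => isNilpotent_atPow _ (he i) hn)
    (sub (isNilpotent_traceSum hY N Φ) (isNilpotent_traceSum hY' N Φ)) ?_
  have hs {n : ℕ} (Y : Matrix (Fin n) (Fin n) A) :=
    IsSeriesSum.traceSum (N := N) (φ := fun i k => atPow ε (e i) (φ k)) (Φ := Φ)
      (fun k hk => h k (Nat.one_le_iff_ne_zero.1 (Finset.mem_Ico.1 hk).1)) Y
  have := (hs Y).sub ((hs Y').mul_left 2)
  convert this using 2 with i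
  · rw [atPow_sub _ (he i), ← atPowHom_apply _ (he i) (2 • _), map_nsmul, atPowHom_apply,
      atPow_traceSum ε (he i), atPow_traceSum ε (he i), nsmul_eq_mul, Nat.cast_ofNat]
  · rw [nsmul_eq_mul, Nat.cast_ofNat]

/-- The exponent of `ch(Θ₁)`. -/
def thetaExp₁ (N : ℕ) : A⟦X⟧ :=
  traceSum (chernMatrix RT) N symExp
    + (traceSum (chernMatrix RW) N lamExp₁ - 2 • traceSum (chernMatrix Rξ) N lamExp₁)
    + traceSum (chernMatrix Rξ) N lamExp₃ + traceSum (chernMatrix Rξ) N lamExp₂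

/-- The exponent of `ch(Θ₂)`. -/
def thetaExp₂ (N : ℕ) : A⟦X⟧ :=
  traceSum (chernMatrix RT) N symExp
    + (traceSum (chernMatrix RW) N lamExp₂ - 2 • traceSum (chernMatrix Rξ) N lamExp₂)
    + traceSum (chernMatrix Rξ) N lamExp₃ + traceSum (chernMatrix Rξ) N lamExp₁

theorem chTheta_eq (hT : ∀ i j, IsNilpotent (RT i j)) (hW : ∀ i j, IsNilpotent (RW i j))
    (hξ : ∀ i j, IsNilpotent (Rξ i j)) (hNT : chernMatrix RT ^ N = 0)
    (hNW : chernMatrix RW ^ N = 0) (hNξ : chernMatrix Rξ ^ N = 0) :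
    chTheta₁ RT RW Rξ = nilEval expSeries (thetaExp₁ RT RW Rξ N) ∧
      chTheta₂ RT RW Rξ = nilEval expSeries (thetaExp₂ RT RW Rξ N) := by
  have nT := fun φ => isNilpotent_traceSum (isNilpotent_chernMatrix hT) N φ
  have nW := fun φ => isNilpotent_traceSum (isNilpotent_chernMatrix hW) N φ
  have nξ := fun φ => isNilpotent_traceSum (isNilpotent_chernMatrix hξ) N φ
  have sub {Z Z' : A⟦X⟧} (h : IsNilpotent Z) (h' : IsNilpotent Z') : IsNilpotent (Z - 2 • Z') :=
    (Commute.all _ _).isNilpotent_sub h (h'.smul 2)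
  have add {Z Z' : A⟦X⟧} (h : IsNilpotent Z) (h' : IsNilpotent Z') : IsNilpotent (Z + Z') :=
    (Commute.all _ _).isNilpotent_add h h'
  have e1 : (1 : A) = algebraMap ℂ A 1 := (map_one _).symm
  have e2 : (-1 : A) = algebraMap ℂ A (-1) := by rw [map_neg, map_one]
  have hT1 := seriesProd_atPow_exp (isNilpotent_chernMatrix hT) (N := N) (φ := powSeries 1) 1
    (e := fun i => 2 * (i + 1)) (fun i => by simp) fun k _ => isSeriesSum_even k
  have hξ1 := seriesProd_atPow_exp (isNilpotent_chernMatrix hξ) (N := N) (φ := powSeries (-1)) 1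
    (e := fun i => 2 * (i + 1)) (fun i => by simp) fun k hk => isSeriesSum_lamExp₁ hk
  have hξ2 := seriesProd_atPow_exp (isNilpotent_chernMatrix hξ) (N := N) (φ := powSeries (-1)) (-1)
    (e := fun i => 2 * i + 1) (fun i => by simp) fun k _ => isSeriesSum_lamExp₂ k
  have hξ3 := seriesProd_atPow_exp (isNilpotent_chernMatrix hξ) (N := N) (φ := powSeries (-1)) 1
    (e := fun i => 2 * i + 1) (fun i => by simp) fun k hk => isSeriesSum_lamExp₃ hk
  have hW1 := seriesProd_atPow_exp_two (isNilpotent_chernMatrix hW) (isNilpotent_chernMatrix hξ)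
    (N := N) (φ := powSeries (-1)) 1 (e := fun i => 2 * (i + 1)) (fun i => by simp)
    fun k hk => isSeriesSum_lamExp₁ hk
  have hW2 := seriesProd_atPow_exp_two (isNilpotent_chernMatrix hW) (isNilpotent_chernMatrix hξ)
    (N := N) (φ := powSeries (-1)) (-1) (e := fun i => 2 * i + 1) (fun i => by simp)
    fun k _ => isSeriesSum_lamExp₂ k
  constructor
  · rw [chTheta₁, chLambdaTilde_mul_invOfUnit RW Rξ hW hξ hNW hNξ, chSymTilde_eq hT hNT,
      chLambdaTilde_eq hξ hNξ, e2, e1, hT1, hW1, hξ2, hξ3, thetaExp₁,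
      nilEval_exp_add (Commute.all _ _) (add (add (nT _) (sub (nW _) (nξ _))) (nξ _)) (nξ _),
      nilEval_exp_add (Commute.all _ _) (add (nT _) (sub (nW _) (nξ _))) (nξ _),
      nilEval_exp_add (Commute.all _ _) (nT _) (sub (nW _) (nξ _))]
    rfl
  · rw [chTheta₂, chLambdaTilde_mul_invOfUnit RW Rξ hW hξ hNW hNξ, chSymTilde_eq hT hNT,
      chLambdaTilde_eq hξ hNξ, e2, e1, hT1, hW2, hξ1, hξ3, thetaExp₂,
      nilEval_exp_add (Commute.all _ _) (add (add (nT _) (sub (nW _) (nξ _))) (nξ _)) (nξ _),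
      nilEval_exp_add (Commute.all _ _) (add (nT _) (sub (nW _) (nξ _))) (nξ _),
      nilEval_exp_add (Commute.all _ _) (nT _) (sub (nW _) (nξ _))]
    rfl

end Theta

/-! ### Sums of `q`-series -/

section QSeries

open PowerSeries

theorem nilEval_mem {B : Type*} [Ring B] [Algebra ℂ B] (S : Subalgebra ℂ B) (f : ℂ⟦X⟧) {b : B}
    (hb : b ∈ S) : nilEval f b ∈ S :=
  S.sum_mem fun k _ => S.smul_mem (S.pow_mem hb k) _

theorem isNilpotent_prodMk {B C : Type*} [CommRing B] [CommRing C] {b : B} {c : C}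
    (hb : IsNilpotent b) (hc : IsNilpotent c) : IsNilpotent (b, c) := by
  obtain ⟨k, hk⟩ := hb
  obtain ⟨l, hl⟩ := hc
  exact ⟨k + l, Prod.ext (by simp [pow_add, hk]) (by simp [pow_add, hl])⟩

theorem nilEval_prodMk {B C : Type*} [CommRing B] [Algebra ℂ B] [CommRing C] [Algebra ℂ C] {b : B}
    {c : C} (hb : IsNilpotent b) (hc : IsNilpotent c) (f : ℂ⟦X⟧) :
    nilEval f (b, c) = (nilEval f b, nilEval f c) :=
  Prod.ext (map_nilEval (AlgHom.fst ℂ B C) (isNilpotent_prodMk hb hc) f)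
    (map_nilEval (AlgHom.snd ℂ B C) (isNilpotent_prodMk hb hc) f)

theorem qTerm_mul {A : Type*} [CommRing A] [Algebra ℂ A] (F G : A⟦X⟧) (τ : ℍ) (n : ℕ) :
    qTerm (F * G) τ n = ∑ kl ∈ Finset.HasAntidiagonal.antidiagonal n,
      qTerm F τ kl.1 * qTerm G τ kl.2 := by
  rw [qTerm, coeff_mul, Finset.smul_sum]
  refine Finset.sum_congr rfl fun kl hkl => ?_
  rw [qTerm, qTerm, smul_mul_smul_comm, ← Complex.exp_add,
    ← Finset.HasAntidiagonal.mem_antidiagonal.1 hkl]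
  congr 2
  push_cast
  ring

/-- The algebra of pairs of a power series `φ` in `s = q^{1/2}` with complex coefficients,
absolutely convergent on the upper half plane, and its sum. -/
def scalarQPairs : Subalgebra ℂ (ℂ⟦X⟧ × (ℍ → ℂ)) where
  carrier := {p | ∀ τ, Summable (fun j => ‖qTerm p.1 τ j‖) ∧ p.2 τ = ∑' j, qTerm p.1 τ j}
  mul_mem' := by
    rintro ⟨φ, g⟩ ⟨ψ, h⟩ hp hp' τ
    have h1 := hp τ
    have h2 := hp' τ
    simp only [Prod.mk_mul_mk, qTerm_mul, Pi.mul_apply] at h1 h2 ⊢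
    rw [h1.2, h2.2]
    exact ⟨summable_norm_sum_mul_antidiagonal_of_summable_norm h1.1 h2.1,
      tsum_mul_tsum_eq_tsum_sum_antidiagonal_of_summable_norm h1.1 h2.1⟩
  add_mem' := by
    rintro ⟨φ, g⟩ ⟨ψ, h⟩ hp hp' τ
    have h1 := hp τ
    have h2 := hp' τ
    have e : ∀ j, qTerm (φ + ψ) τ j = qTerm φ τ j + qTerm ψ τ j := fun j => by
      simp [qTerm, mul_add]
    simp only [Prod.mk_add_mk, Pi.add_apply, e] at h1 h2 ⊢
    rw [h1.2, h2.2]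
    exact ⟨(h1.1.add h2.1).of_nonneg_of_le (fun _ => norm_nonneg _) fun _ => norm_add_le _ _,
      (h1.1.of_norm.tsum_add h2.1.of_norm).symm⟩
  algebraMap_mem' := by
    intro c τ
    have e : ∀ j ≠ 0, qTerm ((algebraMap ℂ (ℂ⟦X⟧ × (ℍ → ℂ)) c).1) τ j = 0 := by
      intro j hj
      simp [qTerm, Prod.algebraMap_apply, coeff_C, hj]
    refine ⟨summable_of_ne_finset_zero (s := {0}) fun j hj => ?_, ?_⟩
    · rw [e j (by simpa using hj), norm_zero]
    · rw [tsum_eq_single 0 e]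
      simp [qTerm, Prod.algebraMap_apply]

variable (A : Type*) [CommRing A] [Algebra ℂ A]

/-- Extension of scalars from `ℂ` to `A` of a pair of a power series and a function. -/
def scalarPairHom : ℂ⟦X⟧ × (ℍ → ℂ) →ₐ[ℂ] A⟦X⟧ × (ℍ → A) :=
  AlgHom.prod ((mapAlgHom (Algebra.ofId ℂ A)).comp (AlgHom.fst ℂ _ _))
    ((AlgHom.pi fun τ : ℍ => (Algebra.ofId ℂ A).comp (Pi.evalAlgHom ℂ (fun _ : ℍ => ℂ) τ)).comp
      (AlgHom.snd ℂ _ _))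

/-- The algebra, generated over `A` by the pairs with complex coefficients, of pairs of a convergent
power series in `s = q^{1/2}` and its sum. -/
def qPairs : Subalgebra A (A⟦X⟧ × (ℍ → A)) :=
  Algebra.adjoin A (scalarQPairs.map (scalarPairHom A) : Set (A⟦X⟧ × (ℍ → A)))

variable {A}

theorem smul_mem_qPairs {φ : ℂ⟦X⟧} {g : ℍ → ℂ} (h : (φ, g) ∈ scalarQPairs) (a : A) :
    (C a * map (algebraMap ℂ A) φ, fun τ => g τ • a) ∈ qPairs A := by
  have := (qPairs A).smul_mem (Algebra.subset_adjoin (Subalgebra.mem_map.2 ⟨_, h, rfl⟩)) a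
  convert this using 1
  refine Prod.ext ?_ (funext fun τ => ?_)
  · change _ = a • map (algebraMap ℂ A) φ
    rw [smul_eq_C_mul]
  · change g τ • a = a * algebraMap ℂ A (g τ)
    rw [Algebra.smul_def, mul_comm]

theorem t2Space_moduleTopology [Module.Finite ℂ A] : @T2Space A (moduleTopology ℂ A) := by
  let _ : TopologicalSpace A := moduleTopology ℂ A
  have : IsModuleTopology ℂ A := ⟨rfl⟩
  let e := (Module.finBasis ℂ A).equivFun
  exact T2Space.of_injective_continuous e.injective
    (IsModuleTopology.continuous_of_linearMap e.toLinearMap)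

/-- The pairs in `qPairs A` are convergent series together with their sums. -/
theorem qEval_eq_of_mem [Module.Finite ℂ A] {F : A⟦X⟧} {G : ℍ → A} (h : (F, G) ∈ qPairs A) :
    QConverges F ∧ qEval F = G := by
  let _ : TopologicalSpace A := moduleTopology ℂ A
  have : IsModuleTopology ℂ A := ⟨rfl⟩
  have : T2Space A := t2Space_moduleTopology
  have : ContinuousAdd A := IsModuleTopology.toContinuousAdd ℂ A
  suffices hs : ∀ p ∈ qPairs A, ∀ τ, HasSum (qTerm p.1 τ) (p.2 τ) from
    ⟨fun τ => (hs _ h τ).summable, funext fun τ => (hs _ h τ).tsum_eq⟩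
  intro p hp τ
  rw [qPairs, ← Subalgebra.mem_toSubmodule, Algebra.adjoin_eq_span] at hp
  have hcl : (Submonoid.closure (scalarQPairs.map (scalarPairHom A) : Set (A⟦X⟧ × (ℍ → A))) :
      Set (A⟦X⟧ × (ℍ → A))) = scalarQPairs.map (scalarPairHom A) := by
    exact congrArg _ (Submonoid.closure_eq (scalarQPairs.map (scalarPairHom A)).toSubmonoid)
  rw [hcl] at hp
  induction hp using Submodule.span_induction with
  | mem p hp =>
    obtain ⟨⟨φ, g⟩, hφ, rfl⟩ := hp
    have h1 := (hφ τ).1.of_norm.hasSum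
    rw [← (hφ τ).2] at h1
    have h2 := h1.map (Algebra.linearMap ℂ A)
      (IsModuleTopology.continuous_of_linearMap (Algebra.linearMap ℂ A))
    convert h2 using 1
    · funext j
      change _ • coeff j (map (algebraMap ℂ A) φ) = algebraMap ℂ A (_ • _)
      rw [coeff_map, smul_eq_mul, map_mul, Algebra.smul_def]
    · rfl
  | zero =>
    convert hasSum_zero using 1
    · funext j
      simp [qTerm]
    · rfl
  | add p p' _ _ hp hp' =>
    convert hp.add hp' using 1
    · funext j
      simp [qTerm]
    · rfl
  | smul a p _ hp =>
    convert hp.map (LinearMap.mulLeft ℂ a)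
      (IsModuleTopology.continuous_of_linearMap (LinearMap.mulLeft ℂ a)) using 1
    · funext j
      simp [qTerm]
    · rfl

/-- The value at `s = e^{π i τ}` of `traceSum Y N φ`, where `g k` is the sum of the series `φ k`. -/
def traceEval {n : ℕ} (Y : Matrix (Fin n) (Fin n) A) (N : ℕ) (g : ℕ → ℂ) : A :=
  ∑ k ∈ Finset.Ico 1 N, g k • ((1 / k.factorial : ℂ) • (Y ^ k).trace)

theorem traceSum_mem_qPairs {n : ℕ} (Y : Matrix (Fin n) (Fin n) A) (N : ℕ) {φ : ℕ → ℂ⟦X⟧}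
    {g : ℕ → ℍ → ℂ} (h : ∀ k ≠ 0, (φ k, g k) ∈ scalarQPairs) :
    (traceSum Y N φ, fun τ => traceEval Y N fun k => g k τ) ∈ qPairs A := by
  have := (qPairs A).sum_mem (t := Finset.Ico 1 N) fun k hk =>
    smul_mem_qPairs (h k (Nat.one_le_iff_ne_zero.1 (Finset.mem_Ico.1 hk).1))
      ((1 / k.factorial : ℂ) • (Y ^ k).trace)
  convert this using 1
  refine Prod.ext ?_ (funext fun τ => ?_)
  · rw [Prod.fst_sum, traceSum]
  · simp [Prod.snd_sum, traceEval]

/-- The sum `∑_{n ≥ 1} σ_{k-1}(n) e^{2π i n z}`. -/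
def sigmaSum (k : ℕ) (z : ℂ) : ℂ :=
  ∑' n : ℕ, (ArithmeticFunction.sigma (k - 1) n : ℂ) * Complex.exp (2 * Real.pi * Complex.I * z) ^ n

theorem sigmaSeries_mem {k e : ℕ} (hk : k ≠ 0) (he : e ≠ 0) :
    (atPow 1 e (sigmaSeries k), fun τ : ℍ => sigmaSum k (e * τ / 2)) ∈ scalarQPairs := by
  intro τ
  have hinj : Function.Injective fun n : ℕ => e * n := fun a b h =>
    Nat.eq_of_mul_eq_mul_left (Nat.pos_of_ne_zero he) h
  have h0 : ∀ j ∉ Set.range fun n : ℕ => e * n, qTerm (atPow 1 e (sigmaSeries k)) τ j = 0 := by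
    intro j hj
    rw [qTerm, coeff_atPow _ he, if_neg, smul_zero]
    rintro ⟨n, rfl⟩
    exact hj ⟨n, rfl⟩
  have h1 : ∀ n : ℕ, qTerm (atPow 1 e (sigmaSeries k)) τ (e * n)
      = (ArithmeticFunction.sigma (k - 1) n : ℂ) *
        Complex.exp (2 * Real.pi * Complex.I * (e * τ / 2)) ^ n := by
    intro n
    rw [qTerm, coeff_atPow _ he, if_pos (Dvd.intro _ rfl),
      Nat.mul_div_cancel_left _ (Nat.pos_of_ne_zero he), one_pow, one_mul, sigmaSeries, coeff_mk,
      ← Complex.exp_nat_mul, smul_eq_mul, mul_comm]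
    congr 2
    push_cast
    ring
  let τ' : ℍ := ⟨e * τ / 2, by
    have : ((e : ℂ) * τ / 2) = ((e / 2 : ℝ) : ℂ) * τ := by push_cast; ring
    rw [this, Complex.im_ofReal_mul]
    exact mul_pos (by positivity) τ.im_pos⟩
  have hs := EisensteinSeries.summable_sigma_mul_cexp_pow (Nat.one_le_iff_ne_zero.2 hk) τ'
  have hs' : Summable (qTerm (atPow 1 e (sigmaSeries k)) τ) := by
    refine (hinj.summable_iff h0).1 ?_
    simpa only [Function.comp_def, h1] using hs
  refine ⟨hs'.norm, ?_⟩
  rw [← hinj.tsum_eq (f := qTerm (atPow 1 e (sigmaSeries k)) τ)]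
  · simp only [h1, sigmaSum]
  · intro j hj
    by_contra h
    exact hj (h0 j h)

end QSeries

section ThetaValues

open PowerSeries

/-- The sum of `symExp k`. -/
def symVal (τ : ℍ) (k : ℕ) : ℂ := sigmaSum k τ

/-- The sum of `lamExp₁ k`. -/
def lamVal₁ (τ : ℍ) (k : ℕ) : ℂ := sigmaSum k τ - 2 ^ k * sigmaSum k (2 * τ)

/-- The sum of `lamExp₂ k`. -/
def lamVal₂ (τ : ℍ) (k : ℕ) : ℂ := sigmaSum k τ - sigmaSum k (τ / 2)

/-- The sum of `lamExp₃ k`. -/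
def lamVal₃ (τ : ℍ) (k : ℕ) : ℂ :=
  sigmaSum k (τ / 2) - sigmaSum k τ - 2 ^ k * (sigmaSum k τ - sigmaSum k (2 * τ))

theorem exp_mem_scalarQPairs {k : ℕ} (hk : k ≠ 0) :
    (symExp k, fun τ => symVal τ k) ∈ scalarQPairs ∧
    (lamExp₁ k, fun τ => lamVal₁ τ k) ∈ scalarQPairs ∧
    (lamExp₂ k, fun τ => lamVal₂ τ k) ∈ scalarQPairs ∧
    (lamExp₃ k, fun τ => lamVal₃ τ k) ∈ scalarQPairs := by
  have h1 : (sigmaSeries k, fun τ : ℍ => sigmaSum k (τ / 2)) ∈ scalarQPairs := by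
    convert sigmaSeries_mem hk one_ne_zero using 2
    · ext m
      rw [coeff_atPow _ one_ne_zero]
      simp
    · funext τ
      simp
  have h2 : (atPow 1 2 (sigmaSeries k), fun τ : ℍ => sigmaSum k τ) ∈ scalarQPairs := by
    convert sigmaSeries_mem hk two_ne_zero using 2
    funext τ
    congr 1
    push_cast
    ring
  have h4 : (atPow 1 4 (sigmaSeries k), fun τ : ℍ => sigmaSum k (2 * τ)) ∈ scalarQPairs := by
    convert sigmaSeries_mem hk four_ne_zero using 2
    funext τ
    congr 1
    push_cast
    ring
  have hc {φ : ℂ⟦X⟧} {g : ℍ → ℂ} (h : (φ, g) ∈ scalarQPairs) :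
      (C (2 ^ k : ℂ) * φ, fun τ => 2 ^ k * g τ) ∈ scalarQPairs := by
    have := scalarQPairs.smul_mem h (2 ^ k : ℂ)
    rwa [Prod.smul_mk, smul_eq_C_mul] at this
  have hs {φ ψ : ℂ⟦X⟧} {g h : ℍ → ℂ} (H : (φ, g) ∈ scalarQPairs) (H' : (ψ, h) ∈ scalarQPairs) :
      (φ - ψ, fun τ => g τ - h τ) ∈ scalarQPairs := by
    have := scalarQPairs.sub_mem H H'
    rwa [Prod.mk_sub_mk] at this
  simp only [symExp, symVal, lamExp₁, lamExp₂, lamExp₃, lamVal₁, lamVal₂, lamVal₃]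
  exact ⟨h2, hs h2 (hc h4), hs h2 h1, hs (hs h1 h2) (hc (hs h2 h4))⟩

variable {A : Type*} [CommRing A] [Algebra ℂ A] {dT dW dξ : ℕ}
  (RT : Matrix (Fin dT) (Fin dT) A) (RW : Matrix (Fin dW) (Fin dW) A)
  (Rξ : Matrix (Fin dξ) (Fin dξ) A) {N : ℕ}

/-- The sum of `thetaExp₁`. -/
def thetaVal₁ (N : ℕ) (τ : ℍ) : A :=
  traceEval (chernMatrix RT) N (symVal τ)
    + (traceEval (chernMatrix RW) N (lamVal₁ τ) - 2 • traceEval (chernMatrix Rξ) N (lamVal₁ τ))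
    + traceEval (chernMatrix Rξ) N (lamVal₃ τ) + traceEval (chernMatrix Rξ) N (lamVal₂ τ)

/-- The sum of `thetaExp₂`. -/
def thetaVal₂ (N : ℕ) (τ : ℍ) : A :=
  traceEval (chernMatrix RT) N (symVal τ)
    + (traceEval (chernMatrix RW) N (lamVal₂ τ) - 2 • traceEval (chernMatrix Rξ) N (lamVal₂ τ))
    + traceEval (chernMatrix Rξ) N (lamVal₃ τ) + traceEval (chernMatrix Rξ) N (lamVal₁ τ)

variable {RT RW Rξ}

theorem isNilpotent_traceEval {n : ℕ} {Y : Matrix (Fin n) (Fin n) A}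
    (hY : ∀ i j, IsNilpotent (Y i j)) (N : ℕ) (g : ℕ → ℂ) : IsNilpotent (traceEval Y N g) := by
  refine isNilpotent_sum fun k hk => ?_
  have h := isNilpotent_trace_pow hY (Nat.one_le_iff_ne_zero.1 (Finset.mem_Ico.1 hk).1)
  generalize (1 / k.factorial : ℂ) = c
  exact (h.smul c).smul (g k)

theorem isNilpotent_thetaVal (hT : ∀ i j, IsNilpotent (RT i j)) (hW : ∀ i j, IsNilpotent (RW i j))
    (hξ : ∀ i j, IsNilpotent (Rξ i j)) (N : ℕ) (τ : ℍ) :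
    IsNilpotent (thetaVal₁ RT RW Rξ N τ) ∧ IsNilpotent (thetaVal₂ RT RW Rξ N τ) := by
  have nT := fun g => isNilpotent_traceEval (isNilpotent_chernMatrix hT) N g
  have nW := fun g => isNilpotent_traceEval (isNilpotent_chernMatrix hW) N g
  have nξ := fun g => isNilpotent_traceEval (isNilpotent_chernMatrix hξ) N g
  have sub {Z Z' : A} (h : IsNilpotent Z) (h' : IsNilpotent Z') : IsNilpotent (Z - 2 • Z') :=
    (Commute.all _ _).isNilpotent_sub h (h'.smul 2)
  have add {Z Z' : A} (h : IsNilpotent Z) (h' : IsNilpotent Z') : IsNilpotent (Z + Z') :=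
    (Commute.all _ _).isNilpotent_add h h'
  exact ⟨add (add (add (nT _) (sub (nW _) (nξ _))) (nξ _)) (nξ _),
    add (add (add (nT _) (sub (nW _) (nξ _))) (nξ _)) (nξ _)⟩

theorem isNilpotent_thetaExp (hT : ∀ i j, IsNilpotent (RT i j)) (hW : ∀ i j, IsNilpotent (RW i j))
    (hξ : ∀ i j, IsNilpotent (Rξ i j)) (N : ℕ) :
    IsNilpotent (thetaExp₁ RT RW Rξ N) ∧ IsNilpotent (thetaExp₂ RT RW Rξ N) := by
  have nT := fun g => isNilpotent_traceSum (isNilpotent_chernMatrix hT) N g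
  have nW := fun g => isNilpotent_traceSum (isNilpotent_chernMatrix hW) N g
  have nξ := fun g => isNilpotent_traceSum (isNilpotent_chernMatrix hξ) N g
  have sub {Z Z' : A⟦X⟧} (h : IsNilpotent Z) (h' : IsNilpotent Z') : IsNilpotent (Z - 2 • Z') :=
    (Commute.all _ _).isNilpotent_sub h (h'.smul 2)
  have add {Z Z' : A⟦X⟧} (h : IsNilpotent Z) (h' : IsNilpotent Z') : IsNilpotent (Z + Z') :=
    (Commute.all _ _).isNilpotent_add h h'
  exact ⟨add (add (add (nT _) (sub (nW _) (nξ _))) (nξ _)) (nξ _),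
    add (add (add (nT _) (sub (nW _) (nξ _))) (nξ _)) (nξ _)⟩

theorem thetaExp_mem_qPairs (N : ℕ) :
    (thetaExp₁ RT RW Rξ N, thetaVal₁ RT RW Rξ N) ∈ qPairs A ∧
      (thetaExp₂ RT RW Rξ N, thetaVal₂ RT RW Rξ N) ∈ qPairs A := by
  have hT := traceSum_mem_qPairs (chernMatrix RT) N fun k hk => (exp_mem_scalarQPairs hk).1
  have hW1 := traceSum_mem_qPairs (chernMatrix RW) N fun k hk => (exp_mem_scalarQPairs hk).2.1
  have hW2 := traceSum_mem_qPairs (chernMatrix RW) N fun k hk => (exp_mem_scalarQPairs hk).2.2.1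
  have h1 := traceSum_mem_qPairs (chernMatrix Rξ) N fun k hk => (exp_mem_scalarQPairs hk).2.1
  have h2 := traceSum_mem_qPairs (chernMatrix Rξ) N fun k hk => (exp_mem_scalarQPairs hk).2.2.1
  have h3 := traceSum_mem_qPairs (chernMatrix Rξ) N fun k hk => (exp_mem_scalarQPairs hk).2.2.2
  exact ⟨(qPairs A).add_mem ((qPairs A).add_mem ((qPairs A).add_mem hT
      ((qPairs A).sub_mem hW1 ((qPairs A).nsmul_mem h1 2))) h3) h2,
    (qPairs A).add_mem ((qPairs A).add_mem ((qPairs A).add_mem hT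
      ((qPairs A).sub_mem hW2 ((qPairs A).nsmul_mem h2 2))) h3) h1⟩

/-- An exponential of a convergent nilpotent series converges to the exponential of the sum. -/
theorem qEval_exp [Module.Finite ℂ A] {Z : A⟦X⟧} {z : ℍ → A} (h : (Z, z) ∈ qPairs A)
    (hZ : IsNilpotent Z) (hz : ∃ M, ∀ τ, z τ ^ M = 0) :
    QConverges (nilEval expSeries Z) ∧
      qEval (nilEval expSeries Z) = fun τ => nilEval expSeries (z τ) := by
  obtain ⟨M, hM⟩ := hz
  have hz' : IsNilpotent z := ⟨M, funext hM⟩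
  have hmem := nilEval_mem ((qPairs A).restrictScalars ℂ) expSeries h
  rw [nilEval_prodMk hZ hz'] at hmem
  obtain ⟨h1, h2⟩ := qEval_eq_of_mem hmem
  refine ⟨h1, h2.trans (funext fun τ => ?_)⟩
  exact map_nilEval (Pi.evalAlgHom ℂ (fun _ : ℍ => A) τ) hz' expSeries

end ThetaValues

/-! ### Hyperbolic functions and Bernoulli numbers -/

section Bernoulli

open PowerSeries

theorem two_mul_X_mul_sinhc : 2 * X * sinhcSeries * expSeries = expSeries ^ 2 - 1 := by
  have h : 2 * X * sinhcSeries = expSeries - evalNegHom expSeries := by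
    ext n
    rw [map_sub, evalNegHom, coeff_rescale, mul_assoc, two_mul, map_add, expSeries, coeff_exp]
    cases n with
    | zero => simp
    | succ n =>
      rw [coeff_succ_X_mul, sinhcSeries, coeff_mk]
      split_ifs with hn
      · rw [Odd.neg_one_pow hn.add_one]
        simp
      · rw [Even.neg_one_pow (Nat.not_even_iff_odd.1 hn).add_one]
        simp
  rw [h, sub_mul, mul_comm (evalNegHom _), expSeries, exp_mul_exp_neg_eq_one, pow_two]

theorem two_mul_cosh : 2 * coshSeries * expSeries = expSeries ^ 2 + 1 := by
  have h : 2 * coshSeries = expSeries + evalNegHom expSeries := by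
    ext n
    rw [map_add, evalNegHom, coeff_rescale, two_mul, map_add, expSeries, coeff_exp, coshSeries,
      coeff_mk]
    split_ifs with hn
    · rw [Even.neg_one_pow hn]
      simp
    · rw [Odd.neg_one_pow (Nat.not_even_iff_odd.1 hn)]
      simp
  rw [h, add_mul, mul_comm (evalNegHom _), expSeries, exp_mul_exp_neg_eq_one, pow_two]

theorem exp_ne_zero : expSeries ≠ 0 := (isUnit_exp ℂ).ne_zero

theorem powerSeries_two_ne_zero : (2 : ℂ⟦X⟧) ≠ 0 := by
  intro h
  have h' := congrArg (constantCoeff (R := ℂ)) h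
  rw [map_ofNat, map_zero] at h'
  exact two_ne_zero h'

theorem cosh_mul_sinhc : coshSeries * sinhcSeries = rescale (2 : ℂ) sinhcSeries := by
  have h2 := congrArg (rescale (2 : ℂ)) two_mul_X_mul_sinhc
  have he : rescale (2 : ℂ) expSeries = expSeries ^ 2 := by
    rw [expSeries, exp_pow_eq_rescale_exp]
    norm_num
  have hX : rescale (2 : ℂ) X = 2 * X := by
    rw [rescale_X]
    rfl
  simp only [map_mul, map_sub, map_pow, map_one, he, hX, map_ofNat] at h2
  refine mul_left_cancel₀ (mul_ne_zero (mul_ne_zero powerSeries_two_ne_zero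
    (mul_ne_zero powerSeries_two_ne_zero X_ne_zero)) (pow_ne_zero 2 exp_ne_zero)) ?_
  linear_combination (2 * coshSeries * expSeries) * two_mul_X_mul_sinhc
    + (expSeries ^ 2 - 1) * two_mul_cosh - h2

/-- The power series `log (sinh (x/2) / (x/2)) = ∑_{k ≥ 2} (B_k / (k · k!)) x^k`. -/
def logSinhc : ℂ⟦X⟧ :=
  PowerSeries.mk fun k => if k < 2 then 0 else (bernoulli k : ℂ) / (k * k.factorial)

theorem constantCoeff_logSinhc : constantCoeff logSinhc = 0 := by
  rw [← coeff_zero_eq_constantCoeff_apply, logSinhc, coeff_mk, if_pos two_pos]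

theorem X_mul_derivative_logSinhc :
    X * d⁄dX ℂ logSinhc = bernoulliPowerSeries ℂ - 1 + C (1 / 2 : ℂ) * X := by
  ext n
  cases n with
  | zero => simp [bernoulliPowerSeries]
  | succ n =>
    rw [coeff_succ_X_mul, coeff_derivative, map_add, map_sub, coeff_C_mul, coeff_X, coeff_one,
      bernoulliPowerSeries, coeff_mk, logSinhc, coeff_mk]
    cases n with
    | zero => norm_num
    | succ n =>
      rw [if_neg (by omega), if_neg (by omega), if_neg (by omega)]
      have h1 : ((n + 1 + 1 : ℕ) : ℂ) ≠ 0 := Nat.cast_ne_zero.2 (by omega)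
      have h2 : ((n + 1 + 1).factorial : ℂ) ≠ 0 := Nat.cast_ne_zero.2 (Nat.factorial_ne_zero _)
      simp only [map_div₀, eq_ratCast, map_natCast]
      push_cast at h1 ⊢
      field_simp
      ring

/-- Both sides solve `F' = F · (log (sinh (x/2) / (x/2)))'`, since
`x (log (sinh (x/2) / (x/2)))' = (x/2) coth (x/2) - 1 = x / (e^x - 1) - 1 + x/2`. -/
theorem rescale_sinhc : rescale (1 / 2 : ℂ) sinhcSeries = expSeries.subst logSinhc := by
  have hs : HasSubst logSinhc := HasSubst.of_constantCoeff_zero' constantCoeff_logSinhc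
  refine eq_of_derivative_eq_mul (Q := d⁄dX ℂ logSinhc) ?_ ?_ ?_
  · set S := rescale (1 / 2 : ℂ) sinhcSeries with hS
    set h := rescale (1 / 2 : ℂ) expSeries with hh
    have hX : rescale (1 / 2 : ℂ) X = C (1 / 2 : ℂ) * X := rescale_X _
    have hC : (2 : ℂ⟦X⟧) * C (1 / 2 : ℂ) = 1 := by
      rw [← map_ofNat C 2, ← map_mul]
      norm_num
    have h1 := congrArg (rescale (1 / 2 : ℂ)) two_mul_X_mul_sinhc
    simp only [map_mul, map_sub, map_pow, map_one, hX, map_ofNat, ← hS, ← hh] at h1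
    have h1' : X * S * h = h ^ 2 - 1 := by linear_combination h1 - X * S * h * hC
    have hdh : d⁄dX ℂ h = C (1 / 2 : ℂ) * h := by
      ext n
      rw [coeff_derivative, coeff_C_mul, hh, coeff_rescale, coeff_rescale, expSeries, coeff_exp,
        coeff_exp, Nat.factorial_succ]
      have h1 : ((n + 1 : ℕ) : ℂ) ≠ 0 := Nat.cast_ne_zero.2 (by omega)
      have h2 : (n.factorial : ℂ) ≠ 0 := Nat.cast_ne_zero.2 (Nat.factorial_ne_zero _)
      simp only [map_div₀, map_one, map_natCast, pow_succ]
      push_cast at h1 ⊢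
      field_simp
    have h2 := congrArg (d⁄dX ℂ) h1'
    simp only [Derivation.leibniz, map_sub, Derivation.leibniz_pow, Derivation.map_one_eq_zero,
      derivative_X, hdh, smul_eq_mul, nsmul_eq_mul] at h2
    have hE : h ^ 2 = PowerSeries.exp ℂ := by
      rw [hh, ← map_pow, expSeries, exp_pow_eq_rescale_exp, rescale_rescale]
      norm_num
    have hb := bernoulliPowerSeries_mul_exp_sub_one ℂ
    rw [← hE, ← h1'] at hb
    have hb' : S * h * bernoulliPowerSeries ℂ = 1 := by
      refine mul_left_cancel₀ (X_ne_zero (R := ℂ)) ?_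
      linear_combination hb
    have hh0 : h ≠ 0 := by
      intro h0
      rw [h0] at hb'
      simp at hb'
    refine mul_left_cancel₀ (mul_ne_zero (X_ne_zero (R := ℂ)) hh0) ?_
    have := X_mul_derivative_logSinhc
    push_cast at h2
    linear_combination h2 - S * h * this - hb' - h1' * (2 * C (1 / 2 : ℂ)) + hC
  · rw [derivative_subst hs, expSeries, derivative_exp]
  · have h0 : constantCoeff ((expSeries - 1).subst logSinhc) = 0 :=
      constantCoeff_subst_eq_zero constantCoeff_logSinhc _ (by simp [expSeries])
    rw [← coe_substAlgHom hs, map_sub, map_one, map_sub, map_one, sub_eq_zero,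
      coe_substAlgHom] at h0
    rw [coeff_zero_eq_constantCoeff_apply, coeff_zero_eq_constantCoeff_apply, h0,
      ← coeff_zero_eq_constantCoeff_apply, coeff_rescale]
    simp [sinhcSeries]

theorem logSeries_subst : logSeries.subst (expSeries - 1) = X := by
  have hs : HasSubst (expSeries - 1) := HasSubst.exp_sub_one
  refine derivative.ext ?_ ?_
  · rw [derivative_subst hs, derivative_X, map_sub, Derivation.map_one_eq_zero, sub_zero,
      expSeries, derivative_exp]
    have h1 : (1 + X) * d⁄dX ℂ logSeries = 1 := by
      ext n
      rw [add_mul, one_mul, map_add, coeff_derivative, coeff_one]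
      cases n with
      | zero => simp [logSeries]
      | succ n =>
        rw [coeff_succ_X_mul, coeff_derivative, logSeries, coeff_mk, coeff_mk, if_neg (by omega),
          if_neg (by omega), if_neg (by omega)]
        have h1 : ((n + 1 + 1 : ℕ) : ℂ) ≠ 0 := Nat.cast_ne_zero.2 (by omega)
        have h2 : ((n + 1 : ℕ) : ℂ) ≠ 0 := Nat.cast_ne_zero.2 (by omega)
        push_cast at h1 h2 ⊢
        field_simp
        ring
    have h2 := congrArg (PowerSeries.subst (expSeries - 1)) h1
    rw [← coe_substAlgHom hs, map_mul, map_add, map_one, coe_substAlgHom, subst_X hs,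
      add_sub_cancel] at h2
    rw [mul_comm]
    exact h2
  · rw [constantCoeff_X]
    exact constantCoeff_subst_eq_zero
      (show constantCoeff (expSeries - 1) = 0 by simp [expSeries]) _
      (by rw [← coeff_zero_eq_constantCoeff_apply]; simp [logSeries])

end Bernoulli

section Genera

open PowerSeries

section Ring

variable {B : Type*} [Ring B] [Algebra ℂ B] {b : B}

theorem commute_nilEval (hb : IsNilpotent b) (f g : ℂ⟦X⟧) : Commute (nilEval f b) (nilEval g b) :=
  (Commute.all f g).map (nilHom hb)

theorem nilEval_log_exp (hb : IsNilpotent b) : nilEval logSeries (nilEval expSeries b - 1) = b := by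
  rw [← nilEval_one hb, ← nilHom_apply hb, ← nilHom_apply hb, ← map_sub, nilHom_apply,
    ← nilEval_subst hb (by simp [expSeries]), logSeries_subst, nilEval_X hb]

theorem nilEval_exp_neg_mul (hb : IsNilpotent b) :
    nilEval expSeries (-b) * nilEval expSeries b = 1 := by
  rw [← nilEval_exp_add (Commute.refl b).neg_left hb.neg hb, neg_add_cancel, nilEval_exp_zero]

theorem isNilpotent_nilEval_logSinhc (hb : IsNilpotent b) (c : ℂ) :
    IsNilpotent (nilEval (rescale c logSinhc) b) :=
  isNilpotent_nilEval hb (by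
    rw [← coeff_zero_eq_constantCoeff_apply, coeff_rescale, coeff_zero_eq_constantCoeff_apply,
      constantCoeff_logSinhc, mul_zero])

theorem nilEval_sinhc (hb : IsNilpotent b) (c : ℂ) :
    nilEval sinhcSeries ((c / 2) • b) = nilEval expSeries (nilEval (rescale c logSinhc) b) := by
  rw [show (c / 2) • b = (1 / 2 : ℂ) • (c • b) by rw [smul_smul]; congr 1; ring,
    nilEval_const_smul _ (hb.smul c), rescale_sinhc,
    nilEval_subst (hb.smul c) constantCoeff_logSinhc, nilEval_const_smul c hb logSinhc]

theorem nilEval_cosh (hb : IsNilpotent b) :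
    nilEval coshSeries ((1 / 2 : ℂ) • b)
      = nilEval expSeries (nilEval (rescale 2 logSinhc - rescale 1 logSinhc) b) := by
  have h1 := nilEval_sinhc hb 1
  have h2 := nilEval_sinhc hb 2
  rw [show (2 / 2 : ℂ) • b = (2 : ℂ) • ((1 / 2 : ℂ) • b) by rw [smul_smul]; congr 1; norm_num,
    nilEval_const_smul 2 (hb.smul _), ← cosh_mul_sinhc, nilEval_mul (hb.smul _), h1] at h2
  have n1 := isNilpotent_nilEval_logSinhc hb 1
  have n2 := isNilpotent_nilEval_logSinhc hb 2
  have hc := commute_nilEval hb (rescale 2 logSinhc) (rescale 1 logSinhc)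
  have e : nilEval (rescale 2 logSinhc - rescale 1 logSinhc) b
      = nilEval (rescale 2 logSinhc) b + -nilEval (rescale 1 logSinhc) b := by
    rw [← nilHom_apply hb, map_sub, nilHom_apply, nilHom_apply, sub_eq_add_neg]
  have hinv : nilEval expSeries (nilEval (rescale 1 logSinhc) b)
      * nilEval expSeries (-nilEval (rescale 1 logSinhc) b) = 1 := by
    have := nilEval_exp_neg_mul n1.neg
    rwa [neg_neg] at this
  rw [e, nilEval_exp_add hc.neg_right n2 n1.neg, ← h2, mul_assoc, hinv, mul_one]

theorem nilEval_eq_exp_neg {f : ℂ⟦X⟧} (hf : constantCoeff f ≠ 0) {c : B} (hb : IsNilpotent b)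
    (hc : IsNilpotent c) (h : nilEval f b = nilEval expSeries c) :
    nilEval f⁻¹ b = nilEval expSeries (-c) := by
  have h1 : nilEval f b * nilEval f⁻¹ b = 1 := by
    rw [← nilEval_mul hb, PowerSeries.mul_inv_cancel _ hf, nilEval_one hb]
  rw [← one_mul (nilEval f⁻¹ b), ← nilEval_exp_neg_mul hc, mul_assoc, ← h, h1, mul_one]

end Ring

variable {A : Type*} [CommRing A] [Algebra ℂ A] {n : ℕ}

theorem sqrtDet_exp {M : Matrix (Fin n) (Fin n) A} (hM : IsNilpotent M) :
    sqrtDet (nilEval expSeries M) = nilEval expSeries ((1 / 2 : ℂ) • M.trace) := by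
  rw [sqrtDet, nilEval_log_exp hM]

theorem trace_nilEval {Y : Matrix (Fin n) (Fin n) A} {N : ℕ} (hY : Y ^ N = 0) {f : ℂ⟦X⟧}
    (hf : constantCoeff f = 0) :
    (nilEval f Y).trace = traceEval Y N fun k => k.factorial * coeff k f := by
  rw [nilEval_eq_sum f hY, Matrix.trace_sum, traceEval]
  cases N with
  | zero => simp
  | succ N =>
    rw [Finset.range_eq_Ico, Finset.sum_eq_sum_Ico_succ_bot (Nat.succ_pos N),
      coeff_zero_eq_constantCoeff_apply, hf, zero_smul, Matrix.trace_zero, zero_add]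
    refine Finset.sum_congr rfl fun k _ => ?_
    rw [Matrix.trace_smul, smul_smul]
    congr 1
    have : (k.factorial : ℂ) ≠ 0 := Nat.cast_ne_zero.2 (Nat.factorial_ne_zero k)
    field_simp

theorem traceEval_add (Y : Matrix (Fin n) (Fin n) A) (N : ℕ) (f g : ℕ → ℂ) :
    traceEval Y N (fun k => f k + g k) = traceEval Y N f + traceEval Y N g := by
  simp only [traceEval, add_smul, Finset.sum_add_distrib]

theorem traceEval_smul (Y : Matrix (Fin n) (Fin n) A) (N : ℕ) (c : ℂ) (f : ℕ → ℂ) :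
    traceEval Y N (fun k => c * f k) = c • traceEval Y N f := by
  simp only [traceEval, mul_smul, Finset.smul_sum]

/-- `B_k / k` for `k ≥ 2`, which is `k!` times the coefficient of `x^k` in
`log (sinh (x/2) / (x/2))`. -/
def bernoulliQuot (k : ℕ) : ℂ := if k < 2 then 0 else (bernoulli k : ℂ) / k

theorem factorial_mul_coeff_logSinhc (c : ℂ) (k : ℕ) :
    k.factorial * coeff k (rescale c logSinhc) = c ^ k * bernoulliQuot k := by
  rw [coeff_rescale, logSinhc, coeff_mk, bernoulliQuot]
  split_ifs with hk
  · simp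
  · have : (k.factorial : ℂ) ≠ 0 := Nat.cast_ne_zero.2 (Nat.factorial_ne_zero k)
    have : (k : ℂ) ≠ 0 := Nat.cast_ne_zero.2 (by omega)
    field_simp

theorem constantCoeff_rescale_logSinhc (c : ℂ) : constantCoeff (rescale c logSinhc) = 0 := by
  rw [← coeff_zero_eq_constantCoeff_apply, coeff_rescale, coeff_zero_eq_constantCoeff_apply,
    constantCoeff_logSinhc, mul_zero]

theorem smul_eq_half_smul_chernMatrix (R : Matrix (Fin n) (Fin n) A) :
    (Complex.I / (4 * Real.pi)) • R = (1 / 2 : ℂ) • chernMatrix R := by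
  rw [chernMatrix, smul_smul]
  congr 1
  ring

theorem aHat_eq {R : Matrix (Fin n) (Fin n) A} {N : ℕ} (hN : chernMatrix R ^ N = 0) :
    aHat R = nilEval expSeries (traceEval (chernMatrix R) N fun k => -(1 / 2) * bernoulliQuot k) := by
  have hb : IsNilpotent (chernMatrix R) := ⟨N, hN⟩
  have h1 := isNilpotent_nilEval_logSinhc hb 1
  rw [aHat, smul_eq_half_smul_chernMatrix,
    nilEval_eq_exp_neg (by simp [← coeff_zero_eq_constantCoeff_apply, sinhcSeries])
      (hb.smul (1 / 2 : ℂ)) h1 (nilEval_sinhc hb 1),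
    sqrtDet_exp h1.neg, Matrix.trace_neg, trace_nilEval hN (constantCoeff_rescale_logSinhc 1),
    smul_neg, ← neg_smul, ← traceEval_smul]
  simp only [factorial_mul_coeff_logSinhc, one_pow, one_mul]

theorem factorial_mul_coeff_cosh (k : ℕ) :
    k.factorial * coeff k (rescale 2 logSinhc - rescale 1 logSinhc)
      = (2 ^ k - 1) * bernoulliQuot k := by
  rw [map_sub, mul_sub, factorial_mul_coeff_logSinhc, factorial_mul_coeff_logSinhc, one_pow,
    one_mul, sub_mul, one_mul]

theorem sqrtDetTwoCosh_eq {R : Matrix (Fin n) (Fin n) A} {N : ℕ}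
    (hN : chernMatrix R ^ N = 0) (l : ℕ) :
    sqrtDetTwoCosh l R = (2 ^ l : ℂ) • nilEval expSeries
      (traceEval (chernMatrix R) N fun k => (1 / 2) * ((2 ^ k - 1) * bernoulliQuot k)) := by
  have hb : IsNilpotent (chernMatrix R) := ⟨N, hN⟩
  have h0 : constantCoeff (rescale (2 : ℂ) logSinhc - rescale 1 logSinhc) = 0 := by
    rw [map_sub, constantCoeff_rescale_logSinhc, constantCoeff_rescale_logSinhc, sub_zero]
  rw [sqrtDetTwoCosh, smul_eq_half_smul_chernMatrix, nilEval_cosh hb,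
    sqrtDet_exp (isNilpotent_nilEval hb h0), trace_nilEval hN h0, ← traceEval_smul]
  simp only [factorial_mul_coeff_cosh]

theorem bernoulliQuot_odd {k : ℕ} (hk : Odd k) : bernoulliQuot k = 0 := by
  rw [bernoulliQuot]
  split_ifs with h
  · rfl
  · rw [bernoulli_eq_zero_of_odd hk (by omega)]
    simp

/-- The curvature of an oriented plane bundle with Euler form `c`, in an oriented orthonormal frame,
satisfies `tr ((√-1/2π) R)^k = 2 c^k` for even `k`. -/
theorem trace_chernMatrix_pow {R : Matrix (Fin 2) (Fin 2) A} (hR : R.transpose = -R) (j : ℕ) :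
    (chernMatrix R ^ (2 * j)).trace
      = (2 : ℂ) • ((1 / (2 * (Real.pi : ℂ))) • R 0 1) ^ (2 * j) := by
  set c := (1 / (2 * (Real.pi : ℂ))) • R 0 1
  have h2 {a : A} (h : a = -a) : a = 0 := by
    have h' : (2 : ℂ) • a = 0 := by
      rw [two_smul]
      nth_rewrite 1 [h]
      exact neg_add_cancel a
    calc a = (1 / 2 : ℂ) • ((2 : ℂ) • a) := by rw [smul_smul]; norm_num
      _ = 0 := by rw [h', smul_zero]
  have h00 : R 0 0 = 0 := h2 (congrFun (congrFun hR 0) 0)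
  have h11 : R 1 1 = 0 := h2 (congrFun (congrFun hR 1) 1)
  have h10 : R 1 0 = -R 0 1 := congrFun (congrFun hR 0) 1
  have hsq : chernMatrix R ^ 2 = (c ^ 2) • (1 : Matrix (Fin 2) (Fin 2) A) := by
    have hY : chernMatrix R = Complex.I • ((1 / (2 * (Real.pi : ℂ))) • R) := by
      rw [chernMatrix, smul_smul]
      congr 1
      ring
    rw [hY, smul_pow, Complex.I_sq]
    ext i j
    fin_cases i <;> fin_cases j <;>
      simp [pow_two, Matrix.mul_apply, Fin.sum_univ_two, h00, h11, h10, c]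
  rw [pow_mul, hsq, smul_pow, one_pow, Matrix.trace_smul, Matrix.trace_one, Fintype.card_fin,
    pow_mul, smul_eq_mul, mul_comm, two_smul]
  push_cast
  ring

theorem traceEval_euler {R : Matrix (Fin 2) (Fin 2) A} (hR : R.transpose = -R) {N : ℕ} {f : ℂ⟦X⟧}
    (hf : constantCoeff f = 0) (hodd : ∀ k, Odd k → coeff k f = 0)
    (hN : ((1 / (2 * (Real.pi : ℂ))) • R 0 1) ^ N = 0) :
    traceEval (chernMatrix R) N (fun k => k.factorial * coeff k f)
      = (2 : ℂ) • nilEval f ((1 / (2 * (Real.pi : ℂ))) • R 0 1) := by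
  rw [nilEval_eq_sum f hN, traceEval]
  cases N with
  | zero =>
    rw [pow_zero] at hN
    exact (subsingleton_of_zero_eq_one hN.symm).elim _ _
  | succ N =>
    rw [Finset.range_eq_Ico, Finset.sum_eq_sum_Ico_succ_bot (Nat.succ_pos N),
      coeff_zero_eq_constantCoeff_apply, hf, zero_smul, zero_add, Finset.smul_sum]
    refine Finset.sum_congr rfl fun k _ => ?_
    have : (k.factorial : ℂ) ≠ 0 := Nat.cast_ne_zero.2 (Nat.factorial_ne_zero k)
    rcases Nat.even_or_odd' k with ⟨j, rfl | rfl⟩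
    · rw [trace_chernMatrix_pow hR, smul_smul, smul_comm (2 : ℂ)]
      congr 1
      field_simp
    · rw [hodd _ ⟨j, rfl⟩, mul_zero, zero_smul, zero_smul, smul_zero]

theorem nilEval_cosh_euler {R : Matrix (Fin 2) (Fin 2) A} (hR : R.transpose = -R) {N : ℕ}
    (hN : ((1 / (2 * (Real.pi : ℂ))) • R 0 1) ^ N = 0) :
    nilEval coshSeries ((1 / 2 : ℂ) • ((1 / (2 * (Real.pi : ℂ))) • R 0 1))
        = nilEval expSeries
          (traceEval (chernMatrix R) N fun k => (1 / 2) * ((2 ^ k - 1) * bernoulliQuot k)) ∧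
      nilEval (coshSeries ^ 2)⁻¹ ((1 / 2 : ℂ) • ((1 / (2 * (Real.pi : ℂ))) • R 0 1))
        = nilEval expSeries
          (traceEval (chernMatrix R) N fun k => (-1) * ((2 ^ k - 1) * bernoulliQuot k)) := by
  have h0 : constantCoeff (rescale (2 : ℂ) logSinhc - rescale 1 logSinhc) = 0 := by
    rw [map_sub, constantCoeff_rescale_logSinhc, constantCoeff_rescale_logSinhc, sub_zero]
  have he := traceEval_euler hR h0 (fun k hk => by
    have h := factorial_mul_coeff_cosh k
    rw [bernoulliQuot_odd hk, mul_zero] at h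
    exact (mul_eq_zero.1 h).resolve_left (Nat.cast_ne_zero.2 (Nat.factorial_ne_zero k))) hN
  simp only [factorial_mul_coeff_cosh] at he
  generalize (1 / (2 * (Real.pi : ℂ))) • R 0 1 = c at he hN ⊢
  have hb : IsNilpotent c := ⟨N, hN⟩
  have hn := isNilpotent_nilEval hb h0
  have hc := nilEval_cosh hb
  have hc2 : nilEval (coshSeries ^ 2) ((1 / 2 : ℂ) • c) = nilEval expSeries
      ((2 : ℂ) • nilEval (rescale 2 logSinhc - rescale 1 logSinhc) c) := by
    rw [pow_two, nilEval_mul (hb.smul _), hc, ← nilEval_exp_add (Commute.all _ _) hn hn, two_smul]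
  rw [traceEval_smul, traceEval_smul, he, smul_smul (1 / 2 : ℂ) 2]
  constructor
  · rw [hc]
    norm_num
  · rw [nilEval_eq_exp_neg
      (by rw [map_pow, ← coeff_zero_eq_constantCoeff_apply]; simp [coshSeries])
      (hb.smul _) (hn.smul _) hc2, neg_smul, one_smul]

theorem pontryaginOne_eq (R : Matrix (Fin n) (Fin n) A) {N : ℕ} (hN : 3 ≤ N) (s : ℂ) :
    s • pontryaginOne R = traceEval (chernMatrix R) N fun k => if k = 2 then s else 0 := by
  rw [traceEval, Finset.sum_eq_single_of_mem 2 (Finset.mem_Ico.2 ⟨by omega, by omega⟩)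
    fun k _ hk => by rw [if_neg hk, zero_smul], if_pos rfl, pontryaginOne, chernMatrix, smul_pow,
    Matrix.trace_smul, pow_two R, smul_smul (1 / _ : ℂ)]
  congr 2
  rw [div_pow, Complex.I_sq]
  simp
  ring

end Genera

/-! ### The characteristic forms as exponentials of power sums -/

section Totals

open PowerSeries

variable {A : Type*} [CommRing A] [Algebra ℂ A] {dT dW : ℕ}

/-- The coefficients of the power sums of the curvature of `TX` in the logarithm of
`e^{E₂p/24} Â(TX) ⋯ ch(Θ_i)`. -/
def coefT (τ : ℍ) (k : ℕ) : ℂ :=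
  (if k = 2 then EisensteinSeries.E2 τ / 24 else 0) + -(1 / 2) * bernoulliQuot k + symVal τ k

/-- The coefficients of the power sums of the curvature of `W` for `Θ₁`. -/
def coefW₁ (τ : ℍ) (k : ℕ) : ℂ :=
  -1 * (if k = 2 then EisensteinSeries.E2 τ / 24 else 0)
    + 1 / 2 * ((2 ^ k - 1) * bernoulliQuot k) + lamVal₁ τ k

/-- The coefficients of the power sums of the curvature of `ξ` for `Θ₁`. -/
def coefξ₁ (τ : ℍ) (k : ℕ) : ℂ :=
  -1 * ((2 ^ k - 1) * bernoulliQuot k) + -2 * lamVal₁ τ k + lamVal₃ τ k + lamVal₂ τ k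

/-- The coefficients of the power sums of the curvature of `W` for `Θ₂`. -/
def coefW₂ (τ : ℍ) (k : ℕ) : ℂ :=
  -1 * (if k = 2 then EisensteinSeries.E2 τ / 24 else 0) + lamVal₂ τ k

/-- The coefficients of the power sums of the curvature of `ξ` for `Θ₂`. -/
def coefξ₂ (τ : ℍ) (k : ℕ) : ℂ :=
  1 / 2 * ((2 ^ k - 1) * bernoulliQuot k) + -2 * lamVal₂ τ k + lamVal₃ τ k + lamVal₁ τ k

section Coefficients

variable {n : ℕ} (Y : Matrix (Fin n) (Fin n) A) (N : ℕ) (τ : ℍ)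

theorem traceEval_coefT : traceEval Y N (coefT τ) =
    traceEval Y N (fun k => if k = 2 then EisensteinSeries.E2 τ / 24 else 0)
      + traceEval Y N (fun k => -(1 / 2) * bernoulliQuot k) + traceEval Y N (symVal τ) := by
  rw [← traceEval_add, ← traceEval_add]
  rfl

theorem traceEval_coefW₁ : traceEval Y N (coefW₁ τ) =
    traceEval Y N (fun k => -1 * if k = 2 then EisensteinSeries.E2 τ / 24 else 0)
      + traceEval Y N (fun k => 1 / 2 * ((2 ^ k - 1) * bernoulliQuot k))
      + traceEval Y N (lamVal₁ τ) := by
  rw [← traceEval_add, ← traceEval_add]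
  rfl

theorem traceEval_coefW₂ : traceEval Y N (coefW₂ τ) =
    traceEval Y N (fun k => -1 * if k = 2 then EisensteinSeries.E2 τ / 24 else 0)
      + traceEval Y N (lamVal₂ τ) := by
  rw [← traceEval_add]
  rfl

theorem traceEval_neg_two_mul (f : ℕ → ℂ) :
    traceEval Y N (fun k => -2 * f k) = -(2 • traceEval Y N f) := by
  rw [traceEval_smul, neg_smul, two_smul, two_nsmul]

theorem traceEval_coefξ₁ : traceEval Y N (coefξ₁ τ) =
    traceEval Y N (fun k => -1 * ((2 ^ k - 1) * bernoulliQuot k)) - 2 • traceEval Y N (lamVal₁ τ)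
      + traceEval Y N (lamVal₃ τ) + traceEval Y N (lamVal₂ τ) := by
  rw [sub_eq_add_neg, ← traceEval_neg_two_mul, ← traceEval_add, ← traceEval_add, ← traceEval_add]
  rfl

theorem traceEval_coefξ₂ : traceEval Y N (coefξ₂ τ) =
    traceEval Y N (fun k => 1 / 2 * ((2 ^ k - 1) * bernoulliQuot k)) - 2 • traceEval Y N (lamVal₂ τ)
      + traceEval Y N (lamVal₃ τ) + traceEval Y N (lamVal₁ τ) := by
  rw [sub_eq_add_neg, ← traceEval_neg_two_mul, ← traceEval_add, ← traceEval_add, ← traceEval_add]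
  rfl

end Coefficients

/-- The power sums of the curvatures of `TX`, `W` and `ξ`, with coefficients. -/
def totalEval (RT : Matrix (Fin dT) (Fin dT) A) (RW : Matrix (Fin dW) (Fin dW) A)
    (Rξ : Matrix (Fin 2) (Fin 2) A) (N : ℕ) (f g h : ℕ → ℂ) : A :=
  traceEval (chernMatrix RT) N f + traceEval (chernMatrix RW) N g + traceEval (chernMatrix Rξ) N h

variable {RT : Matrix (Fin dT) (Fin dT) A} {RW : Matrix (Fin dW) (Fin dW) A}
  {Rξ : Matrix (Fin 2) (Fin 2) A} {N : ℕ}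

theorem qEval_chTheta [Module.Finite ℂ A] (hT : ∀ i j, IsNilpotent (RT i j))
    (hW : ∀ i j, IsNilpotent (RW i j)) (hξ : ∀ i j, IsNilpotent (Rξ i j))
    (hNT : chernMatrix RT ^ N = 0) (hNW : chernMatrix RW ^ N = 0) (hNξ : chernMatrix Rξ ^ N = 0) :
    (QConverges (chTheta₁ RT RW Rξ) ∧
      qEval (chTheta₁ RT RW Rξ) = fun τ => nilEval expSeries (thetaVal₁ RT RW Rξ N τ)) ∧
    (QConverges (chTheta₂ RT RW Rξ) ∧
      qEval (chTheta₂ RT RW Rξ) = fun τ => nilEval expSeries (thetaVal₂ RT RW Rξ N τ)) := by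
  have : IsNoetherianRing A := isNoetherian_of_tower ℂ inferInstance
  obtain ⟨M, hM⟩ := IsNoetherianRing.isNilpotent_nilradical A
  have hM' {z : A} (hz : IsNilpotent z) : z ^ M = 0 := by
    have := Ideal.pow_mem_pow (mem_nilradical.2 hz) M
    rwa [hM] at this
  obtain ⟨e1, e2⟩ := chTheta_eq RT RW Rξ hT hW hξ hNT hNW hNξ
  rw [e1, e2]
  exact ⟨qEval_exp (thetaExp_mem_qPairs N).1 (isNilpotent_thetaExp hT hW hξ N).1
      ⟨M, fun τ => hM' (isNilpotent_thetaVal hT hW hξ N τ).1⟩,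
    qEval_exp (thetaExp_mem_qPairs N).2 (isNilpotent_thetaExp hT hW hξ N).2
      ⟨M, fun τ => hM' (isNilpotent_thetaVal hT hW hξ N τ).2⟩⟩

theorem exp_mul_expand_eq_total₁ [Module.Finite ℂ A] (hT : ∀ i j, IsNilpotent (RT i j))
    (hW : ∀ i j, IsNilpotent (RW i j)) (hξ : ∀ i j, IsNilpotent (Rξ i j))
    (hNT : chernMatrix RT ^ N = 0) (hNW : chernMatrix RW ^ N = 0) (hNξ : chernMatrix Rξ ^ N = 0)
    (hskew : Rξ.transpose = -Rξ) (hNc : ((1 / (2 * (Real.pi : ℂ))) • Rξ 0 1) ^ N = 0) (hN : 3 ≤ N)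
    (l : ℕ) (τ : ℍ) :
    nilEval expSeries ((EisensteinSeries.E2 τ / 24) • (pontryaginOne RT - pontryaginOne RW)) *
      (aHat RT * sqrtDetTwoCosh l RW *
        nilEval (coshSeries ^ 2)⁻¹ ((1 / 2 : ℂ) • ((1 / (2 * (Real.pi : ℂ))) • Rξ 0 1))) *
      qEval (chTheta₁ RT RW Rξ) τ
    = (2 ^ l : ℂ) • nilEval expSeries (totalEval RT RW Rξ N (coefT τ) (coefW₁ τ) (coefξ₁ τ)) := by
  have nT := fun g => isNilpotent_traceEval (isNilpotent_chernMatrix hT) N g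
  have nW := fun g => isNilpotent_traceEval (isNilpotent_chernMatrix hW) N g
  have nξ := fun g => isNilpotent_traceEval (isNilpotent_chernMatrix hξ) N g
  have nΘ := (isNilpotent_thetaVal hT hW hξ N τ).1
  have add {Z Z' : A} (h : IsNilpotent Z) (h' : IsNilpotent Z') : IsNilpotent (Z + Z') :=
    (Commute.all _ _).isNilpotent_add h h'
  have mul {Z Z' : A} (h : IsNilpotent Z) (h' : IsNilpotent Z') :
      nilEval expSeries Z * nilEval expSeries Z' = nilEval expSeries (Z + Z') :=
    (nilEval_exp_add (Commute.all _ _) h h').symm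
  rw [(qEval_chTheta hT hW hξ hNT hNW hNξ).1.2, aHat_eq hNT, sqrtDetTwoCosh_eq hNW,
    (nilEval_cosh_euler hskew hNc).2, smul_sub, pontryaginOne_eq RT hN, pontryaginOne_eq RW hN,
    sub_eq_add_neg, ← neg_one_smul ℂ (traceEval (chernMatrix RW) N _), ← traceEval_smul,
    mul_smul_comm, smul_mul_assoc, mul_smul_comm, smul_mul_assoc]
  congr 1
  rw [mul (nT _) (nW _), mul (add (nT _) (nW _)) (nξ _),
    mul (add (nT _) (nW _)) (add (add (nT _) (nW _)) (nξ _)),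
    mul (add (add (nT _) (nW _)) (add (add (nT _) (nW _)) (nξ _))) nΘ]
  congr 1
  simp only [totalEval, traceEval_coefT, traceEval_coefW₁, traceEval_coefξ₁, thetaVal₁]
  abel

theorem exp_mul_expand_eq_total₂ [Module.Finite ℂ A] (hT : ∀ i j, IsNilpotent (RT i j))
    (hW : ∀ i j, IsNilpotent (RW i j)) (hξ : ∀ i j, IsNilpotent (Rξ i j))
    (hNT : chernMatrix RT ^ N = 0) (hNW : chernMatrix RW ^ N = 0) (hNξ : chernMatrix Rξ ^ N = 0)
    (hskew : Rξ.transpose = -Rξ) (hNc : ((1 / (2 * (Real.pi : ℂ))) • Rξ 0 1) ^ N = 0) (hN : 3 ≤ N)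
    (τ : ℍ) :
    nilEval expSeries ((EisensteinSeries.E2 τ / 24) • (pontryaginOne RT - pontryaginOne RW)) *
      (aHat RT * nilEval coshSeries ((1 / 2 : ℂ) • ((1 / (2 * (Real.pi : ℂ))) • Rξ 0 1))) *
      qEval (chTheta₂ RT RW Rξ) τ
    = nilEval expSeries (totalEval RT RW Rξ N (coefT τ) (coefW₂ τ) (coefξ₂ τ)) := by
  have nT := fun g => isNilpotent_traceEval (isNilpotent_chernMatrix hT) N g
  have nW := fun g => isNilpotent_traceEval (isNilpotent_chernMatrix hW) N g
  have nξ := fun g => isNilpotent_traceEval (isNilpotent_chernMatrix hξ) N g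
  have nΘ := (isNilpotent_thetaVal hT hW hξ N τ).2
  have add {Z Z' : A} (h : IsNilpotent Z) (h' : IsNilpotent Z') : IsNilpotent (Z + Z') :=
    (Commute.all _ _).isNilpotent_add h h'
  have mul {Z Z' : A} (h : IsNilpotent Z) (h' : IsNilpotent Z') :
      nilEval expSeries Z * nilEval expSeries Z' = nilEval expSeries (Z + Z') :=
    (nilEval_exp_add (Commute.all _ _) h h').symm
  rw [(qEval_chTheta hT hW hξ hNT hNW hNξ).2.2, aHat_eq hNT,
    (nilEval_cosh_euler hskew hNc).1, smul_sub, pontryaginOne_eq RT hN, pontryaginOne_eq RW hN,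
    sub_eq_add_neg, ← neg_one_smul ℂ (traceEval (chernMatrix RW) N _), ← traceEval_smul]
  rw [mul (nT _) (nξ _), mul (add (nT _) (nW _)) (add (nT _) (nξ _)),
    mul (add (add (nT _) (nW _)) (add (nT _) (nξ _))) nΘ]
  congr 1
  simp only [totalEval, traceEval_coefT, traceEval_coefW₂, traceEval_coefξ₂, thetaVal₂]
  abel

/-- `1 + p (e^{sp} - 1)/p = e^{sp}`. -/
theorem one_add_mul_nilEval_expQuot {p : A} (hp : IsNilpotent p) (s : ℂ) :
    1 + p * nilEval (expQuotSeries s) p = nilEval expSeries (s • p) := by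
  rw [nilEval_const_smul s hp]
  have h : rescale s expSeries = 1 + X * expQuotSeries s := by
    ext n
    rw [map_add, coeff_rescale, coeff_one, expSeries, coeff_exp]
    cases n with
    | zero => simp
    | succ n =>
      rw [coeff_succ_X_mul, expQuotSeries, coeff_mk]
      simp [div_eq_mul_inv]
  rw [h, ← nilHom_apply hp (1 + _), map_add, map_mul, map_one, nilHom_apply, nilHom_apply, nilEval_X hp]

end Totals

/-! ### Modular forms over `Γ₀(2)` and their transforms under `τ ↦ -1/τ` -/

section Modular

open UpperHalfPlane ModularGroup CongruenceSubgroup EisensteinSeries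
open Matrix.SpecialLinearGroup (mapGL)
open scoped ModularForm

/-- `f` is a modular form of weight `k` over `Γ₀(2)` and `g = f|S` is its transform under
`S : τ ↦ -1/τ`. The cusps of `Γ₀(2)` are those of `∞` and `S∞`, so it is enough to require
boundedness of `f` and `g` at `∞`. -/
structure IsModularPair (k : ℤ) (f g : ℍ → ℂ) : Prop where
  mdiff : MDiff f
  slash_eq : ∀ γ ∈ Gamma0 2, f ∣[k] γ = f
  slash_S : f ∣[k] S = g
  bounded : IsBoundedAtImInfty f
  bounded' : IsBoundedAtImInfty g

namespace IsModularPair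

variable {k k' : ℤ} {f g f' g' : ℍ → ℂ}

theorem add (h : IsModularPair k f g) (h' : IsModularPair k f' g') :
    IsModularPair k (f + f') (g + g') where
  mdiff := h.mdiff.add h'.mdiff
  slash_eq γ hγ := by rw [SlashAction.add_slash, h.slash_eq γ hγ, h'.slash_eq γ hγ]
  slash_S := by rw [SlashAction.add_slash, h.slash_S, h'.slash_S]
  bounded := h.bounded.add h'.bounded
  bounded' := h.bounded'.add h'.bounded'

theorem smul (h : IsModularPair k f g) (c : ℂ) : IsModularPair k (c • f) (c • g) where
  mdiff := h.mdiff.const_smul c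
  slash_eq γ hγ := by rw [ModularForm.SL_smul_slash, h.slash_eq γ hγ]
  slash_S := by rw [ModularForm.SL_smul_slash, h.slash_S]
  bounded := h.bounded.const_smul_left c
  bounded' := h.bounded'.const_smul_left c

theorem zero (k : ℤ) : IsModularPair k 0 0 where
  mdiff := mdifferentiable_const
  slash_eq γ _ := SlashAction.zero_slash k γ
  slash_S := SlashAction.zero_slash k S
  bounded := zero_form_isBoundedAtImInfty
  bounded' := zero_form_isBoundedAtImInfty

theorem mul (h : IsModularPair k f g) (h' : IsModularPair k' f' g') :
    IsModularPair (k + k') (f * f') (g * g') where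
  mdiff := h.mdiff.mul h'.mdiff
  slash_eq γ hγ := by rw [ModularForm.mul_slash_SL2, h.slash_eq γ hγ, h'.slash_eq γ hγ]
  slash_S := by rw [ModularForm.mul_slash_SL2, h.slash_S, h'.slash_S]
  bounded := h.bounded.mul h'.bounded
  bounded' := h.bounded'.mul h'.bounded'

theorem one : IsModularPair 0 1 1 where
  mdiff := mdifferentiable_const
  slash_eq γ _ := ModularForm.is_invariant_one γ
  slash_S := ModularForm.is_invariant_one S
  bounded := Filter.const_boundedAtFilter _ _
  bounded' := Filter.const_boundedAtFilter _ _

/-- `SL₂(ℤ)` is the union of `Γ₀(2)` and of the cosets `Γ₀(2) S T^j`. -/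
theorem isBoundedAtImInfty_slash (h : IsModularPair k f g) (δ : SL(2, ℤ)) :
    IsBoundedAtImInfty (f ∣[k] δ) := by
  rcases Int.even_or_odd (δ 1 0) with hc | hc
  · rw [h.slash_eq δ (Gamma0_mem.2 ((ZMod.intCast_zmod_eq_zero_iff_dvd _ 2).2 hc.two_dvd))]
    exact h.bounded
  · have hmem : δ * (S * T ^ (δ 1 1))⁻¹ ∈ Gamma0 2 := by
      rw [Gamma0_mem]
      refine (ZMod.intCast_zmod_eq_zero_iff_dvd _ 2).2 ?_
      obtain ⟨c, hc⟩ := hc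
      have e : (δ * (S * T ^ (δ 1 1))⁻¹) 1 0 = δ 1 1 * (δ 1 0 - 1) := by
        rw [Matrix.SpecialLinearGroup.coe_mul, Matrix.SpecialLinearGroup.coe_inv,
          Matrix.SpecialLinearGroup.coe_mul, coe_S, coe_T_zpow, Matrix.adjugate_fin_two]
        simp [Matrix.mul_apply, Fin.sum_univ_two]
        ring
      rw [e, hc]
      exact ⟨δ 1 1 * c, by push_cast; ring⟩
    have e : δ = δ * (S * T ^ (δ 1 1))⁻¹ * (S * T ^ (δ 1 1)) := by group
    rw [e, SlashAction.slash_mul, h.slash_eq _ hmem, SlashAction.slash_mul, h.slash_S]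
    exact h.bounded'.slash k (g := mapGL ℝ (T ^ (δ 1 1))) (by
      rw [Matrix.SpecialLinearGroup.mapGL_coe_matrix, Matrix.SpecialLinearGroup.map_apply_coe,
        coe_T_zpow]
      simp)

theorem exists_modularForm (h : IsModularPair k f g) :
    ∃ F : ModularForm ((Gamma0 2).map (mapGL ℝ)) k, ∀ τ, F τ = f τ :=
  ⟨{ toFun := f
     slash_action_eq' := by
       rintro _ ⟨γ, hγ, rfl⟩
       exact h.slash_eq γ hγ
     holo' := h.mdiff
     bdd_at_cusps' := fun {c} hc => by
       rw [OnePoint.isBoundedAt_iff_forall_SL2Z (hc.mono (Subgroup.map_le_range _ _))]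
       exact fun γ _ => h.isBoundedAtImInfty_slash γ }, fun _ => rfl⟩

theorem exists_modularForm' (h : IsModularPair k f g) :
    ∃ F : ModularForm (GammaUpper0.map (mapGL ℝ)) k, ∀ τ, F τ = g τ :=
  ⟨{ toFun := g
     slash_action_eq' := by
       rintro _ ⟨γ, hγ, rfl⟩
       have hmem : S * γ * S⁻¹ ∈ Gamma0 2 := by
         have hγ' : ((γ 0 1 : ℤ) : ZMod 2) = 0 := hγ
         rw [Gamma0_mem]
         rw [Matrix.SpecialLinearGroup.coe_mul, Matrix.SpecialLinearGroup.coe_inv,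
          Matrix.SpecialLinearGroup.coe_mul, coe_S, Matrix.adjugate_fin_two]
         simp [Matrix.mul_apply, Matrix.vecMul, dotProduct, Fin.sum_univ_two, hγ']
       change g ∣[k] γ = g
       rw [← h.slash_S, ← SlashAction.slash_mul, show S * γ = S * γ * S⁻¹ * S by group,
         SlashAction.slash_mul, h.slash_eq _ hmem]
     holo' := by
       change MDiff g
       rw [← h.slash_S]
       exact h.mdiff.slash k _
     bdd_at_cusps' := fun {c} hc => by
       rw [OnePoint.isBoundedAt_iff_forall_SL2Z (hc.mono (Subgroup.map_le_range _ _))]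
       intro γ _
       rw [← h.slash_S, ← SlashAction.slash_mul]
       exact h.isBoundedAtImInfty_slash _ }, fun _ => rfl⟩

theorem apply_S_smul (h : IsModularPair k f g) (τ : ℍ) : f (S • τ) = (τ : ℂ) ^ k * g τ := by
  have := ModularForm.SL_slash_apply (f := f) (k := k) S τ
  rw [h.slash_S, denom_S] at this
  rw [this, zpow_neg, mul_comm, mul_assoc, inv_mul_cancel₀ (zpow_ne_zero _ τ.ne_zero), mul_one]

end IsModularPair

/-- The matrix `diag(2, 1)`. -/
def diagTwoOne : GL (Fin 2) ℝ := .mkOfDetNeZero !![2, 0; 0, 1] (by simp)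

/-- The matrix `diag(1, 2)`. -/
def diagOneTwo : GL (Fin 2) ℝ := .mkOfDetNeZero !![1, 0; 0, 2] (by simp)

/-- The point `2τ`. -/
def double (τ : ℍ) : ℍ := ⟨2 * τ, by simpa using τ.im_pos⟩

/-- The point `τ/2`. -/
def half (τ : ℍ) : ℍ := ⟨τ / 2, by simpa using τ.im_pos⟩

theorem slash_diagTwoOne (h : ℍ → ℂ) (k : ℤ) (τ : ℍ) :
    (h ∣[k] diagTwoOne) τ = 2 ^ (k - 1) * h (double τ) := by
  have hdet : diagTwoOne.det.val = 2 := by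
    simp [diagTwoOne, Matrix.GeneralLinearGroup.mkOfDetNeZero]
  have hpos : 0 < diagTwoOne.det.val := by rw [hdet]; exact two_pos
  have hsmul : diagTwoOne • τ = double τ := by
    ext
    rw [coe_smul_of_det_pos hpos]
    simp [num, denom, diagTwoOne, Matrix.GeneralLinearGroup.mkOfDetNeZero, double]
  have hdenom : denom diagTwoOne τ = 1 := by
    simp [denom, diagTwoOne, Matrix.GeneralLinearGroup.mkOfDetNeZero]
  rw [ModularForm.slash_apply, hsmul, hdenom, hdet, σ, if_pos hpos]
  simp [mul_comm]

theorem slash_diagOneTwo (h : ℍ → ℂ) (k : ℤ) (τ : ℍ) :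
    (h ∣[k] diagOneTwo) τ = 1 / 2 * h (half τ) := by
  have hdet : diagOneTwo.det.val = 2 := by
    simp [diagOneTwo, Matrix.GeneralLinearGroup.mkOfDetNeZero]
  have hpos : 0 < diagOneTwo.det.val := by rw [hdet]; exact two_pos
  have hsmul : diagOneTwo • τ = half τ := by
    ext
    rw [coe_smul_of_det_pos hpos]
    simp [num, denom, diagOneTwo, Matrix.GeneralLinearGroup.mkOfDetNeZero, half]
  have hdenom : denom diagOneTwo τ = 2 := by
    simp [denom, diagOneTwo, Matrix.GeneralLinearGroup.mkOfDetNeZero]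
  rw [ModularForm.slash_apply, hsmul, hdenom, hdet, σ, if_pos hpos]
  have h2 : (2 : ℂ) ^ (k - 1) * 2 ^ (-k) = 1 / 2 := by
    rw [← zpow_add₀ two_ne_zero, show k - 1 + -k = -1 by ring]
    norm_num
  simp only [abs_two, Complex.ofReal_ofNat, mul_assoc, h2, ContinuousAlgEquiv.refl_apply]
  ring

theorem diagTwoOne_mul_S : diagTwoOne * mapGL ℝ S = mapGL ℝ S * diagOneTwo := by
  ext i j
  fin_cases i <;> fin_cases j <;>
    simp [diagTwoOne, diagOneTwo, Matrix.GeneralLinearGroup.mkOfDetNeZero, Matrix.mul_apply,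
      Fin.sum_univ_two, Matrix.SpecialLinearGroup.mapGL_coe_matrix, coe_S]

/-- `diag(2, 1) γ diag(2, 1)⁻¹` is integral for `γ ∈ Γ₀(2)`. -/
theorem exists_diagTwoOne_mul {γ : SL(2, ℤ)} (hγ : γ ∈ Gamma0 2) :
    ∃ γ' : SL(2, ℤ), diagTwoOne * mapGL ℝ γ = mapGL ℝ γ' * diagTwoOne ∧ 2 * γ' 1 0 = γ 1 0 ∧
      γ' 1 1 = γ 1 1 := by
  obtain ⟨c, hc⟩ := (ZMod.intCast_zmod_eq_zero_iff_dvd _ 2).1 (Gamma0_mem.1 hγ)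
  have hdet := γ.det_coe
  rw [Matrix.det_fin_two] at hdet
  obtain ⟨γ', h00, h01, h10, h11⟩ : ∃ γ' : SL(2, ℤ), γ' 0 0 = γ 0 0 ∧ γ' 0 1 = 2 * γ 0 1 ∧
      γ' 1 0 = c ∧ γ' 1 1 = γ 1 1 := by
    refine ⟨⟨!![γ 0 0, 2 * γ 0 1; c, γ 1 1], ?_⟩, rfl, rfl, rfl, rfl⟩
    rw [Matrix.det_fin_two_of]
    push_cast at hc
    linear_combination hdet + γ 0 1 * hc
  refine ⟨γ', ?_, by rw [h10, hc]; rfl, h11⟩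
  have hc' : ((γ 1 0 : ℤ) : ℝ) = 2 * c := by rw [hc]; push_cast; ring
  ext i j
  fin_cases i <;> fin_cases j <;>
    simp [diagTwoOne, Matrix.GeneralLinearGroup.mkOfDetNeZero, Matrix.mul_apply,
      Fin.sum_univ_two, Matrix.SpecialLinearGroup.mapGL_coe_matrix, h00, h01, h10, h11, hc',
      mul_comm]

/-- A level one form `h` and its multiples `h(2τ)`, `h(τ/2)` (up to constants) give modular forms over
`Γ₀(2)`, the last two being exchanged by `S`. -/
theorem isModularPair_double {k : ℤ} {h : ℍ → ℂ} (hd : MDiff h) (hb : IsBoundedAtImInfty h)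
    (hs : ∀ γ : SL(2, ℤ), h ∣[k] γ = h) :
    IsModularPair k h h ∧ IsModularPair k (h ∣[k] diagTwoOne) (h ∣[k] diagOneTwo) := by
  have hs' (γ : SL(2, ℤ)) : h ∣[k] mapGL ℝ γ = h := hs γ
  refine ⟨⟨hd, fun γ _ => hs γ, hs S, hb, hb⟩, hd.slash k _, fun γ hγ => ?_, ?_, hb.slash k ?_,
    hb.slash k ?_⟩
  · obtain ⟨γ', hγ', -⟩ := exists_diagTwoOne_mul hγ
    rw [ModularForm.SL_slash]
    change (h ∣[k] diagTwoOne) ∣[k] mapGL ℝ γ = _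
    rw [← SlashAction.slash_mul, hγ', SlashAction.slash_mul, hs']
  · rw [ModularForm.SL_slash]
    change (h ∣[k] diagTwoOne) ∣[k] mapGL ℝ S = _
    rw [← SlashAction.slash_mul, diagTwoOne_mul_S, SlashAction.slash_mul, hs']
  · simp [diagTwoOne, Matrix.GeneralLinearGroup.mkOfDetNeZero]
  · simp [diagOneTwo, Matrix.GeneralLinearGroup.mkOfDetNeZero]

/-- The quasimodularity defects of `E₂(τ)` and of `2 E₂(2τ)` cancel over `Γ₀(2)`. -/
theorem isModularPair_E2 :
    IsModularPair 2 (E2 - E2 ∣[(2 : ℤ)] diagTwoOne) (E2 - E2 ∣[(2 : ℤ)] diagOneTwo) := by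
  have hE (γ : SL(2, ℤ)) : E2 ∣[(2 : ℤ)] mapGL ℝ γ = E2 - (1 / (2 * riemannZeta 2)) • D2 γ :=
    E2_slash_action γ
  have hσ2 : σ diagTwoOne = ContinuousAlgEquiv.refl ℝ ℂ := by
    rw [σ, if_pos]; simp [diagTwoOne, Matrix.GeneralLinearGroup.mkOfDetNeZero]
  have hσ1 : σ diagOneTwo = ContinuousAlgEquiv.refl ℝ ℂ := by
    rw [σ, if_pos]; simp [diagOneTwo, Matrix.GeneralLinearGroup.mkOfDetNeZero]
  have hsub (f f' : ℍ → ℂ) (g : GL (Fin 2) ℝ) :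
      (f - f') ∣[(2 : ℤ)] g = f ∣[(2 : ℤ)] g - f' ∣[(2 : ℤ)] g := by
    rw [sub_eq_add_neg, SlashAction.add_slash, SlashAction.neg_slash, sub_eq_add_neg]
  refine ⟨E2_mdifferentiable.sub (E2_mdifferentiable.slash 2 _), fun γ hγ => ?_, ?_,
    isBoundedAtImInfty_E2.sub (isBoundedAtImInfty_E2.slash 2 ?_),
    isBoundedAtImInfty_E2.sub (isBoundedAtImInfty_E2.slash 2 ?_)⟩
  · obtain ⟨γ', hγ', hc, hd⟩ := exists_diagTwoOne_mul hγ
    rw [ModularForm.SL_slash]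
    change (E2 - E2 ∣[(2 : ℤ)] diagTwoOne) ∣[(2 : ℤ)] mapGL ℝ γ = _
    rw [hsub, ← SlashAction.slash_mul, hγ', SlashAction.slash_mul, hE, hE, hsub,
      ModularForm.smul_slash, hσ2]
    have hD : D2 γ' ∣[(2 : ℤ)] diagTwoOne = D2 γ := by
      ext τ
      rw [slash_diagTwoOne, D2, D2, ModularGroup.denom_apply, ModularGroup.denom_apply, hd, ← hc]
      simp only [double]
      push_cast
      norm_num
      ring
    rw [hD]
    simp
  · rw [ModularForm.SL_slash]
    change (E2 - E2 ∣[(2 : ℤ)] diagTwoOne) ∣[(2 : ℤ)] mapGL ℝ S = _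
    rw [hsub, ← SlashAction.slash_mul, diagTwoOne_mul_S, SlashAction.slash_mul, hE, hsub,
      ModularForm.smul_slash, hσ1]
    have hD : D2 S ∣[(2 : ℤ)] diagOneTwo = D2 S := by
      ext τ
      rw [slash_diagOneTwo, D2_S, D2_S]
      simp only [half]
      have := τ.ne_zero
      field_simp
    rw [hD]
    simp
  · simp [diagTwoOne, Matrix.GeneralLinearGroup.mkOfDetNeZero]
  · simp [diagOneTwo, Matrix.GeneralLinearGroup.mkOfDetNeZero]

end Modular

/-! ### Modularity of the coefficients of the power sums -/

section Coefficients

open UpperHalfPlane EisensteinSeries ModularForm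
open scoped ModularForm

/-- The Eisenstein series `-B_k/(2k) + ∑_{n ≥ 1} σ_{k-1}(n) e^{2π i n z}`. -/
def eisG (k : ℕ) (z : ℂ) : ℂ := sigmaSum k z - 1 / 2 * bernoulliQuot k

theorem sigmaSum_eq_tsum_pnat {k : ℕ} (hk : k ≠ 0) (τ : ℍ) :
    sigmaSum k τ = ∑' n : ℕ+, (ArithmeticFunction.sigma (k - 1) n : ℂ) *
      Complex.exp (2 * Real.pi * Complex.I * τ) ^ (n : ℕ) := by
  rw [tsum_pnat_eq_tsum_succ (f := fun n : ℕ => (ArithmeticFunction.sigma (k - 1) n : ℂ) *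
    Complex.exp (2 * Real.pi * Complex.I * τ) ^ n), sigmaSum,
    (summable_sigma_mul_cexp_pow (Nat.one_le_iff_ne_zero.2 hk) τ).tsum_eq_zero_add]
  simp

theorem bernoulli_ne_zero {k : ℕ} (hk : Even k) (h0 : k ≠ 0) : bernoulli k ≠ 0 := by
  obtain ⟨j, rfl⟩ := hk.two_dvd
  have hj : j ≠ 0 := by rintro rfl; exact h0 rfl
  intro h
  have h1 := riemannZeta_two_mul_nat hj
  rw [h] at h1
  refine riemannZeta_ne_zero_of_one_lt_re (s := 2 * j) ?_ (by simpa using h1)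
  have : (1 : ℝ) ≤ j := by exact_mod_cast Nat.one_le_iff_ne_zero.2 hj
  simp
  linarith

theorem eisG_eq {k : ℕ} (hk : 3 ≤ k) (hk2 : Even k) (τ : ℍ) :
    eisG k τ = -(bernoulliQuot k / 2) * E hk τ := by
  rw [q_expansion_bernoulli hk hk2, eisG, sigmaSum_eq_tsum_pnat (by omega), bernoulliQuot,
    if_neg (by omega)]
  simp only [zpow_natCast]
  have h1 : (bernoulli k : ℂ) ≠ 0 := by exact_mod_cast bernoulli_ne_zero hk2 (by omega)
  have h2 : (k : ℂ) ≠ 0 := Nat.cast_ne_zero.2 (by omega)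
  field_simp
  ring

theorem eisG_two (τ : ℍ) : eisG 2 τ = -(1 / 24) * E2 τ := by
  rw [E2_eq_tsum_cexp, eisG, sigmaSum_eq_tsum_pnat two_ne_zero, bernoulliQuot,
    if_neg (lt_irrefl 2), bernoulli_two]
  push_cast
  ring

theorem coefT_eq (τ : ℍ) (k : ℕ) :
    coefT τ k = (if k = 2 then E2 τ / 24 else 0) + eisG k τ := by
  rw [coefT, symVal, eisG]
  ring

theorem coefW₁_eq (τ : ℍ) (k : ℕ) :
    coefW₁ τ k = -(if k = 2 then E2 τ / 24 else 0) + eisG k τ - 2 ^ k * eisG k (double τ) := by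
  simp only [coefW₁, lamVal₁, eisG, double]
  ring

theorem coefW₂_eq (τ : ℍ) (k : ℕ) :
    coefW₂ τ k = -(if k = 2 then E2 τ / 24 else 0) + eisG k τ - eisG k (half τ) := by
  simp only [coefW₂, lamVal₂, eisG, half]
  ring

theorem coefξ₁_eq (τ : ℍ) (k : ℕ) :
    coefξ₁ τ k = -(2 + 2 ^ k) * eisG k τ + 3 * 2 ^ k * eisG k (double τ) := by
  simp only [coefξ₁, lamVal₁, lamVal₂, lamVal₃, eisG, double]
  ring

theorem coefξ₂_eq (τ : ℍ) (k : ℕ) :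
    coefξ₂ τ k = -(2 + 2 ^ k) * eisG k τ + 3 * eisG k (half τ) := by
  simp only [coefξ₂, lamVal₁, lamVal₂, lamVal₃, eisG, half]
  ring

/-- The coefficients of the power sums of even degree are modular forms over `Γ₀(2)` for `Θ₁`, and
their transforms under `τ ↦ -1/τ` are the coefficients for `Θ₂`. -/
theorem isModularPair_coef {k : ℕ} (hk : Even k) (h0 : k ≠ 0) :
    IsModularPair k (fun τ => coefT τ k) (fun τ => coefT τ k) ∧
    IsModularPair k (fun τ => coefW₁ τ k) (fun τ => coefW₂ τ k) ∧
    IsModularPair k (fun τ => coefξ₁ τ k) (fun τ => coefξ₂ τ k) := by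
  simp only [coefT_eq, coefW₁_eq, coefW₂_eq, coefξ₁_eq, coefξ₂_eq]
  by_cases h2 : k = 2
  · subst h2
    have h := isModularPair_E2
    rw [Nat.cast_ofNat]
    refine ⟨?_, ?_, ?_⟩
    · convert IsModularPair.zero 2 using 1 <;>
      · funext τ
        simp [eisG_two]
        ring
    · convert h.smul (-(1 / 12)) using 1 <;>
      · funext τ
        simp only [Pi.smul_apply, Pi.sub_apply, slash_diagTwoOne, slash_diagOneTwo, eisG_two,
          smul_eq_mul, if_true]
        norm_num
        ring
    · convert h.smul (1 / 4) using 1 <;>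
      · funext τ
        simp only [Pi.smul_apply, Pi.sub_apply, slash_diagTwoOne, slash_diagOneTwo, eisG_two,
          smul_eq_mul]
        norm_num
        ring
  · have hk3 : 3 ≤ k := by
      obtain ⟨j, rfl⟩ := hk
      omega
    obtain ⟨h, h'⟩ := isModularPair_double (k := k) (h := E hk3) (ModularFormClass.holo _)
      (ModularFormClass.bdd_at_infty _)
      fun γ => SlashInvariantFormClass.slash_action_eq (E hk3) _ ⟨γ, rfl⟩
    have hpow : (2 : ℂ) ^ k = 2 * 2 ^ ((k : ℤ) - 1) := by
      rw [← zpow_one_add₀ two_ne_zero, add_sub_cancel, zpow_natCast]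
    refine ⟨?_, ?_, ?_⟩
    · convert h.smul (-(bernoulliQuot k / 2)) using 1 <;>
      · funext τ
        simp [eisG_eq hk3 hk, h2]
    · convert (h.add (h'.smul (-2))).smul (-(bernoulliQuot k / 2)) using 1 <;>
      · funext τ
        simp only [Pi.smul_apply, Pi.add_apply, slash_diagTwoOne, slash_diagOneTwo,
          eisG_eq hk3 hk, smul_eq_mul, if_neg h2, hpow]
        ring
    · convert ((h.smul (-(2 + 2 ^ k))).add (h'.smul 6)).smul (-(bernoulliQuot k / 2)) using 1 <;>
      · funext τ
        simp only [Pi.smul_apply, Pi.add_apply, slash_diagTwoOne, slash_diagOneTwo,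
          eisG_eq hk3 hk, smul_eq_mul, hpow]
        ring

end Coefficients

/-! ### Degrees of forms -/

section Degrees

variable {T : Type*} [AddCommGroup T] [Module ℝ T]

theorem formPart_natCast (n : ℕ) (η : CForm T) :
    formPart n η = DirectSum.decompose (fun i : ℕ => ⋀[ℂ]^i (T →ₗ[ℝ] ℂ)) η n := by
  rw [formPart, if_pos (Int.natCast_nonneg n), Int.toNat_natCast, GradedRing.proj_apply]

theorem formPart_add (j : ℤ) (x y : CForm T) : formPart j (x + y) = formPart j x + formPart j y := by
  rw [formPart, formPart, formPart]
  split_ifs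
  · exact map_add _ _ _
  · exact (add_zero 0).symm

theorem formPart_smul (n : ℕ) (c : ℂ) (x : CForm T) : formPart n (c • x) = c • formPart n x := by
  rw [formPart_natCast, formPart_natCast, DirectSum.decompose_smul]
  rfl

/-- The component of degree `j`, as a linear map. -/
def formPartHom (T : Type*) [AddCommGroup T] [Module ℝ T] (n : ℕ) : CForm T →ₗ[ℂ] CForm T where
  toFun := formPart n
  map_add' := formPart_add n
  map_smul' := formPart_smul n

theorem formPart_of_mem {n : ℕ} {x : CForm T} (hx : x ∈ ⋀[ℂ]^n (T →ₗ[ℝ] ℂ)) (j : ℕ) :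
    formPart j x = if j = n then x else 0 := by
  rw [formPart_natCast]
  split_ifs with h
  · subst h
    exact DirectSum.decompose_of_mem_same _ hx
  · exact DirectSum.decompose_of_mem_ne _ hx (Ne.symm h)

theorem formPart_mul_of_mem {n : ℕ} {x : CForm T} (hx : x ∈ ⋀[ℂ]^n (T →ₗ[ℝ] ℂ)) (y : CForm T)
    (j : ℕ) : formPart j (x * y) = x * formPart (j - n) y := by
  rw [formPart_natCast]
  by_cases h : n ≤ j
  · rw [← Nat.cast_sub h, formPart_natCast]
    exact DirectSum.coe_decompose_mul_of_left_mem_of_le _ hx h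
  · rw [formPart, if_neg (by omega), mul_zero]
    exact DirectSum.coe_decompose_mul_of_left_mem_of_not_le _ hx h

/-- The even forms which are homogeneous of degree `n`. -/
def evenDeg (T : Type*) [AddCommGroup T] [Module ℝ T] (n : ℕ) : Submodule ℂ (EvenForm T) :=
  (⋀[ℂ]^n (T →ₗ[ℝ] ℂ)).comap (Subalgebra.val _).toLinearMap

theorem mem_evenDeg {n : ℕ} {x : EvenForm T} :
    x ∈ evenDeg T n ↔ (x : CForm T) ∈ ⋀[ℂ]^n (T →ₗ[ℝ] ℂ) := Iff.rfl

theorem one_mem_evenDeg : (1 : EvenForm T) ∈ evenDeg T 0 :=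
  SetLike.GradedOne.one_mem (A := fun i : ℕ => ⋀[ℂ]^i (T →ₗ[ℝ] ℂ))

theorem mul_mem_evenDeg {m n : ℕ} {x y : EvenForm T} (hx : x ∈ evenDeg T m) (hy : y ∈ evenDeg T n) :
    x * y ∈ evenDeg T (m + n) :=
  SetLike.GradedMul.mul_mem (A := fun i : ℕ => ⋀[ℂ]^i (T →ₗ[ℝ] ℂ)) hx hy

theorem pow_mem_evenDeg {m : ℕ} {x : EvenForm T} (hx : x ∈ evenDeg T m) (k : ℕ) :
    x ^ k ∈ evenDeg T (m * k) := by
  induction k with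
  | zero => simpa using one_mem_evenDeg
  | succ k ih =>
    rw [pow_succ, Nat.mul_succ]
    exact mul_mem_evenDeg ih hx

theorem twoForm_mem_evenDeg [FiniteDimensional ℝ T] (r : T → T → ℝ) : twoForm r ∈ evenDeg T 2 := by
  refine Submodule.smul_mem _ _ (Submodule.sum_mem _ fun a _ => Submodule.sum_mem _ fun b _ =>
    Submodule.smul_mem _ _ ?_)
  rw [mem_evenDeg, CliffordAlgebra.even.ι, ExteriorAlgebra.exteriorPower, pow_two]
  exact Submodule.mul_mem_mul (LinearMap.mem_range_self _ _) (LinearMap.mem_range_self _ _)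

theorem twoForm_neg [FiniteDimensional ℝ T] (r : T → T → ℝ) :
    twoForm (fun u v => -r u v) = -twoForm r := by
  simp only [twoForm, Complex.ofReal_neg, neg_smul, Finset.sum_neg_distrib, smul_neg]

variable [FiniteDimensional ℝ T]

instance : Module.Finite ℂ (T →ₗ[ℝ] ℂ) := Module.Finite.linearMap ℝ ℂ T ℂ

theorem exteriorPower_eq_bot {n : ℕ} (hn : Module.finrank ℂ (T →ₗ[ℝ] ℂ) < n) :
    (⋀[ℂ]^n (T →ₗ[ℝ] ℂ)) = ⊥ := by
  have h := exteriorPower.finrank_eq (R := ℂ) (M := T →ₗ[ℝ] ℂ) n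
  rw [Nat.choose_eq_zero_of_lt hn] at h
  exact Submodule.finrank_eq_zero.1 h

instance : Module.Finite ℂ (CForm T) := by
  have h := (DirectSum.Decomposition.isInternal
    (fun i : ℕ => ⋀[ℂ]^i (T →ₗ[ℝ] ℂ))).submodule_iSup_eq_top
  refine ⟨?_⟩
  rw [← h]
  have e : (⨆ i : ℕ, ⋀[ℂ]^i (T →ₗ[ℝ] ℂ))
      = ⨆ i : Fin (Module.finrank ℂ (T →ₗ[ℝ] ℂ) + 1), ⋀[ℂ]^(i : ℕ) (T →ₗ[ℝ] ℂ) := by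
    refine le_antisymm (iSup_le fun i => ?_) (iSup_le fun i => le_iSup
      (fun i : ℕ => ⋀[ℂ]^i (T →ₗ[ℝ] ℂ)) i)
    by_cases hi : i < Module.finrank ℂ (T →ₗ[ℝ] ℂ) + 1
    · exact le_iSup (fun i : Fin (Module.finrank ℂ (T →ₗ[ℝ] ℂ) + 1) =>
        ⋀[ℂ]^(i : ℕ) (T →ₗ[ℝ] ℂ)) ⟨i, hi⟩
    · rw [exteriorPower_eq_bot (by omega)]
      exact bot_le
  rw [e]
  exact Submodule.fg_iSup _ fun i => Module.Finite.iff_fg.1 inferInstance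

instance : Module.Finite ℂ (EvenForm T) := FiniteDimensional.finiteDimensional_subalgebra _

theorem isNilpotent_of_mem_evenDeg {x : EvenForm T} (hx : x ∈ evenDeg T 2) : IsNilpotent x := by
  refine ⟨Module.finrank ℂ (T →ₗ[ℝ] ℂ) + 1, ?_⟩
  have h := pow_mem_evenDeg hx (Module.finrank ℂ (T →ₗ[ℝ] ℂ) + 1)
  rw [mem_evenDeg, exteriorPower_eq_bot (by omega)] at h
  exact Subtype.ext h

end Degrees

section TracePowers

variable {T : Type*} [AddCommGroup T] [Module ℝ T] {n : ℕ}

theorem pow_apply_mem_evenDeg {Y : Matrix (Fin n) (Fin n) (EvenForm T)}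
    (hY : ∀ i j, Y i j ∈ evenDeg T 2) (k : ℕ) (i j : Fin n) : (Y ^ k) i j ∈ evenDeg T (2 * k) := by
  induction k generalizing j with
  | zero =>
    rw [pow_zero, Matrix.one_apply]
    split_ifs
    · exact one_mem_evenDeg
    · exact Submodule.zero_mem _
  | succ k ih =>
    rw [pow_succ, Matrix.mul_apply]
    exact Submodule.sum_mem _ fun m _ => mul_mem_evenDeg (ih m) (hY m j)

theorem trace_pow_odd {A : Type*} [CommRing A] [Algebra ℂ A] {Y : Matrix (Fin n) (Fin n) A}
    (hY : Y.transpose = -Y) {k : ℕ} (hk : Odd k) : (Y ^ k).trace = 0 := by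
  have h : (Y ^ k).trace = -(Y ^ k).trace := by
    nth_rewrite 1 [← Matrix.trace_transpose]
    rw [Matrix.transpose_pow, hY, hk.neg_pow, Matrix.trace_neg]
  have h' : (2 : ℂ) • (Y ^ k).trace = 0 := by
    rw [two_smul]
    nth_rewrite 1 [h]
    exact neg_add_cancel _
  calc (Y ^ k).trace = (1 / 2 : ℂ) • ((2 : ℂ) • (Y ^ k).trace) := by rw [smul_smul]; norm_num
    _ = 0 := by rw [h', smul_zero]

theorem chernMatrix_mem {R : Matrix (Fin n) (Fin n) (EvenForm T)}
    (hR : ∀ i j, R i j ∈ evenDeg T 2) (i j : Fin n) : chernMatrix R i j ∈ evenDeg T 2 :=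
  Submodule.smul_mem _ _ (hR i j)

theorem chernMatrix_transpose {A : Type*} [CommRing A] [Algebra ℂ A]
    {R : Matrix (Fin n) (Fin n) A} (hR : R.transpose = -R) :
    (chernMatrix R).transpose = -chernMatrix R := by
  rw [chernMatrix, Matrix.transpose_smul, hR, smul_neg]

end TracePowers

/-! ### Pairs of modular forms with values in forms -/

section GradedPairs

variable (T : Type*) [AddCommGroup T] [Module ℝ T]

/-- The pairs `(f v, (f|S) v)` with `f` a modular form over `Γ₀(2)` of weight `k` and `v` a form of
degree `2k`. -/
def homogeneousPairs : Submonoid ((ℍ → EvenForm T) × (ℍ → EvenForm T)) where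
  carrier := {p | ∃ (k : ℕ) (f g : ℍ → ℂ) (v : EvenForm T), IsModularPair k f g ∧
    v ∈ evenDeg T (2 * k) ∧ p = (fun τ => f τ • v, fun τ => g τ • v)}
  one_mem' := ⟨0, 1, 1, 1, IsModularPair.one, one_mem_evenDeg, by
    simp only [Pi.one_apply, one_smul]
    rfl⟩
  mul_mem' := by
    rintro _ _ ⟨k, f, g, v, h, hv, rfl⟩ ⟨k', f', g', v', h', hv', rfl⟩
    refine ⟨k + k', f * f', g * g', v * v', by exact_mod_cast h.mul h', ?_, ?_⟩
    · rw [mul_add]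
      exact mul_mem_evenDeg hv hv'
    · simp only [Pi.mul_apply, Prod.mk_mul_mk, ← smul_mul_smul_comm]
      rfl

/-- The algebra spanned by the pairs `(f v, (f|S) v)`, with `f` a modular form over `Γ₀(2)` and `v`
a form whose degree is twice the weight of `f`. -/
def gradedPairs : Subalgebra ℂ ((ℍ → EvenForm T) × (ℍ → EvenForm T)) :=
  Algebra.adjoin ℂ (homogeneousPairs T : Set _)

variable {T}

/-- The component of degree `2k` of an element of `gradedPairs` is modular of weight `k`. -/
theorem isModularPair_formPart {F G : ℍ → EvenForm T} (h : (F, G) ∈ gradedPairs T) (k : ℕ)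
    (φ : CForm T →ₗ[ℂ] ℂ) :
    IsModularPair k (fun τ => φ (formPart (2 * k : ℕ) (F τ : CForm T)))
      (fun τ => φ (formPart (2 * k : ℕ) (G τ : CForm T))) := by
  rw [gradedPairs, ← Subalgebra.mem_toSubmodule, Algebra.adjoin_eq_span, Submonoid.closure_eq] at h
  generalize hp : (F, G) = p at h
  obtain ⟨rfl, rfl⟩ : F = p.1 ∧ G = p.2 := ⟨congrArg Prod.fst hp, congrArg Prod.snd hp⟩
  clear hp
  let L := φ.comp ((formPartHom T (2 * k)).comp
    (Subalgebra.val (CliffordAlgebra.even (0 : QuadraticForm ℂ (T →ₗ[ℝ] ℂ)))).toLinearMap)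
  change IsModularPair k (fun τ => L (p.1 τ)) (fun τ => L (p.2 τ))
  induction h using Submodule.span_induction with
  | mem p hp =>
    obtain ⟨k', f, g, v, h, hv, rfl⟩ := hp
    simp only [map_smul]
    by_cases hk : k = k'
    · subst hk
      convert h.smul (L v) using 1 <;>
      · funext τ
        simp [mul_comm]
    · have : L v = 0 := by
        change φ (formPart (2 * k : ℕ) (v : CForm T)) = 0
        rw [formPart_of_mem (mem_evenDeg.1 hv), if_neg (by omega), map_zero]
      simp only [this, smul_zero]
      exact IsModularPair.zero k
  | zero =>
    convert IsModularPair.zero k using 1 <;>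
    · funext τ
      exact map_zero L
  | add p p' _ _ h h' =>
    convert h.add h' using 1 <;>
    · funext τ
      exact map_add L _ _
  | smul c p _ h =>
    convert h.smul c using 1 <;>
    · funext τ
      exact map_smul L _ _

theorem traceEval_mem_gradedPairs {n : ℕ} {Y : Matrix (Fin n) (Fin n) (EvenForm T)}
    (hY : ∀ i j, Y i j ∈ evenDeg T 2) (hskew : Y.transpose = -Y) (N : ℕ) {f g : ℍ → ℕ → ℂ}
    (h : ∀ k : ℕ, Even k → k ≠ 0 → IsModularPair k (fun τ => f τ k) (fun τ => g τ k)) :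
    (fun τ => traceEval Y N (f τ), fun τ => traceEval Y N (g τ)) ∈ gradedPairs T := by
  have h1 : ∀ k ∈ Finset.Ico 1 N, (fun τ => f τ k • ((1 / k.factorial : ℂ) • (Y ^ k).trace),
      fun τ => g τ k • ((1 / k.factorial : ℂ) • (Y ^ k).trace)) ∈ gradedPairs T := by
    intro k hk
    rcases Nat.even_or_odd k with hk2 | hk2
    · refine Algebra.subset_adjoin ⟨k, _, _, _,
        h k hk2 (Nat.one_le_iff_ne_zero.1 (Finset.mem_Ico.1 hk).1), ?_, rfl⟩
      exact Submodule.smul_mem _ _ (Submodule.sum_mem _ fun i _ => pow_apply_mem_evenDeg hY k i i)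
    · simp only [trace_pow_odd hskew hk2, smul_zero]
      exact (gradedPairs T).zero_mem
  have := (gradedPairs T).sum_mem h1
  convert this using 1
  refine Prod.ext (funext fun τ => ?_) (funext fun τ => ?_)
  · simp [Prod.fst_sum, traceEval]
  · simp [Prod.snd_sum, traceEval]

end GradedPairs

/-! ### Modularity at a point -/

section Pontryagin

theorem pontryaginOne_mem_evenDeg {T : Type*} [AddCommGroup T] [Module ℝ T] {n : ℕ}
    {R : Matrix (Fin n) (Fin n) (EvenForm T)}
    (hR : ∀ i j, R i j ∈ evenDeg T 2) : pontryaginOne R ∈ evenDeg T 4 := by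
  rw [pontryaginOne, ← pow_two]
  exact Submodule.smul_mem _ _ (Submodule.sum_mem _ fun i _ => pow_apply_mem_evenDeg hR 2 i i)

theorem isNilpotent_pontryaginOne {A : Type*} [CommRing A] [Algebra ℂ A] {n : ℕ}
    {R : Matrix (Fin n) (Fin n) A}
    (hR : ∀ i j, IsNilpotent (R i j)) : IsNilpotent (pontryaginOne R) := by
  rw [pontryaginOne, ← pow_two]
  generalize (-(1 / (8 * (Real.pi : ℂ) ^ 2))) = c
  exact (isNilpotent_trace_pow hR two_ne_zero).smul c

end Pontryagin

section Pointwise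

variable {T : Type*} [AddCommGroup T] [Module ℝ T]

section GradedPairs

variable [FiniteDimensional ℝ T]

theorem nilEval_mem_gradedPairs {F G : ℍ → EvenForm T} (h : (F, G) ∈ gradedPairs T)
    (hF : ∀ τ, IsNilpotent (F τ)) (hG : ∀ τ, IsNilpotent (G τ)) (f : ℂ⟦X⟧) :
    (fun τ => nilEval f (F τ), fun τ => nilEval f (G τ)) ∈ gradedPairs T := by
  have : IsNoetherianRing (EvenForm T) := isNoetherian_of_tower ℂ inferInstance
  obtain ⟨M, hM⟩ := IsNoetherianRing.isNilpotent_nilradical (EvenForm T)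
  have hM' {F : ℍ → EvenForm T} (hz : ∀ τ, IsNilpotent (F τ)) : IsNilpotent F := by
    refine ⟨M, funext fun τ => ?_⟩
    have := Ideal.pow_mem_pow (mem_nilradical.2 (hz τ)) M
    rwa [hM] at this
  have hmem := nilEval_mem (gradedPairs T) f h
  rw [nilEval_prodMk (hM' hF) (hM' hG)] at hmem
  convert hmem using 2
  · exact funext fun τ => (map_nilEval (Pi.evalAlgHom ℂ (fun _ : ℍ => EvenForm T) τ) (hM' hF) f).symm
  · exact funext fun τ => (map_nilEval (Pi.evalAlgHom ℂ (fun _ : ℍ => EvenForm T) τ) (hM' hG) f).symm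

end GradedPairs

namespace CurvatureData

/-- The curvature matrices consist of `2`-forms and are skew-symmetric, as is the case for metric
connections in orthonormal frames. -/
structure IsMetric (D : CurvatureData T) : Prop where
  memT : ∀ i j, D.RT i j ∈ evenDeg T 2
  memW : ∀ i j, D.RW i j ∈ evenDeg T 2
  memξ : ∀ i j, D.Rξ i j ∈ evenDeg T 2
  skewT : D.RT.transpose = -D.RT
  skewW : D.RW.transpose = -D.RW
  skewξ : D.Rξ.transpose = -D.Rξ

variable {D : CurvatureData T}

theorem IsMetric.pDiff_mem (hD : D.IsMetric) : D.pDiff ∈ evenDeg T 4 :=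
  Submodule.sub_mem _ (pontryaginOne_mem_evenDeg hD.memT) (pontryaginOne_mem_evenDeg hD.memW)

variable [FiniteDimensional ℝ T]

theorem IsMetric.isNilpotent_pDiff (hD : D.IsMetric) : IsNilpotent D.pDiff :=
  (Commute.all _ _).isNilpotent_sub
    (isNilpotent_pontryaginOne fun i j => isNilpotent_of_mem_evenDeg (hD.memT i j))
    (isNilpotent_pontryaginOne fun i j => isNilpotent_of_mem_evenDeg (hD.memW i j))

/-- `F₂ + p F₃` is the component of `e^{E₂ p / 24} Â(TX) cosh(c/2) ch(Θ₂)`. -/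
theorem IsMetric.form₂_add (hD : D.IsMetric) (k : ℕ) (τ : ℍ) :
    D.form₂ k τ + (D.pDiff : CForm T) * D.form₃ (k - 4) τ = formPart k
      ((nilEval expSeries ((EisensteinSeries.E2 τ / 24) • D.pDiff) *
        (aHat D.RT * nilEval coshSeries ((1 / 2 : ℂ) • D.euler)) *
        qEval D.chΘ₂ τ : EvenForm T) : CForm T) := by
  have h := formPart_mul_of_mem (mem_evenDeg.1 hD.pDiff_mem)
    ((nilEval (expQuotSeries (EisensteinSeries.E2 τ / 24)) D.pDiff *
      (aHat D.RT * nilEval coshSeries ((1 / 2 : ℂ) • D.euler)) * qEval D.chΘ₂ τ : EvenForm T) :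
      CForm T) k
  rw [Nat.cast_ofNat] at h
  rw [form₂, form₃, ← h, ← formPart_add, ← one_add_mul_nilEval_expQuot hD.isNilpotent_pDiff]
  congr 1
  rw [← Subalgebra.coe_mul, ← Subalgebra.coe_add]
  congr 1
  ring

theorem IsMetric.exists_gradedPair (hD : D.IsMetric) (l : ℕ) :
    (QConverges D.chΘ₁ ∧ QConverges D.chΘ₂) ∧
    ∃ F G : ℍ → EvenForm T, (F, G) ∈ gradedPairs T ∧
      (∀ (k : ℕ) (τ : ℍ), D.form₁ l k τ = (2 ^ l : ℂ) • formPart k (F τ : CForm T)) ∧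
      ∀ (k : ℕ) (τ : ℍ), D.form₂ k τ + (D.pDiff : CForm T) * D.form₃ (k - 4) τ
        = formPart k (G τ : CForm T) := by
  have nT : ∀ i j, IsNilpotent (D.RT i j) := fun i j => isNilpotent_of_mem_evenDeg (hD.memT i j)
  have nW : ∀ i j, IsNilpotent (D.RW i j) := fun i j => isNilpotent_of_mem_evenDeg (hD.memW i j)
  have nξ : ∀ i j, IsNilpotent (D.Rξ i j) := fun i j => isNilpotent_of_mem_evenDeg (hD.memξ i j)
  obtain ⟨a, ha⟩ := isNilpotent_matrix_of_entries (isNilpotent_chernMatrix nT)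
  obtain ⟨b, hb⟩ := isNilpotent_matrix_of_entries (isNilpotent_chernMatrix nW)
  obtain ⟨c, hc⟩ := isNilpotent_matrix_of_entries (isNilpotent_chernMatrix nξ)
  obtain ⟨e, he⟩ : IsNilpotent D.euler :=
    isNilpotent_of_mem_evenDeg (Submodule.smul_mem _ _ (hD.memξ 0 1))
  have hN : 3 ≤ a + b + c + e + 3 := by omega
  generalize hNe : a + b + c + e + 3 = N at hN
  have hNT := pow_eq_zero_of_le (show a ≤ N by omega) ha
  have hNW := pow_eq_zero_of_le (show b ≤ N by omega) hb
  have hNξ := pow_eq_zero_of_le (show c ≤ N by omega) hc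
  have hNe := pow_eq_zero_of_le (show e ≤ N by omega) he
  obtain ⟨⟨c1, -⟩, ⟨c2, -⟩⟩ := qEval_chTheta nT nW nξ hNT hNW hNξ
  have nil (f g h : ℕ → ℂ) : IsNilpotent (totalEval D.RT D.RW D.Rξ N f g h) := by
    have add {Z Z' : EvenForm T} (h : IsNilpotent Z) (h' : IsNilpotent Z') : IsNilpotent (Z + Z') :=
      (Commute.all _ _).isNilpotent_add h h'
    exact add (add (isNilpotent_traceEval (isNilpotent_chernMatrix nT) N f)
      (isNilpotent_traceEval (isNilpotent_chernMatrix nW) N g))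
      (isNilpotent_traceEval (isNilpotent_chernMatrix nξ) N h)
  refine ⟨⟨c1, c2⟩, _, _, nilEval_mem_gradedPairs (F := fun τ =>
      totalEval D.RT D.RW D.Rξ N (coefT τ) (coefW₁ τ) (coefξ₁ τ)) (G := fun τ =>
      totalEval D.RT D.RW D.Rξ N (coefT τ) (coefW₂ τ) (coefξ₂ τ)) ?_
      (fun τ => nil _ _ _) (fun τ => nil _ _ _) expSeries, fun k τ => ?_, fun k τ => ?_⟩
  · exact (gradedPairs T).add_mem ((gradedPairs T).add_mem
      (traceEval_mem_gradedPairs (chernMatrix_mem hD.memT) (chernMatrix_transpose hD.skewT) N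
        fun k hk h0 => (isModularPair_coef hk h0).1)
      (traceEval_mem_gradedPairs (chernMatrix_mem hD.memW) (chernMatrix_transpose hD.skewW) N
        fun k hk h0 => (isModularPair_coef hk h0).2.1))
      (traceEval_mem_gradedPairs (chernMatrix_mem hD.memξ) (chernMatrix_transpose hD.skewξ) N
        fun k hk h0 => (isModularPair_coef hk h0).2.2)
  · rw [form₁, ← formPart_smul]
    exact congrArg (fun y : EvenForm T => formPart k (y : CForm T))
      (exp_mul_expand_eq_total₁ nT nW nξ hNT hNW hNξ hD.skewξ hNe hN l τ)
  · rw [hD.form₂_add]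
    exact congrArg (fun y : EvenForm T => formPart k (y : CForm T))
      (exp_mul_expand_eq_total₂ nT nW nξ hNT hNW hNξ hD.skewξ hNe hN τ)

/-- The modularity of the forms and their transformation under `τ ↦ -1/τ`, in every even degree
`2k`. -/
theorem IsMetric.modular (hD : D.IsMetric) (l k : ℕ) {j : ℤ} (hj : j = (2 * k : ℕ)) :
    IsModularFormValued (CongruenceSubgroup.Gamma0 2) k (D.form₁ l j) ∧
    IsModularFormValued GammaUpper0 k
      (fun τ => D.form₂ j τ + (D.pDiff : CForm T) * D.form₃ (j - 4) τ) ∧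
    ∀ τ τ' : ℍ, (τ' : ℂ) = -1 / (τ : ℂ) → D.form₁ l j τ' = ((2 : ℂ) ^ l * (τ : ℂ) ^ k) •
      (D.form₂ j τ + (D.pDiff : CForm T) * D.form₃ (j - 4) τ) := by
  subst hj
  obtain ⟨-, F, G, hFG, h1, h2⟩ := hD.exists_gradedPair l
  have e1 : D.form₁ l (2 * k : ℕ) = fun τ => (2 ^ l : ℂ) • formPart (2 * k : ℕ) (F τ : CForm T) :=
    funext fun τ => h1 _ τ
  simp only [e1, h2]
  have key := fun φ => isModularPair_formPart hFG k φ
  refine ⟨fun φ => ?_, fun φ => (key φ).exists_modularForm', fun τ τ' hτ => ?_⟩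
  · obtain ⟨f, hf⟩ := ((key φ).smul (2 ^ l)).exists_modularForm
    exact ⟨f, fun τ => (hf τ).trans (map_smul φ _ _).symm⟩
  · obtain rfl : τ' = ModularGroup.S • τ := by
      ext
      rw [hτ, UpperHalfPlane.modular_S_smul]
      change -1 / (τ : ℂ) = (-(τ : ℂ))⁻¹
      rw [neg_div, one_div, inv_neg]
    rw [mul_smul]
    congr 1
    rw [← sub_eq_zero, ← Module.forall_dual_apply_eq_zero_iff ℂ]
    intro φ
    rw [map_sub, map_smul, sub_eq_zero, smul_eq_mul]
    exact_mod_cast (key φ).apply_S_smul τ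

end CurvatureData

end Pointwise

/-! ### The curvature of a metric connection -/

section CoordinateFields

theorem lieBracketWithin_const {E : Type*} [NormedAddCommGroup E] [NormedSpace ℝ E] (u v : E)
    (s : Set E) (z : E) :
    VectorField.lieBracketWithin ℝ (fun _ : E => u) (fun _ : E => v) s z = 0 := by
  simp [VectorField.lieBracketWithin]

theorem fderiv_fderiv_apply {E : Type*} [NormedAddCommGroup E] [NormedSpace ℝ E] {g : E → ℝ} {z : E}
    (hg : DifferentiableAt ℝ (fderiv ℝ g) z) (u v : E) :
    fderiv ℝ (fun z => fderiv ℝ g z u) z v = fderiv ℝ (fderiv ℝ g) z v u := by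
  rw [fderiv_clm_apply hg (differentiableAt_const _)]
  simp

variable {E : Type*} [NormedAddCommGroup E] [NormedSpace ℝ E]
  {H : Type*} [TopologicalSpace H] {I : ModelWithCorners ℝ E H}
  {X : Type*} [TopologicalSpace X] [ChartedSpace H X] [IsManifold I 1 X]

/-- The extension of a tangent vector is a coordinate vector field. -/
theorem extend_tangent_eq {x y : X} (hy : y ∈ (chartAt H x).source) (u : TangentSpace I x) :
    FiberBundle.extend E u y
      = mfderivWithin 𝓘(ℝ, E) I (extChartAt I x).symm (Set.range I) (extChartAt I x y) u := by
  rw [← TangentBundle.symmL_trivializationAt hy]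
  have h : ((trivializationAt E (TangentSpace I) x) ⟨x, u⟩).2 = u := by
    have h1 := TangentBundle.continuousLinearMapAt_trivializationAt (I := I) (mem_chart_source H x)
    rw [mfderiv_extChartAt_self] at h1
    exact ((trivializationAt E (TangentSpace I) x).continuousLinearMapAt_apply_of_mem (R := ℝ)
      (FiberBundle.mem_baseSet_trivializationAt' x) u).symm.trans (DFunLike.congr_fun h1 u)
  rw [FiberBundle.extend, h]
  exact ((trivializationAt E (TangentSpace I) x).symmL_apply (R := ℝ) hy u).symm

variable [I.Boundaryless]

theorem mlieBracket_extend {x : X} (u v : TangentSpace I x) :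
    VectorField.mlieBracket I (FiberBundle.extend E u) (FiberBundle.extend E v) x = 0 := by
  have key (u : TangentSpace I x) : VectorField.mpullbackWithin 𝓘(ℝ, E) I (extChartAt I x).symm
      (FiberBundle.extend E u) (Set.range I) =ᶠ[𝓝 (extChartAt I x x)] fun _ => (u : E) := by
    filter_upwards [extChartAt_target_mem_nhds x] with z hz
    rw [VectorField.mpullbackWithin_apply, extend_tangent_eq (by
      simpa using (extChartAt I x).map_target hz), (extChartAt I x).right_inv hz]
    exact (isInvertible_mfderivWithin_extChartAt_symm hz).inverse_apply_eq.2 rfl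
  rw [← VectorField.mlieBracketWithin_univ, VectorField.mlieBracketWithin_apply]
  have h := Filter.EventuallyEq.lieBracketWithin_vectorField_eq_nhds (𝕜 := ℝ)
    (s := (extChartAt I x).symm ⁻¹' Set.univ ∩ Set.range I) (key u) (key v)
  exact (congrArg _ (h.trans (lieBracketWithin_const (E := E) u v _ _))).trans (map_zero _)

/-- The derivative of a function along a coordinate vector field, in the chart. -/
theorem mvfderiv_extend_eq {x y : X} (hy : y ∈ (chartAt H x).source) (u : TangentSpace I x)
    {f : X → ℝ} (hf : MDifferentiableAt I 𝓘(ℝ) f y) :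
    mvfderiv I f y (FiberBundle.extend E u y)
      = fderiv ℝ (f ∘ (extChartAt I x).symm) (extChartAt I x y) u := by
  have hy' : y ∈ (extChartAt I x).source := by rwa [extChartAt_source]
  have e : (extChartAt I x).symm (extChartAt I x y) = y := (extChartAt I x).left_inv hy'
  have hs : MDifferentiableAt 𝓘(ℝ, E) I (extChartAt I x).symm (extChartAt I x y) := by
    have := mdifferentiableWithinAt_extChartAt_symm ((extChartAt I x).map_source hy')
    rwa [ModelWithCorners.range_eq_univ, mdifferentiableWithinAt_univ] at this
  rw [extend_tangent_eq hy, ModelWithCorners.range_eq_univ, mfderivWithin_univ,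
    ← mfderiv_eq_fderiv]
  exact (mvfderiv_comp_apply_of_eq (extChartAt I x y) hf hs e u).symm

theorem mvfderiv_mvfderiv_extend {x : X} (u v : TangentSpace I x) {f : X → ℝ}
    (hf : ContMDiffAt I 𝓘(ℝ) 2 f x) :
    MDifferentiableAt I 𝓘(ℝ) (fun y => mvfderiv I f y (FiberBundle.extend E u y)) x ∧
    mvfderiv I (fun y => mvfderiv I f y (FiberBundle.extend E u y)) x v
      = fderiv ℝ (fderiv ℝ (f ∘ (extChartAt I x).symm)) (extChartAt I x x) v u := by
  have hg : ContDiffAt ℝ 2 (f ∘ (extChartAt I x).symm) (extChartAt I x x) := by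
    have := (contMDiffAt_iff.1 hf).2
    rwa [ModelWithCorners.range_eq_univ, contDiffWithinAt_univ] at this
  have hg' : DifferentiableAt ℝ (fderiv ℝ (f ∘ (extChartAt I x).symm)) (extChartAt I x x) :=
    (hg.fderiv_right (m := 1) (by norm_num)).differentiableAt one_ne_zero
  have hG : DifferentiableAt ℝ (fun z => fderiv ℝ (f ∘ (extChartAt I x).symm) z u)
      (extChartAt I x x) := hg'.clm_apply (differentiableAt_const _)
  have hφ : MDifferentiableAt I 𝓘(ℝ, E) (extChartAt I x) x :=
    mdifferentiableAt_extChartAt (mem_chart_source H x)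
  have e : (fun y => mvfderiv I f y (FiberBundle.extend E u y)) =ᶠ[𝓝 x]
      (fun z => fderiv ℝ (f ∘ (extChartAt I x).symm) z u) ∘ extChartAt I x := by
    filter_upwards [(contMDiffAt_iff_contMDiffAt_nhds (by simp)).1 (hf.of_le one_le_two),
      (chartAt H x).open_source.mem_nhds (mem_chart_source H x)] with y hy hy'
    exact mvfderiv_extend_eq hy' u (hy.mdifferentiableAt one_ne_zero)
  refine ⟨(hG.mdifferentiableAt.comp x hφ).congr_of_eventuallyEq e, ?_⟩
  have h1 : mvfderiv I (fun y => mvfderiv I f y (FiberBundle.extend E u y)) x v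
      = mvfderiv I ((fun z => fderiv ℝ (f ∘ (extChartAt I x).symm) z u) ∘ extChartAt I x) x v :=
    congrArg (fun L : E →L[ℝ] ℝ => L v) e.mfderiv_eq
  rw [h1, mvfderiv_comp_apply x hG.mdifferentiableAt hφ, mfderiv_extChartAt_self]
  refine (congrArg (fun L : E →L[ℝ] ℝ => L v) (mfderiv_eq_fderiv (𝕜 := ℝ))).trans ?_
  exact fderiv_fderiv_apply hg' u v

/-- Coordinate vector fields commute. -/
theorem mvfderiv_mvfderiv_extend_comm {x : X} (u v : TangentSpace I x) {f : X → ℝ}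
    (hf : ContMDiffAt I 𝓘(ℝ) 2 f x) :
    mvfderiv I (fun y => mvfderiv I f y (FiberBundle.extend E u y)) x v
      = mvfderiv I (fun y => mvfderiv I f y (FiberBundle.extend E v y)) x u := by
  have hg : ContDiffAt ℝ 2 (f ∘ (extChartAt I x).symm) (extChartAt I x x) := by
    have := (contMDiffAt_iff.1 hf).2
    rwa [ModelWithCorners.range_eq_univ, contDiffWithinAt_univ] at this
  rw [(mvfderiv_mvfderiv_extend u v hf).2, (mvfderiv_mvfderiv_extend v u hf).2]
  exact hg.isSymmSndFDerivAt (by simp) v u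

end CoordinateFields

section TwoForms

variable {E : Type*} [NormedAddCommGroup E] [NormedSpace ℝ E] [FiniteDimensional ℝ E]
  {H : Type*} [TopologicalSpace H] {I : ModelWithCorners ℝ E H}
  {X : Type*} [TopologicalSpace X] [ChartedSpace H X] [IsManifold I 1 X]
  {F : Type*} [NormedAddCommGroup F] [NormedSpace ℝ F]
  {V : X → Type*} [TopologicalSpace (TotalSpace F V)]
  [∀ x, NormedAddCommGroup (V x)] [∀ x, InnerProductSpace ℝ (V x)] [FiberBundle F V]

theorem curvatureMatrix_mem (cov : CovariantDerivative I F V) (x : X) {n : ℕ}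
    (e : OrthonormalBasis (Fin n) ℝ (V x)) (i j : Fin n) :
    curvatureMatrix cov x e i j ∈ evenDeg (TangentSpace I x) 2 := by
  have : FiniteDimensional ℝ (TangentSpace I x) := inferInstanceAs (FiniteDimensional ℝ E)
  rw [curvatureMatrix, Matrix.of_apply]
  exact twoForm_mem_evenDeg (T := TangentSpace I x) _

end TwoForms

section Metric

variable {E : Type*} [NormedAddCommGroup E] [NormedSpace ℝ E] [FiniteDimensional ℝ E]
  {H : Type*} [TopologicalSpace H] {I : ModelWithCorners ℝ E H}
  {X : Type*} [TopologicalSpace X] [T2Space X] [ChartedSpace H X] [IsManifold I ∞ X]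
  {F : Type*} [NormedAddCommGroup F] [NormedSpace ℝ F]
  {V : X → Type*} [TopologicalSpace (TotalSpace F V)]
  [∀ x, NormedAddCommGroup (V x)] [∀ x, InnerProductSpace ℝ (V x)] [FiberBundle F V]
  [VectorBundle ℝ F V]

/-- A local section extends, near a point of its domain, to a global one. -/
theorem exists_contMDiff_extension {x : X} {σ : Π y, V y} {s : Set X} (hs : s ∈ 𝓝 x)
    (hσ : ContMDiffOn I (I.prod 𝓘(ℝ, F)) ∞ (fun y => TotalSpace.mk' F y (σ y)) s) :
    ∃ σ' : Π y, V y, ContMDiff I (I.prod 𝓘(ℝ, F)) ∞ (fun y => TotalSpace.mk' F y (σ' y)) ∧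
      ∀ᶠ y in 𝓝 x, σ' y = σ y := by
  obtain ⟨u, hus, hu, hxu⟩ := mem_nhds_iff.1 hs
  obtain ⟨ψ, hψ, -⟩ := (SmoothBumpFunction.nhds_basis_support (I := I) (hu.mem_nhds hxu)).mem_iff.1
    (Filter.univ_mem : Set.univ ∈ 𝓝 x)
  refine ⟨(ψ : X → ℝ) • σ, ContMDiffOn.smul_section_of_tsupport ψ.contMDiff.contMDiffOn hu hψ
    (hσ.mono hus), ?_⟩
  filter_upwards [ψ.eventuallyEq_one] with y hy
  change ψ y • σ y = σ y
  rw [hy, Pi.one_apply, one_smul]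

variable [ContMDiffVectorBundle ∞ F V I] {cov : CovariantDerivative I F V}

/-- The covariant derivative of an extended vector along a coordinate vector field is smooth; this
allows the metric to be differentiated twice. -/
theorem contMDiffAt_cov (hcov : CovariantDerivative.ContMDiffCovariantDerivative cov ∞) {x : X}
    (w : V x) (u : TangentSpace I x) :
    ContMDiffAt I (I.prod 𝓘(ℝ, F)) ∞ (fun y => TotalSpace.mk' F y
      (cov (FiberBundle.extend F w) y (FiberBundle.extend E u y))) x := by
  obtain ⟨s, hs, hσ⟩ := FiberBundle.exists_contMDiffOn_extend (k := ∞) I F w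
  obtain ⟨σ', hσ', he⟩ := exists_contMDiff_extension hs hσ
  have h1 := (hcov.contMDiff.contMDiff (σ := σ') (hσ'.contMDiffOn.of_le (by simp))).contMDiffAt
    (x := x) Filter.univ_mem
  have h2 := FiberBundle.contMDiffAt_extend (k := ∞) I E u
  refine (h1.clm_bundle_apply h2).congr_of_eventuallyEq ?_
  filter_upwards [he.eventually_nhds, eventually_mem_nhds_iff.2 hs] with y hy hys
  have := cov.isCovariantDerivativeOn.congr_of_eventuallyEq (s := Set.univ)
    ((hσ.contMDiffAt hys).mdifferentiableAt (by simp))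
    (hσ'.contMDiffAt.mdifferentiableAt (by simp)) Filter.univ_mem (hy.mono fun _ h => h.symm)
  rw [this]

variable [FiniteDimensional ℝ F] [IsContMDiffRiemannianBundle I ∞ F V]

theorem mvfderiv_mvfderiv_inner (hcov : CovariantDerivative.ContMDiffCovariantDerivative cov ∞)
    (h : cov.IsMetricCompatible) {x : X} (u v : TangentSpace I x) (w w' : V x) :
    let σ : Π y, V y := FiberBundle.extend F w
    let σ' : Π y, V y := FiberBundle.extend F w'
    mvfderiv I (fun y => mvfderiv I (fun y => inner ℝ (σ y) (σ' y)) y (FiberBundle.extend E u y)) x v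
      = inner ℝ (cov (fun y => cov σ y (FiberBundle.extend E u y)) x v) w'
        + inner ℝ (cov σ x u) (cov σ' x v)
        + (inner ℝ (cov σ x v) (cov σ' x u)
        + inner ℝ w (cov (fun y => cov σ' y (FiberBundle.extend E u y)) x v)) := by
  intro σ σ'
  have dσ := FiberBundle.mdifferentiableAt_extend I F w
  have dσ' := FiberBundle.mdifferentiableAt_extend I F w'
  have cσ := (contMDiffAt_cov hcov w u).mdifferentiableAt (by simp)
  have cσ' := (contMDiffAt_cov hcov w' u).mdifferentiableAt (by simp)
  have e : (fun y => mvfderiv I (fun y => inner ℝ (σ y) (σ' y)) y (FiberBundle.extend E u y))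
      =ᶠ[𝓝 x] (fun y => inner ℝ (cov σ y (FiberBundle.extend E u y)) (σ' y))
        + fun y => inner ℝ (σ y) (cov σ' y (FiberBundle.extend E u y)) := by
    obtain ⟨s, hs, hσ⟩ := FiberBundle.exists_contMDiffOn_extend (k := ∞) I F w
    obtain ⟨s', hs', hσ'⟩ := FiberBundle.exists_contMDiffOn_extend (k := ∞) I F w'
    filter_upwards [eventually_mem_nhds_iff.2 hs, eventually_mem_nhds_iff.2 hs'] with y hy hy'
    exact h.mvfderiv_inner_eq (FiberBundle.extend E u)
      ((hσ.contMDiffAt hy).mdifferentiableAt (by simp))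
      ((hσ'.contMDiffAt hy').mdifferentiableAt (by simp))
  have e1 : mvfderiv I (fun y => mvfderiv I (fun y => inner ℝ (σ y) (σ' y)) y
      (FiberBundle.extend E u y)) x v = mvfderiv I ((fun y => inner ℝ
        (cov σ y (FiberBundle.extend E u y)) (σ' y))
        + fun y => inner ℝ (σ y) (cov σ' y (FiberBundle.extend E u y))) x v :=
    congrArg (fun L : E →L[ℝ] ℝ => L v) e.mfderiv_eq
  have a1 := h.mvfderiv_inner_eq (FiberBundle.extend E v) cσ dσ'
  have a2 := h.mvfderiv_inner_eq (FiberBundle.extend E v) dσ cσ'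
  simp only [FiberBundle.extend_apply_self] at a1 a2
  rw [e1, mvfderiv_add (cσ.inner_bundle dσ') (dσ.inner_bundle cσ'), add_apply,
    a1, a2]

variable [I.Boundaryless]

/-- The curvature of a metric connection is skew-symmetric. -/
theorem inner_curvature (hcov : CovariantDerivative.ContMDiffCovariantDerivative cov ∞)
    (h : cov.IsMetricCompatible) {x : X} (u v : TangentSpace I x) (w w' : V x) :
    inner ℝ (curvature cov x u v w) w' = -inner ℝ (curvature cov x u v w') w := by
  have hf : ContMDiffAt I 𝓘(ℝ) 2 (fun y => inner ℝ (FiberBundle.extend F w y : V y)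
      (FiberBundle.extend F w' y)) x :=
    (ContMDiffAt.inner_bundle (FiberBundle.contMDiffAt_extend (k := ∞) I F w)
      (FiberBundle.contMDiffAt_extend (k := ∞) I F w')).of_le (by norm_cast)
  have h1 := mvfderiv_mvfderiv_extend_comm u v hf
  rw [mvfderiv_mvfderiv_inner hcov h u v w w', mvfderiv_mvfderiv_inner hcov h v u w w'] at h1
  simp only [curvature, mlieBracket_extend, map_zero, sub_zero, inner_sub_left]
  rw [real_inner_comm w (cov _ x u), real_inner_comm w (cov _ x v)]
  linarith

theorem curvatureMatrix_transpose
    (hcov : CovariantDerivative.ContMDiffCovariantDerivative cov ∞) (h : cov.IsMetricCompatible)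
    (x : X) {n : ℕ} (e : OrthonormalBasis (Fin n) ℝ (V x)) :
    (curvatureMatrix cov x e).transpose = -curvatureMatrix cov x e := by
  have : FiniteDimensional ℝ (TangentSpace I x) := inferInstanceAs (FiniteDimensional ℝ E)
  ext1 i j
  rw [Matrix.transpose_apply, Matrix.neg_apply, curvatureMatrix, Matrix.of_apply, Matrix.of_apply,
    ← twoForm_neg]
  congr 1
  funext u v
  exact inner_curvature hcov h u v _ _

end Metric

end CharForms

end

theorem proposition2p1 {d l m : ℕ}
    {X : Type*} [TopologicalSpace X] [T2Space X] [ChartedSpace (EuclideanSpace ℝ (Fin d)) X]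
    [IsManifold (𝓡 d) ∞ X]
    [RiemannianBundle (fun x : X => TangentSpace (𝓡 d) x)]
    [IsContMDiffRiemannianBundle (𝓡 d) ∞ (EuclideanSpace ℝ (Fin d))
      (fun x : X => TangentSpace (𝓡 d) x)]
    (covT : CovariantDerivative (𝓡 d) (EuclideanSpace ℝ (Fin d))
      (fun x : X => TangentSpace (𝓡 d) x))
    (hcovT : CovariantDerivative.ContMDiffCovariantDerivative covT ∞) (hLC : IsLeviCivita covT)
    {W : X → Type*} [TopologicalSpace (TotalSpace (EuclideanSpace ℝ (Fin (2 * l))) W)]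
    [∀ x, NormedAddCommGroup (W x)] [∀ x, InnerProductSpace ℝ (W x)]
    [FiberBundle (EuclideanSpace ℝ (Fin (2 * l))) W]
    [VectorBundle ℝ (EuclideanSpace ℝ (Fin (2 * l))) W]
    [ContMDiffVectorBundle ∞ (EuclideanSpace ℝ (Fin (2 * l))) W (𝓡 d)]
    [IsContMDiffRiemannianBundle (𝓡 d) ∞ (EuclideanSpace ℝ (Fin (2 * l))) W]
    (covW : CovariantDerivative (𝓡 d) (EuclideanSpace ℝ (Fin (2 * l))) W)
    (hcovW : CovariantDerivative.ContMDiffCovariantDerivative covW ∞) (hW : covW.IsMetricCompatible)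
    {ξ : X → Type*} [TopologicalSpace (TotalSpace (EuclideanSpace ℝ (Fin 2)) ξ)]
    [∀ x, NormedAddCommGroup (ξ x)] [∀ x, InnerProductSpace ℝ (ξ x)]
    [FiberBundle (EuclideanSpace ℝ (Fin 2)) ξ]
    [VectorBundle ℝ (EuclideanSpace ℝ (Fin 2)) ξ]
    [ContMDiffVectorBundle ∞ (EuclideanSpace ℝ (Fin 2)) ξ (𝓡 d)]
    [IsContMDiffRiemannianBundle (𝓡 d) ∞ (EuclideanSpace ℝ (Fin 2)) ξ]
    (covξ : CovariantDerivative (𝓡 d) (EuclideanSpace ℝ (Fin 2)) ξ)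
    (hcovξ : CovariantDerivative.ContMDiffCovariantDerivative covξ ∞) (hξ : covξ.IsMetricCompatible)
    (o : BundleOrientation (EuclideanSpace ℝ (Fin 2)) ξ 2) (x : X) :
    let D := curvatureData covT covW covξ o x
    let p : CForm (TangentSpace (𝓡 d) x) := (D.pDiff : CForm (TangentSpace (𝓡 d) x))
    -- convergence of the q-series
    (QConverges D.chΘ₁ ∧ QConverges D.chΘ₂) ∧
    -- dimension 8m + 4
    (d = 8 * m + 4 →
      let P₁ := D.form₁ l (8 * m + 4)
      let P₂ := D.form₂ (8 * m + 4)
      let Ξ₂ := D.form₃ (8 * m)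
      IsModularFormValued (CongruenceSubgroup.Gamma0 2) (4 * m + 2) P₁ ∧
      IsModularFormValued GammaUpper0 (4 * m + 2) (fun τ => P₂ τ + p * Ξ₂ τ) ∧
      ∀ τ τ' : UpperHalfPlane, (τ' : ℂ) = -1 / (τ : ℂ) →
        P₁ τ' = ((2 : ℂ) ^ l * (τ : ℂ) ^ (4 * m + 2)) • (P₂ τ + p * Ξ₂ τ)) ∧
    -- dimension 8m
    (d = 8 * m →
      let Q₁ := D.form₁ l (8 * m)
      let Q₂ := D.form₂ (8 * m)
      let Pi₂ := D.form₃ (8 * m - 4)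
      IsModularFormValued (CongruenceSubgroup.Gamma0 2) (4 * m) Q₁ ∧
      IsModularFormValued GammaUpper0 (4 * m) (fun τ => Q₂ τ + p * Pi₂ τ) ∧
      ∀ τ τ' : UpperHalfPlane, (τ' : ℂ) = -1 / (τ : ℂ) →
        Q₁ τ' = ((2 : ℂ) ^ l * (τ : ℂ) ^ (4 * m)) • (Q₂ τ + p * Pi₂ τ)) := by
  intro D p
  have hD : D.IsMetric :=
    { memT := curvatureMatrix_mem covT x _
      memW := curvatureMatrix_mem covW x _
      memξ := curvatureMatrix_mem covξ x _
      skewT := curvatureMatrix_transpose hcovT hLC.1 x _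
      skewW := curvatureMatrix_transpose hcovW hW x _
      skewξ := curvatureMatrix_transpose hcovξ hξ x _ }
  have : FiniteDimensional ℝ (TangentSpace (𝓡 d) x) :=
    inferInstanceAs (FiniteDimensional ℝ (EuclideanSpace ℝ (Fin d)))
  refine ⟨(hD.exists_gradedPair l).1, fun _ => ?_, fun _ => ?_⟩
  · have h := hD.modular l (4 * m + 2) (j := 8 * m + 4) (by push_cast; ring)
    rw [show (8 * (m : ℤ) + 4 - 4) = 8 * m by ring] at h
    exact_mod_cast h
  · have h := hD.modular l (4 * m) (j := 8 * m) (by push_cast; ring)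
    exact_mod_cast h
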